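/- Let $\mathfrak l=\mathfrak g\oplus V$ be the Lie algebra decomposition of a compact symmetric space: $\mathfrak l$ is a compact semisimple real Lie algebra, $\mathfrak g$ is a subalgebra, $V$ is a complementary subspace, $[\mathfrak g,V]\subseteq V$ and $[V,V]\subseteq\mathfrak g$. Let $\langle\ ,\ \rangle$ be the negative of the Killing form of $\mathfrak l$, and let $G$ be the connected group generated by $\exp(\mathrm{ad}\,X)$, $X\in\mathfrak g$, acting on $V$ (the isotropy representation) and on $\mathfrak l$. Let $\Sigma\subseteq V$ be a maximal abelian subspace. For $\lambda\in\Sigma^*$ let $\mathfrak l_\lambda=\{X\in\mathfrak l:[H,[H,X]]=-\lambda(H)^2X\ \text{for all } H\in\Sigma\}$; the restricted roots are the $\lambda\neq0$ with $\mathfrak l_\lambda\ne0$. Let $C^o\subset\Sigma$ be an open chamber, i.e. a connected component of the complement of all walls $\{\lambda=0\}$, let $C$ be its closure, and let $R$ be the (finite) set of restricted roots that are positive on $C^o$. Let $A\in C^o$ and $\alpha\in V$, and let $J\ni 0$ be the connected component of $0$ in the set of all $t$ for which the orbit $G.(A+t\alpha)$ meets $C^o$. Then $J$ is open, and: (a)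 For $t\in J$ the orbit of $A+t\alpha$ meets $C$ in exactly one point $A(t)$, which lies in $C^o$ (so $t\mapsto A(t)$ is the ballistic curve, the projection of the straight line to the chamber), and $t\mapsto A(t)$ is twice differentiable on $J$. (b) There is a differentiable curve $k:J\to G$ with $k(0)=1$ and $k(t).(A+t\alpha)=A(t)$ such that the correspondingly transported momentum $$Y(t)=k(t).[A,\alpha]=[A(t),k(t).\alpha]$$ has a decomposition $Y(t)=\sum_{\lambda\in R}Y_\lambda(t)$ with $Y_\lambda(t)\in\mathfrak l_\lambda\cap\mathfrak g$, and, with $Z(t)=\sum_{\lambda\in R}Y_\lambda(t)/\lambda(A(t))^2$, the following equations hold for all $t\in J$: $$\langle\ddot A,\ \cdot\ \rangle=\sum_{\lambda\in R}\frac{\|Y_\lambda\|^2}{\lambda(A)^3}\,\lambda\ \in\Sigma^*,\qquad \dot Y=[Y,Z].$$ This is a Calogero–Moser system with spin attached to the restricted root system: the energy of the line is $$\tfrac12\|\alpha\|^2=\tfrac12\|\dot A\|^2+\tfrac12\sum_{\lambda\in R}\frac{\|Y_\lambda\|^2}{\lambda(A)^2}.$$ -/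

import Mathlib

open Set

/-- `L = 𝔤 ⊕ V` is the Lie algebra decomposition of a compact symmetric space: `L` is a compact
semisimple Lie algebra (its Killing form is negative definite), `𝔤` is a subalgebra, `V` is a
complementary subspace, `[𝔤, V] ⊆ V` and `[V, V] ⊆ 𝔤`.  (These relations force `𝔤 ⟂ V` for the
Killing form.) -/
structure IsCompactSymmetricPair {L : Type*} [LieRing L] [LieAlgebra ℝ L]
    (𝔤 : LieSubalgebra ℝ L) (V : Submodule ℝ L) : Prop where
  killing_neg : ∀ x : L, x ≠ 0 → killingForm ℝ L x x < 0
  isCompl : IsCompl 𝔤.toSubmodule V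
  lie_mem_V : ∀ x ∈ 𝔤, ∀ v ∈ V, ⁅x, v⁆ ∈ V
  lie_mem_g : ∀ v ∈ V, ∀ w ∈ V, ⁅v, w⁆ ∈ 𝔤

/-- The invariant inner product on `L`: minus the Killing form. -/
noncomputable def negKilling {L : Type*} [LieRing L] [LieAlgebra ℝ L] (x y : L) : ℝ :=
  -killingForm ℝ L x y

/-- The connected isotropy group, acting on `L` by the adjoint action: the group of linear
automorphisms of `L` that is generated by the exponentials
`exp (ad X) = ∑ₙ (ad X)ⁿ / n!` with `X ∈ 𝔤`. -/
def isotropyGroup {L : Type*} [LieRing L] [LieAlgebra ℝ L] [TopologicalSpace L]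
    (𝔤 : LieSubalgebra ℝ L) : Subgroup (L ≃ₗ[ℝ] L) :=
  Subgroup.closure {φ | ∃ X ∈ 𝔤, ∀ v : L,
    HasSum (fun n : ℕ => (n.factorial : ℝ)⁻¹ • ((LieAlgebra.ad ℝ L X) ^ n) v) (φ v)}

/-- A section of the isotropy representation: a maximal abelian subspace `S` of `V`. -/
structure IsMaximalAbelian {L : Type*} [LieRing L] [LieAlgebra ℝ L]
    (V S : Submodule ℝ L) : Prop where
  le : S ≤ V
  abelian : ∀ x ∈ S, ∀ y ∈ S, ⁅x, y⁆ = 0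
  maximal : ∀ x ∈ V, (∀ y ∈ S, ⁅x, y⁆ = 0) → x ∈ S

/-- The real restricted root space
`L_μ = {x | [H, [H, x]] = -μ(H)² x for all H ∈ S}` (so that `L_μ = L_{-μ}`). -/
def rootSpace {L : Type*} [LieRing L] [LieAlgebra ℝ L] {S : Submodule ℝ L}
    (μ : Module.Dual ℝ S) : Submodule ℝ L where
  carrier := {x | ∀ H : S, ⁅(H : L), ⁅(H : L), x⁆⁆ = -(μ H) ^ 2 • x}
  add_mem' := by
    intro x y hx hy H
    rw [lie_add, lie_add, hx H, hy H, smul_add]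
  zero_mem' := by
    intro H
    simp
  smul_mem' := by
    intro c x hx H
    rw [lie_smul, lie_smul, hx H, smul_comm]

/-- The restricted roots of `L` with respect to `S` (both `μ` and `-μ` occur). -/
def IsRestrictedRoot {L : Type*} [LieRing L] [LieAlgebra ℝ L] {S : Submodule ℝ L}
    (μ : Module.Dual ℝ S) : Prop :=
  μ ≠ 0 ∧ rootSpace μ ≠ ⊥

/-- The complement in `S` of all the walls. -/
def regularSet {L : Type*} [LieRing L] [LieAlgebra ℝ L] (S : Submodule ℝ L) : Set S :=
  {H | ∀ μ : Module.Dual ℝ S, IsRestrictedRoot μ → μ H ≠ 0}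

/-- An open chamber in `S`: a connected component of the complement of the walls. -/
def IsOpenChamber {L : Type*} [LieRing L] [LieAlgebra ℝ L] [TopologicalSpace L]
    {S : Submodule ℝ L} (C : Set S) : Prop :=
  ∃ H ∈ regularSet S, C = connectedComponentIn (regularSet S) H

/-- The restricted roots which are positive on the open chamber `C`: one out of each pair `±μ`. -/
def IsPositiveRoot {L : Type*} [LieRing L] [LieAlgebra ℝ L] {S : Submodule ℝ L}
    (C : Set S) (μ : Module.Dual ℝ S) : Prop :=
  IsRestrictedRoot μ ∧ ∀ H ∈ C, 0 < μ H

/-- `x` lies in the orbit of `v` under the isotropy group. -/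
def SameOrbit {L : Type*} [LieRing L] [LieAlgebra ℝ L] [TopologicalSpace L]
    (𝔤 : LieSubalgebra ℝ L) (v x : L) : Prop :=
  ∃ φ ∈ isotropyGroup 𝔤, φ v = x

/-- The times at which the projection of the line `A + t α` to the chamber lies in the open
chamber `C`. -/
def regularTimes {L : Type*} [LieRing L] [LieAlgebra ℝ L] [TopologicalSpace L]
    (𝔤 : LieSubalgebra ℝ L) {S : Submodule ℝ L} (C : Set S) (A α : L) : Set ℝ :=
  {t | ∃ x ∈ C, SameOrbit 𝔤 (A + t • α) (x : L)}

open Topology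
set_option linter.unusedSectionVars false

/-! Write `x = A + tα`. At a regular time, `x` is conjugate to a regular element of `S`. The motion
along orbits is removed by a moving frame `K` in the isotropy group with `K' = K ad η`. Since `(K
x)' = K (α + [η, x])`, the point `K x` can stay in `S` if `α + [η, x]` commutes with `x`, that is,
if `[x, [x, η]] = [x, α] = [A, α]`. The solution `η` in the image of `ad x` comes from a generalized
inverse that is a polynomial in `(ad x)²`, with coefficients read off the characteristic polynomial.
The multiplicity of the eigenvalue `0` is the same at all regular times, so this inverse is `C¹` in
`t` (`exists_contDiffAt_inverse`). The frame equation is solved inside the group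
(`exists_local_lift`, `exists_lift_of_local`), and uniqueness for a linear equation gives `[K x, S]
= 0`, hence `K x ∈ S` (`lift_mem`).

With `a = K x`, `Y = K [A, α]` and `Z = -K η` one has `Y' = [Y, Z]` and `[a, [a, Z]] = -Y`, so the
root components of `Z` are those of `Y` divided by `λ(a)²`. Invariance of the Killing form makes
`[·, a]` orthogonal to `S`, so `a'` is the projection of `K α` to `S`, and `K α = a' + [Z, a]` is an
orthogonal splitting, which is the energy formula.

The regular times are open because `V = S + [𝔤, a]` at a regular `a`, so that `(X, H) ↦ exp (ad X)
H` is open there.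

That an orbit through an open chamber meets the closed one only once is a highest weight argument in
the dual (noncompact) symmetric Lie algebra. For `h` in the closed chamber, the sum `Λ_h` of the
weights positive on `h` is the top eigenvalue functional of a module of multilinear forms that is
stable under the group. Hence `Λ_h(φ a) ≤ Λ_h(a)` whenever `φ a ∈ S` (`sum_weights_le`). Applied to
`φ` and to its inverse this gives equality, and a linear map that preserves the closed chamber and
all `Λ_h` fixes the chamber pointwise (`eq_self_of_mem_cone`). -/

theorem Set.OrdConnected.exists_Icc_subset_of_isOpen {J : Set ℝ} (hJ : J.OrdConnected)
    (hJo : IsOpen J) {t t₀ : ℝ} (ht : t ∈ J) (ht₀ : t₀ ∈ J) :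
    ∃ a b, Icc a b ⊆ J ∧ t ∈ Ioo a b ∧ t₀ ∈ Ioo a b := by
  obtain ⟨ε, hε, h1⟩ := Metric.isOpen_iff.1 hJo (min t t₀)
    (by rcases min_choice t t₀ with h | h <;> rwa [h])
  obtain ⟨δ, hδ, h2⟩ := Metric.isOpen_iff.1 hJo (max t t₀)
    (by rcases max_choice t t₀ with h | h <;> rwa [h])
  rw [Real.ball_eq_Ioo] at h1 h2
  have := min_le_left t t₀
  have := min_le_right t t₀
  have := le_max_left t t₀
  have := le_max_right t t₀
  refine ⟨min t t₀ - ε / 2, max t t₀ + δ / 2, hJ.out (h1 ⟨?_, ?_⟩) (h2 ⟨?_, ?_⟩),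
    ⟨?_, ?_⟩, ⟨?_, ?_⟩⟩ <;> linarith

/-! ### Curves in a group generated by exponentials -/

section NormedAlgebra

open NormedSpace

variable {𝔸 : Type*} [NormedRing 𝔸] [NormedAlgebra ℝ 𝔸]

theorem exp_mul_exp_neg [CompleteSpace 𝔸] (X : 𝔸) : exp X * exp (-X) = 1 := by
  let _ : NormedAlgebra ℚ 𝔸 := NormedAlgebra.restrictScalars ℚ ℝ 𝔸
  rw [← exp_add_of_commute ((Commute.refl X).neg_right), add_neg_cancel, exp_zero]

theorem exp_neg_mul_exp [CompleteSpace 𝔸] (X : 𝔸) : exp (-X) * exp X = 1 := by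
  simpa using exp_mul_exp_neg (-X)

theorem contDiff_exp_smul [CompleteSpace 𝔸] {E : Type*} [NormedAddCommGroup E]
    [NormedSpace ℝ E] {n : WithTop ℕ∞}
    {f : E → ℝ} (hf : ContDiff ℝ n f) (X : 𝔸) : ContDiff ℝ n fun x ↦ exp (f x • X) := by
  have h : ContDiff ℝ n (exp : 𝔸 → 𝔸) := by
    rw [contDiff_iff_contDiffAt]
    exact fun x ↦ (exp_analytic (𝕂 := ℝ) x).contDiffAt
  exact h.comp (hf.smul contDiff_const)

/-- Canonical coordinates of the second kind, with their left logarithmic derivatives. -/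
theorem exists_exp_coordinates [CompleteSpace 𝔸] (𝔥 : Submodule ℝ 𝔸)
    (hAd : ∀ x ∈ 𝔥, ∀ y ∈ 𝔥, exp x * y * exp (-x) ∈ 𝔥) (n : ℕ) (X : Fin n → 𝔸)
    (hX : ∀ i, X i ∈ 𝔥) :
    ∃ (Φ : (Fin n → ℝ) → 𝔸) (N : Fin n → (Fin n → ℝ) → 𝔸),
      (∀ i, ContDiff ℝ 1 (N i)) ∧ (∀ i, N i 0 = X i) ∧ (∀ i x, N i x ∈ 𝔥) ∧ Φ 0 = 1 ∧
      (∀ x, Φ x ∈ Submonoid.closure (exp '' (𝔥 : Set 𝔸))) ∧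
      ∀ x, HasFDerivAt Φ
        (∑ i, (ContinuousLinearMap.proj (R := ℝ) (φ := fun _ : Fin n ↦ ℝ) i).smulRight
          (Φ x * N i x)) x := by
  induction n with
  | zero =>
    refine ⟨fun _ ↦ 1, fun i ↦ i.elim0, fun i ↦ i.elim0, fun i ↦ i.elim0, fun i ↦ i.elim0, rfl,
      fun _ ↦ one_mem _, fun x ↦ ?_⟩
    simpa using hasFDerivAt_const (𝕜 := ℝ) (1 : 𝔸) x
  | succ n ih =>
    obtain ⟨Φ, N, hN, hN0, hNm, hΦ0, hΦm, hΦ⟩ := ih (fun i ↦ X i.succ) fun i ↦ hX _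
    let tl : (Fin (n + 1) → ℝ) →L[ℝ] (Fin n → ℝ) :=
      ContinuousLinearMap.pi fun i ↦ ContinuousLinearMap.proj i.succ
    have hp : ContDiff ℝ 1 fun x : Fin (n + 1) → ℝ ↦ x 0 :=
      (ContinuousLinearMap.proj (R := ℝ) (φ := fun _ : Fin (n + 1) ↦ ℝ) 0).contDiff
    -- A new right factor conjugates the earlier logarithmic derivatives by its inverse and
    -- contributes `X 0`; `hAd` keeps the conjugates in `𝔥`.
    refine ⟨fun x ↦ Φ (tl x) * exp (x 0 • X 0),
      Fin.cons (fun _ ↦ X 0) fun i x ↦ exp (-(x 0 • X 0)) * N i (tl x) * exp (x 0 • X 0),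
      ?_, ?_, ?_, ?_, ?_, ?_⟩
    · refine Fin.cases ?_ fun i ↦ ?_
      · simpa using contDiff_const
      · simp only [Fin.cons_succ]
        refine (ContDiff.mul ?_ ((hN i).comp tl.contDiff)).mul (contDiff_exp_smul hp _)
        simpa only [neg_smul] using contDiff_exp_smul hp.neg (X 0)
    · refine Fin.cases ?_ fun i ↦ ?_
      · simp
      · simp [hN0]
    · refine Fin.cases (fun x ↦ ?_) fun i x ↦ ?_
      · simpa using hX 0
      · simpa only [Fin.cons_succ, neg_neg] using
          hAd (-(x 0 • X 0)) (neg_mem (𝔥.smul_mem _ (hX 0))) _ (hNm i (tl x))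
    · simp [hΦ0]
    · exact fun x ↦ mul_mem (hΦm _) (Submonoid.subset_closure ⟨_, 𝔥.smul_mem _ (hX 0), rfl⟩)
    · intro x
      have h1 : HasFDerivAt (fun x ↦ Φ (tl x)) _ x := (hΦ (tl x)).comp x tl.hasFDerivAt
      have h2 : HasFDerivAt (fun x : Fin (n + 1) → ℝ ↦ exp (x 0 • X 0)) _ x :=
        HasFDerivAt.comp (g := fun u : ℝ ↦ exp (u • X 0)) x
          (hasDerivAt_exp_smul_const (𝕂 := ℝ) (X 0) (x 0)).hasFDerivAt
          (ContinuousLinearMap.proj (R := ℝ) (φ := fun _ : Fin (n + 1) ↦ ℝ) 0).hasFDerivAt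
      convert! h1.mul' h2 using 1
      ext v
      have key : ∀ m : 𝔸, exp (x 0 • X 0) * (exp (-(x 0 • X 0)) * m) = m := fun m ↦ by
        rw [← mul_assoc, exp_mul_exp_neg, one_mul]
      simp [Fin.sum_univ_succ, key, tl, Finset.sum_mul, mul_assoc]

/-- A solution of `k' = k ζ` in the ambient algebra need not visibly stay in the monoid generated by
`exp 𝔥`, which is not known to be closed. The equation is therefore solved in coordinates of the
second kind, where membership is automatic. -/
theorem exists_local_lift [CompleteSpace 𝔸] [FiniteDimensional ℝ 𝔸] (𝔥 : Submodule ℝ 𝔸)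
    (hAd : ∀ x ∈ 𝔥, ∀ y ∈ 𝔥, exp x * y * exp (-x) ∈ 𝔥) {ζ : ℝ → 𝔸} {t₀ : ℝ}
    (hζ : ContDiffAt ℝ 1 ζ t₀) (hm : ∀ᶠ t in 𝓝 t₀, ζ t ∈ 𝔥) :
    ∃ u : ℝ → 𝔸, u t₀ = 1 ∧ ∀ᶠ t in 𝓝 t₀,
      u t ∈ Submonoid.closure (exp '' (𝔥 : Set 𝔸)) ∧ HasDerivAt u (u t * ζ t) t := by
  let b := Module.finBasis ℝ 𝔥
  obtain ⟨Φ, N, hN, hN0, hNm, hΦ0, hΦm, hΦ⟩ :=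
    exists_exp_coordinates 𝔥 hAd _ (fun i ↦ (b i : 𝔸)) fun i ↦ (b i).2
  let T : (Fin (Module.finrank ℝ 𝔥) → ℝ) →ₗ[ℝ] 𝔸 := 𝔥.subtype ∘ₗ b.equivFun.symm.toLinearMap
  obtain ⟨c', hc'⟩ := LinearMap.exists_leftInverse_of_injective T
    (LinearMap.ker_eq_bot.2 (𝔥.injective_subtype.comp b.equivFun.symm.injective))
  let c := LinearMap.toContinuousLinearMap c'
  have hc : ∀ y ∈ 𝔥, T (c y) = y := by
    intro y hy
    have : T (b.equivFun ⟨y, hy⟩) = y := by simp [T]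
    rw [← this]
    exact congrArg T (LinearMap.congr_fun hc' _)
  have hcT : ∀ v, c (T v) = v := fun v ↦ LinearMap.congr_fun hc' v
  let M : (Fin (Module.finrank ℝ 𝔥) → ℝ) → (Fin (Module.finrank ℝ 𝔥) → ℝ) →L[ℝ] 𝔸 := fun x ↦
    ∑ i, (ContinuousLinearMap.proj (R := ℝ) (φ := fun _ ↦ ℝ) i).smulRight (N i x)
  let m : (Fin (Module.finrank ℝ 𝔥) → ℝ) →
      (Fin (Module.finrank ℝ 𝔥) → ℝ) →L[ℝ] (Fin (Module.finrank ℝ 𝔥) → ℝ) := fun x ↦ c.comp (M x)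
  have hM : ContDiff ℝ 1 M := by
    refine ContDiff.sum fun i _ ↦ ?_
    exact contDiff_const.smulRight (hN i)
  have hmC : ContDiff ℝ 1 m := contDiff_const.clm_comp hM
  have hm0 : m 0 = 1 := by
    ext1 v
    have : M 0 v = T v := by simp [M, T, hN0, Module.Basis.equivFun_symm_apply]
    simp [m, this, hcT]
  -- The second component is time, which makes the field autonomous. The first solves `M(σ) σ' = ζ`
  -- through the left inverse `c`; `Ring.inverse` is a true inverse near `0` because `m 0 = 1`.
  let F : (Fin (Module.finrank ℝ 𝔥) → ℝ) × ℝ → (Fin (Module.finrank ℝ 𝔥) → ℝ) × ℝ := fun z ↦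
    (Ring.inverse (m z.1) (c (ζ z.2)), 1)
  have hF : ContDiffAt ℝ 1 F (0, t₀) := by
    refine ContDiffAt.prodMk (ContDiffAt.clm_apply ?_ ?_) contDiffAt_const
    · have h1 : ContDiffAt ℝ 1 Ring.inverse (m ((0 : Fin (Module.finrank ℝ 𝔥) → ℝ), t₀).1) := by
        have := contDiffAt_ringInverse ℝ (n := 1)
          (1 : ((Fin (Module.finrank ℝ 𝔥) → ℝ) →L[ℝ] (Fin (Module.finrank ℝ 𝔥) → ℝ))ˣ)
        simpa [hm0] using this
      exact h1.comp (f := fun z : (Fin (Module.finrank ℝ 𝔥) → ℝ) × ℝ ↦ m z.1) _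
        (hmC.contDiffAt.comp _ contDiffAt_fst)
    · exact c.contDiff.contDiffAt.comp _
        (ContDiffAt.comp (g := ζ) (f := Prod.snd)
          ((0 : Fin (Module.finrank ℝ 𝔥) → ℝ), t₀) hζ contDiffAt_snd)
  obtain ⟨σ, hσ0, ε, hε, hσ⟩ :=
    hF.exists_forall_mem_closedBall_exists_eq_forall_mem_Ioo_hasDerivAt₀ t₀
  have hI : ∀ᶠ t in 𝓝 t₀, t ∈ Ioo (t₀ - ε) (t₀ + ε) :=
    Ioo_mem_nhds (by linarith) (by linarith)
  have h1 : ∀ t ∈ Ioo (t₀ - ε) (t₀ + ε), HasDerivAt (fun t ↦ (σ t).1) (F (σ t)).1 t :=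
    fun t ht ↦ (hσ t ht).fst
  have h2 : ∀ t ∈ Ioo (t₀ - ε) (t₀ + ε), (σ t).2 = t := by
    intro t ht
    have hd : ∀ s ∈ Ioo (t₀ - ε) (t₀ + ε), HasDerivAt (fun t ↦ (σ t).2 - t) 0 s := by
      intro s hs
      have h : HasDerivAt (fun t ↦ (σ t).2) 1 s := (hσ s hs).snd
      simpa only [sub_self] using h.fun_sub (hasDerivAt_id' s)
    have := isOpen_Ioo.is_const_of_deriv_eq_zero isPreconnected_Ioo
      (fun s hs ↦ (hd s hs).differentiableAt.differentiableWithinAt)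
      (fun s hs ↦ (hd s hs).deriv) ht (y := t₀) ⟨by linarith, by linarith⟩
    simp only [hσ0, sub_self] at this
    linarith
  have hu : ∀ᶠ t in 𝓝 t₀, IsUnit (m (σ t).1) := by
    have hcont : ContinuousAt (fun t ↦ m (σ t).1) t₀ :=
      hmC.continuous.continuousAt.comp
        (h1 t₀ ⟨by linarith, by linarith⟩).continuousAt
    refine hcont.eventually_mem (Units.isOpen.mem_nhds ?_)
    simp [hσ0, hm0]
  refine ⟨fun t ↦ Φ (σ t).1, by simp [hσ0, hΦ0], ?_⟩
  filter_upwards [hI, hu, hm] with t ht hut hmt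
  refine ⟨hΦm _, ?_⟩
  have h3 := (hΦ (σ t).1).comp_hasDerivAt t (h1 t ht)
  convert! h3 using 1
  have h4 : M (σ t).1 (F (σ t)).1 = ζ t := by
    have hmem : M (σ t).1 (F (σ t)).1 ∈ 𝔥 := by
      simp only [M, sum_apply, ContinuousLinearMap.smulRight_apply]
      exact sum_mem fun i _ ↦ 𝔥.smul_mem _ (hNm i _)
    rw [← hc _ hmem, ← hc _ hmt]
    congr 1
    change m (σ t).1 (Ring.inverse (m (σ t).1) (c (ζ (σ t).2))) = _
    rw [h2 t ht, ← mul_apply_eq_comp, Ring.mul_inverse_cancel _ hut]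
    rfl
  rw [← h4]
  simp [M, Finset.mul_sum]

theorem eqOn_of_linear_ode {E : Type*} [NormedAddCommGroup E] [NormedSpace ℝ E] {J : Set ℝ}
    (hJo : IsOpen J) (hJ : J.OrdConnected) {M : ℝ → E →L[ℝ] E} (hM : ContinuousOn M J)
    {f g : ℝ → E} (hf : ∀ t ∈ J, HasDerivAt f (M t (f t)) t)
    (hg : ∀ t ∈ J, HasDerivAt g (M t (g t)) t) {t₀ : ℝ} (ht₀ : t₀ ∈ J) (h : f t₀ = g t₀) :
    EqOn f g J := by
  intro t ht
  obtain ⟨a, b, hab, hat, hat₀⟩ := hJ.exists_Icc_subset_of_isOpen hJo ht ht₀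
  obtain ⟨K, hK⟩ := isCompact_Icc.exists_bound_of_continuousOn (hM.mono hab)
  have hK' : ∀ s ∈ Ioo a b, ‖M s‖₊ ≤ K.toNNReal := fun s hs ↦ by
    rw [← NNReal.coe_le_coe, coe_nnnorm]
    exact (hK s (Ioo_subset_Icc_self hs)).trans (Real.le_coe_toNNReal K)
  exact ODE_solution_unique_of_mem_Ioo (v := fun s x ↦ M s x) (s := fun _ ↦ univ)
    (K := K.toNNReal)
    (fun s hs ↦ ((M s).lipschitz.weaken (hK' s hs)).lipschitzOnWith) hat₀
    (fun s hs ↦ ⟨hf s (hab (Ioo_subset_Icc_self hs)), mem_univ _⟩)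
    (fun s hs ↦ ⟨hg s (hab (Ioo_subset_Icc_self hs)), mem_univ _⟩) h hat

/-- `k` solves `k' = k ζ` at time `t`, with value in `𝒢`. -/
def IsLiftAt (𝒢 : Submonoid 𝔸) (ζ k : ℝ → 𝔸) (t : ℝ) : Prop :=
  k t ∈ 𝒢 ∧ HasDerivAt k (k t * ζ t) t

theorem IsLiftAt.const_mul {𝒢 : Submonoid 𝔸} {ζ k : ℝ → 𝔸} {t : ℝ} (h : IsLiftAt 𝒢 ζ k t)
    {g : 𝔸} (hg : g ∈ 𝒢) : IsLiftAt 𝒢 ζ (fun s ↦ g * k s) t :=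
  ⟨mul_mem hg h.1, by simpa only [mul_assoc] using h.2.const_mul g⟩

theorem IsLiftAt.concat {𝒢 : Submonoid 𝔸} {ζ k₁ k₂ : ℝ → 𝔸} {a b c : ℝ} (hab : a ≤ b) (hbc : b ≤ c)
    (h₁ : ∀ t ∈ Icc a b, IsLiftAt 𝒢 ζ k₁ t) (h₂ : ∀ t ∈ Icc b c, IsLiftAt 𝒢 ζ k₂ t)
    (h : k₁ b = k₂ b) :
    ∀ t ∈ Icc a c, IsLiftAt 𝒢 ζ (fun t ↦ if t ≤ b then k₁ t else k₂ t) t := by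
  intro t ht
  rcases lt_trichotomy t b with hlt | rfl | hlt
  · refine ⟨by simpa [hlt.le] using (h₁ t ⟨ht.1, hlt.le⟩).1, ?_⟩
    simp only [hlt.le, if_true]
    refine (h₁ t ⟨ht.1, hlt.le⟩).2.congr_of_eventuallyEq ?_
    filter_upwards [Iio_mem_nhds hlt] with s hs
    simp [(mem_Iio.1 hs).le]
  · refine ⟨by simpa using (h₁ t ⟨ht.1, le_rfl⟩).1, ?_⟩
    simp only [le_rfl, if_true]
    rw [← hasDerivWithinAt_univ, ← Iic_union_Ici (a := t)]
    refine HasDerivWithinAt.union ?_ ?_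
    · refine (h₁ t ⟨ht.1, le_rfl⟩).2.hasDerivWithinAt.congr (fun s hs ↦ ?_) (by simp)
      simp [mem_Iic.1 hs]
    · rw [h]
      refine (h₂ t ⟨le_rfl, ht.2⟩).2.hasDerivWithinAt.congr (fun s hs ↦ ?_) (by simp [h])
      rcases eq_or_lt_of_le (mem_Ici.1 hs) with rfl | hs
      · simp [h]
      · simp [not_le.2 hs]
  · refine ⟨by simpa [not_le.2 hlt] using (h₂ t ⟨hlt.le, ht.2⟩).1, ?_⟩
    simp only [not_le.2 hlt, if_false]
    refine (h₂ t ⟨hlt.le, ht.2⟩).2.congr_of_eventuallyEq ?_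
    filter_upwards [Ioi_mem_nhds hlt] with s hs
    simp [not_le.2 (mem_Ioi.1 hs)]

/-- Local solutions of `k' = k ζ` with values in a group glue to a global one. -/
theorem exists_lift_of_local {𝒢 : Submonoid 𝔸} (h𝒢 : ∀ g ∈ 𝒢, ∃ g' ∈ 𝒢, g' * g = 1 ∧ g * g' = 1)
    {J : Set ℝ} (hJo : IsOpen J) (hJ : IsPreconnected J) {t₀ : ℝ} (ht₀ : t₀ ∈ J)
    {ζ : ℝ → 𝔸} (hζ : ContinuousOn ζ J)
    (hloc : ∀ s ∈ J, ∃ u : ℝ → 𝔸, ∀ᶠ t in 𝓝 s, IsLiftAt 𝒢 ζ u t) :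
    ∃ k : ℝ → 𝔸, k t₀ = 1 ∧ ∀ t ∈ J, IsLiftAt 𝒢 ζ k t := by
  have hJc := hJ.ordConnected
  have htrans : ∀ {a b c : ℝ}, a ≤ b → b ≤ c → (∃ k, ∀ t ∈ Icc a b, IsLiftAt 𝒢 ζ k t) →
      (∃ k, ∀ t ∈ Icc b c, IsLiftAt 𝒢 ζ k t) → ∃ k, ∀ t ∈ Icc a c, IsLiftAt 𝒢 ζ k t := by
    rintro a b c hab hbc ⟨k₁, h₁⟩ ⟨k₂, h₂⟩
    obtain ⟨g, hg, hg1, -⟩ := h𝒢 _ (h₂ b ⟨le_rfl, hbc⟩).1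
    have hm : k₁ b * g ∈ 𝒢 := mul_mem (h₁ b ⟨hab, le_rfl⟩).1 hg
    exact ⟨_, IsLiftAt.concat hab hbc h₁ (fun t ht ↦ (h₂ t ht).const_mul hm)
      (by rw [mul_assoc, hg1, mul_one])⟩
  have key : ∀ a ∈ J, ∀ b ∈ J, ∃ k, ∀ t ∈ uIcc a b, IsLiftAt 𝒢 ζ k t := by
    intro a ha b hb
    -- Having a lift on the segment between two points is a local, symmetric and transitive
    -- relation. For transitivity, either the middle point lies between the others and lifts are
    -- concatenated after a left translation, or one given segment already contains the wanted one.
    refine hJ.induction₂ (fun a b ↦ ∃ k, ∀ t ∈ uIcc a b, IsLiftAt 𝒢 ζ k t) ?_ ?_ ?_ ha hb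
    · intro x hx
      obtain ⟨u, hu⟩ := hloc x hx
      obtain ⟨ε, hε, hu⟩ := Metric.eventually_nhds_iff_ball.1 hu
      filter_upwards [mem_nhdsWithin_of_mem_nhds (Metric.ball_mem_nhds x hε)] with y hy
      refine ⟨u, fun t ht ↦ hu t ?_⟩
      rw [Real.ball_eq_Ioo] at hy ⊢
      exact ordConnected_Ioo.uIcc_subset ⟨by linarith, by linarith⟩ hy ht
    · rintro x y z _ _ _ ⟨k₁, h₁⟩ ⟨k₂, h₂⟩
      by_cases hxy : y ∈ uIcc x z
      · rcases le_total x z with hxz | hxz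
        · rw [uIcc_of_le hxz] at hxy ⊢
          rw [uIcc_of_le hxy.1] at h₁
          rw [uIcc_of_le hxy.2] at h₂
          exact htrans hxy.1 hxy.2 ⟨k₁, h₁⟩ ⟨k₂, h₂⟩
        · rw [uIcc_of_ge hxz] at hxy ⊢
          rw [uIcc_of_ge hxy.2] at h₁
          rw [uIcc_of_ge hxy.1] at h₂
          exact htrans hxy.1 hxy.2 ⟨k₂, h₂⟩ ⟨k₁, h₁⟩
      · by_cases hx : x ∈ uIcc y z
        · exact ⟨k₂, fun t ht ↦ h₂ t (uIcc_subset_uIcc hx right_mem_uIcc ht)⟩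
        · have hz : z ∈ uIcc x y := by
            rw [mem_uIcc] at *
            grind
          exact ⟨k₁, fun t ht ↦ h₁ t (uIcc_subset_uIcc left_mem_uIcc hz ht)⟩
    · rintro x y _ _ ⟨k, hk⟩
      exact ⟨k, by rwa [uIcc_comm]⟩
  have key2 : ∀ t ∈ J, ∃ a b, ∃ k : ℝ → 𝔸, t ∈ Ioo a b ∧ t₀ ∈ Ioo a b ∧ Icc a b ⊆ J ∧ k t₀ = 1 ∧
      ∀ s ∈ Ioo a b, IsLiftAt 𝒢 ζ k s := by
    intro t ht
    obtain ⟨a, b, hab, hat, hat₀⟩ := hJc.exists_Icc_subset_of_isOpen hJo ht ht₀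
    have hle : a ≤ b := (hat.1.trans hat.2).le
    obtain ⟨k, hk⟩ := key a (hab ⟨le_rfl, hle⟩) b (hab ⟨hle, le_rfl⟩)
    rw [uIcc_of_le hle] at hk
    obtain ⟨g, hg, hg1, -⟩ := h𝒢 _ (hk t₀ (Ioo_subset_Icc_self hat₀)).1
    exact ⟨a, b, fun s ↦ g * k s, hat, hat₀, hab, hg1,
      fun s hs ↦ (hk s (Ioo_subset_Icc_self hs)).const_mul hg⟩
  choose! a b k hat hat₀ hab hk1 hk using key2
  -- All lifts are normalized at `t₀`, so uniqueness for the linear equation makes them agree on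
  -- overlaps, and the diagonal `t ↦ k t t` is again a lift.
  have hcoh : ∀ t ∈ J, ∀ s ∈ Ioo (a t) (b t), k s s = k t s := by
    intro t ht s hs
    have hsJ := hab t ht (Ioo_subset_Icc_self hs)
    have hsub : Ioo (max (a s) (a t)) (min (b s) (b t)) = Ioo (a s) (b s) ∩ Ioo (a t) (b t) :=
      Ioo_inter_Ioo.symm
    refine eqOn_of_linear_ode (J := Ioo (a s) (b s) ∩ Ioo (a t) (b t))
      (M := fun r ↦ (ContinuousLinearMap.mul ℝ 𝔸).flip (ζ r)) (isOpen_Ioo.inter isOpen_Ioo)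
      (ordConnected_Ioo.inter ordConnected_Ioo)
      ((ContinuousLinearMap.continuous _).comp_continuousOn (hζ.mono ?_)) ?_ ?_
      (t₀ := t₀) ⟨hat₀ s hsJ, hat₀ t ht⟩ ?_ ⟨hat s hsJ, hs⟩
    · exact fun r hr ↦ hab t ht (Ioo_subset_Icc_self hr.2)
    · exact fun r hr ↦ (hk s hsJ r hr.1).2
    · exact fun r hr ↦ (hk t ht r hr.2).2
    · rw [hk1 s hsJ, hk1 t ht]
  refine ⟨fun t ↦ k t t, hk1 t₀ ht₀, fun t ht ↦ ⟨(hk t ht t (hat t ht)).1, ?_⟩⟩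
  refine (hk t ht t (hat t ht)).2.congr_of_eventuallyEq ?_
  filter_upwards [Ioo_mem_nhds (hat t ht).1 (hat t ht).2] with s hs
  exact hcoh t ht s hs

end NormedAlgebra

/-! ### A normed algebra structure on endomorphisms -/

section EndNorm

variable {M : Type*} [AddCommGroup M] [Module ℝ M] [FiniteDimensional ℝ M]

attribute [local instance] Matrix.linftyOpNormedRing Matrix.linftyOpNormedAlgebra in
/-- A norm on the endomorphism ring of a finite-dimensional real vector space. -/
@[reducible] noncomputable def Module.End.normedRing : NormedRing (Module.End ℝ M) :=
  NormedRing.induced (Module.End ℝ M) _ (LinearMap.toMatrixAlgEquiv (Module.finBasis ℝ M))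
    (LinearMap.toMatrixAlgEquiv (Module.finBasis ℝ M)).injective

attribute [local instance] Module.End.normedRing

attribute [local instance] Matrix.linftyOpNormedRing Matrix.linftyOpNormedAlgebra in
@[reducible] noncomputable def Module.End.normedAlgebra : NormedAlgebra ℝ (Module.End ℝ M) :=
  NormedAlgebra.induced ℝ (Module.End ℝ M) _ (LinearMap.toMatrixAlgEquiv (Module.finBasis ℝ M))

end EndNorm

attribute [local instance] Module.End.normedRing Module.End.normedAlgebra

/-! ### From the normed algebra of endomorphisms to a topological vector space -/

section Bridge

variable {M : Type*} [AddCommGroup M] [Module ℝ M] [TopologicalSpace M]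
  [IsTopologicalAddGroup M] [ContinuousSMul ℝ M]

/-- `L` carries a vector topology and no norm. Curves are differentiated in the normed algebra `End
L` and reach `L` through linear maps. -/
theorem HasDerivAt.linearMap_comp {F : Type*} [NormedAddCommGroup F] [NormedSpace ℝ F]
    [FiniteDimensional ℝ F] (ℓ : F →ₗ[ℝ] M) {f : ℝ → F} {f' : F} {t : ℝ} (h : HasDerivAt f f' t) :
    HasDerivAt (fun s ↦ ℓ (f s)) (ℓ f') t := by
  let ℓ' : F →L[ℝ] M := ⟨ℓ, ℓ.continuous_of_finiteDimensional⟩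
  have h1 := (ℓ'.isBigOTVS_comp (f := _) (l := _)).trans_isLittleOTVS h.isLittleOTVS
  refine HasFDerivAtFilter.of_isLittleOTVS (h1.congr_left fun p ↦ ?_)
  simp [ℓ']

variable [FiniteDimensional ℝ M]

theorem Module.End.hasSum_exp_apply (X : Module.End ℝ M) (v : M) :
    HasSum (fun n : ℕ ↦ (n.factorial : ℝ)⁻¹ • (X ^ n) v) (NormedSpace.exp X v) := by
  have : CompleteSpace (Module.End ℝ M) := FiniteDimensional.complete ℝ _
  let ev : Module.End ℝ M →ₗ[ℝ] M := LinearMap.applyₗ v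
  have h := (NormedSpace.exp_series_hasSum_exp' (𝕂 := ℝ) X).map ev.toAddMonoidHom
    ev.continuous_of_finiteDimensional
  exact h

end Bridge

instance Module.End.completeSpace {M : Type*} [AddCommGroup M] [Module ℝ M]
    [FiniteDimensional ℝ M] : CompleteSpace (Module.End ℝ M) :=
  FiniteDimensional.complete ℝ _

/-! ### The isotropy group as automorphisms of the pair -/

section Isotropy

open NormedSpace LieAlgebra

variable {L : Type*} [LieRing L] [LieAlgebra ℝ L] [FiniteDimensional ℝ L]

/-- With `X` replaced by `s X`, the left side has derivative zero in `s`, because `ad X` is a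
derivation. This is the source of the fact that `exp (ad X)` is a Lie algebra automorphism. -/
theorem exp_neg_mul_ad_mul_exp (X u : L) :
    exp (-ad ℝ L X) * ad ℝ L (exp (ad ℝ L X) u) * exp (ad ℝ L X) = ad ℝ L u := by
  let ev : Module.End ℝ L →ₗ[ℝ] Module.End ℝ L := (ad ℝ L : L →ₗ[ℝ] Module.End ℝ L) ∘ₗ
    LinearMap.applyₗ u
  have h1 : ∀ t : ℝ, HasDerivAt (fun s : ℝ ↦ exp (s • ad ℝ L X))
      (ad ℝ L X * exp (t • ad ℝ L X)) t := hasDerivAt_exp_smul_const' _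
  have h2 : ∀ t : ℝ, HasDerivAt (fun s : ℝ ↦ exp (s • ad ℝ L X))
      (exp (t • ad ℝ L X) * ad ℝ L X) t := hasDerivAt_exp_smul_const _
  have h3 : ∀ t : ℝ, HasDerivAt (fun s : ℝ ↦ exp (s • -ad ℝ L X))
      (exp (t • -ad ℝ L X) * -ad ℝ L X) t := hasDerivAt_exp_smul_const _
  have hd : ∀ t : ℝ, HasDerivAt (fun s : ℝ ↦ exp (s • -ad ℝ L X) * ev (exp (s • ad ℝ L X)) *
      exp (s • ad ℝ L X)) 0 t := by
    intro t
    refine (((h3 t).fun_mul ((h2 t).linearMap_comp ev)).fun_mul (h1 t)).congr_deriv ?_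
    have : ev (ad ℝ L X * exp (t • ad ℝ L X)) =
        ad ℝ L X * ev (exp (t • ad ℝ L X)) - ev (exp (t • ad ℝ L X)) * ad ℝ L X := by
      ext v
      simp [ev]
    rw [(h2 t).unique (h1 t), this]
    noncomm_ring
  have := is_const_of_deriv_eq_zero (fun t ↦ (hd t).differentiableAt) (fun t ↦ (hd t).deriv) 1 0
  simpa [ev] using this

theorem exp_ad_lie (X u v : L) :
    exp (ad ℝ L X) ⁅u, v⁆ = ⁅exp (ad ℝ L X) u, exp (ad ℝ L X) v⁆ := by
  have h := congrArg (fun f ↦ (exp (ad ℝ L X) * f) v) (exp_neg_mul_ad_mul_exp X u)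
  simp only [← mul_assoc, exp_mul_exp_neg, one_mul] at h
  simpa using h.symm

theorem exp_mul_ad_mul_exp_neg (X u : L) :
    exp (ad ℝ L X) * ad ℝ L u * exp (-ad ℝ L X) = ad ℝ L (exp (ad ℝ L X) u) := by
  rw [← exp_neg_mul_ad_mul_exp X u]
  simp only [← mul_assoc, exp_mul_exp_neg, one_mul]
  rw [mul_assoc, exp_mul_exp_neg, mul_one]

/-- The exponential of an endomorphism, as a linear automorphism. -/
noncomputable def expEquiv (X : Module.End ℝ L) : L ≃ₗ[ℝ] L :=
  LinearEquiv.ofLinearMap (exp X) (exp (-X)) (exp_mul_exp_neg X) (exp_neg_mul_exp X)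

variable [TopologicalSpace L] [IsTopologicalAddGroup L] [ContinuousSMul ℝ L] [T2Space L]

theorem exp_apply_mem {X : Module.End ℝ L} {p : Submodule ℝ L} (h : ∀ v ∈ p, X v ∈ p) {v : L}
    (hv : v ∈ p) : exp X v ∈ p := by
  have hpow : ∀ n : ℕ, (X ^ n) v ∈ p := by
    intro n
    induction n with
    | zero => simpa using hv
    | succ n ih => rw [pow_succ', Module.End.mul_apply]; exact h _ ih
  exact p.closed_of_finiteDimensional.mem_of_tendsto (X.hasSum_exp_apply v)
    (Filter.Eventually.of_forall fun s ↦ sum_mem fun n _ ↦ p.smul_mem _ (hpow n))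

variable {𝔤 : LieSubalgebra ℝ L}

theorem expEquiv_mem_isotropyGroup {X : L} (hX : X ∈ 𝔤) : expEquiv (ad ℝ L X) ∈ isotropyGroup 𝔤 :=
  Subgroup.subset_closure ⟨X, hX, fun v ↦ (ad ℝ L X).hasSum_exp_apply v⟩

theorem isotropyGroup_induction {p : (L ≃ₗ[ℝ] L) → Prop} (h1 : p 1)
    (hmul : ∀ φ ψ, p φ → p ψ → p (φ * ψ)) (hinv : ∀ φ, p φ → p φ⁻¹)
    (hexp : ∀ X ∈ 𝔤, p (expEquiv (ad ℝ L X))) {φ : L ≃ₗ[ℝ] L} (hφ : φ ∈ isotropyGroup 𝔤) : p φ := by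
  refine Subgroup.closure_induction (p := fun φ _ ↦ p φ) ?_ h1 (fun φ ψ _ _ ↦ hmul φ ψ)
    (fun φ _ ↦ hinv φ) hφ
  rintro φ ⟨X, hX, h⟩
  have : φ = expEquiv (ad ℝ L X) := by
    ext v
    exact (h v).unique ((ad ℝ L X).hasSum_exp_apply v)
  exact this ▸ hexp X hX

/-- An automorphism of the Lie algebra which preserves `𝔤` and `V`. -/
structure IsPairAut (𝔤 : LieSubalgebra ℝ L) (V : Submodule ℝ L) (φ : L ≃ₗ[ℝ] L) : Prop where
  map_lie : ∀ x y, φ ⁅x, y⁆ = ⁅φ x, φ y⁆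
  mem_g : ∀ x, φ x ∈ 𝔤 ↔ x ∈ 𝔤
  mem_V : ∀ x, φ x ∈ V ↔ x ∈ V

theorem isPairAut_of_mem {V : Submodule ℝ L} (hV : ∀ x ∈ 𝔤, ∀ v ∈ V, ⁅x, v⁆ ∈ V)
    {φ : L ≃ₗ[ℝ] L} (hφ : φ ∈ isotropyGroup 𝔤) : IsPairAut 𝔤 V φ := by
  have key : ∀ (p : Submodule ℝ L), (∀ x ∈ 𝔤, ∀ v ∈ p, ⁅x, v⁆ ∈ p) → ∀ X ∈ 𝔤, ∀ x,
      expEquiv (ad ℝ L X) x ∈ p ↔ x ∈ p := by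
    intro p hp X hX x
    refine ⟨fun h ↦ ?_, fun h ↦ exp_apply_mem (fun v hv ↦ hp X hX v hv) h⟩
    have h2 : (exp (-ad ℝ L X)) (exp (ad ℝ L X) x) ∈ p :=
      exp_apply_mem (fun v hv ↦ neg_mem (hp X hX v hv)) h
    rwa [← Module.End.mul_apply, exp_neg_mul_exp] at h2
  refine isotropyGroup_induction (p := IsPairAut 𝔤 V) ?_ ?_ ?_ ?_ hφ
  · exact ⟨fun _ _ ↦ rfl, fun _ ↦ Iff.rfl, fun _ ↦ Iff.rfl⟩
  · intro φ ψ hφ hψ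
    exact ⟨fun x y ↦ by simp [hφ.map_lie, hψ.map_lie], fun x ↦ (hφ.mem_g _).trans (hψ.mem_g _),
      fun x ↦ (hφ.mem_V _).trans (hψ.mem_V _)⟩
  · intro φ hφ
    have h : ∀ x, φ (φ⁻¹ x) = x := fun x ↦ φ.apply_symm_apply x
    refine ⟨fun x y ↦ φ.injective ?_, fun x ↦ ?_, fun x ↦ ?_⟩
    · rw [hφ.map_lie, h, h, h]
    · rw [← hφ.mem_g, h]
    · rw [← hφ.mem_V, h]
  · intro X hX
    exact ⟨fun x y ↦ exp_ad_lie X x y, key 𝔤.toSubmodule (fun x hx v hv ↦ 𝔤.lie_mem hx hv) X hX,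
      key V hV X hX⟩

/-- The isotropy group as a monoid of endomorphisms. -/
def isotropyMonoid (𝔤 : LieSubalgebra ℝ L) : Submonoid (Module.End ℝ L) :=
  (isotropyGroup 𝔤).toSubmonoid.map (LinearEquiv.automorphismGroup.toLinearMapMonoidHom)

theorem closure_exp_le_isotropyMonoid :
    Submonoid.closure (exp '' ((𝔤.toSubmodule.map (ad ℝ L : L →ₗ[ℝ] Module.End ℝ L) :
      Submodule ℝ (Module.End ℝ L)) : Set (Module.End ℝ L))) ≤ isotropyMonoid 𝔤 := by
  rw [Submonoid.closure_le]
  rintro _ ⟨_, ⟨X, hX, rfl⟩, rfl⟩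
  exact ⟨_, expEquiv_mem_isotropyGroup hX, rfl⟩

theorem exp_conj_mem_map_ad : ∀ x ∈ 𝔤.toSubmodule.map (ad ℝ L : L →ₗ[ℝ] Module.End ℝ L),
    ∀ y ∈ 𝔤.toSubmodule.map (ad ℝ L : L →ₗ[ℝ] Module.End ℝ L),
    exp x * y * exp (-x) ∈ 𝔤.toSubmodule.map (ad ℝ L : L →ₗ[ℝ] Module.End ℝ L) := by
  rintro _ ⟨X, hX, rfl⟩ _ ⟨u, hu, rfl⟩
  refine ⟨exp (ad ℝ L X) u, exp_apply_mem (p := 𝔤.toSubmodule)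
    (fun v hv ↦ 𝔤.lie_mem hX hv) hu, ?_⟩
  exact (exp_mul_ad_mul_exp_neg X u).symm

theorem exists_inv_mem_isotropyMonoid : ∀ g ∈ isotropyMonoid 𝔤, ∃ g' ∈ isotropyMonoid 𝔤,
    g' * g = 1 ∧ g * g' = 1 := by
  rintro _ ⟨φ, hφ, rfl⟩
  refine ⟨_, ⟨φ⁻¹, (isotropyGroup 𝔤).inv_mem hφ, rfl⟩, ?_, ?_⟩
  · rw [← map_mul, inv_mul_cancel, map_one]
  · rw [← map_mul, mul_inv_cancel, map_one]

end Isotropy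

/-! ### Simultaneous diagonalization -/

theorem exists_joint_eigenbasis {M : Type*} [AddCommGroup M] [Module ℝ M] [FiniteDimensional ℝ M]
    (B : LinearMap.BilinForm ℝ M) (hsymm : ∀ x y, B x y = B y x) (hpos : ∀ x, x ≠ 0 → 0 < B x x)
    {H : Type*} [AddCommGroup H] [Module ℝ H] (T : H →ₗ[ℝ] Module.End ℝ M)
    (hT : ∀ h x y, B (T h x) y = B x (T h y)) (hcomm : ∀ h h', Commute (T h) (T h')) :
    ∃ (e : Module.Basis (Fin (Module.finrank ℝ M)) ℝ M)
      (ν : Fin (Module.finrank ℝ M) → Module.Dual ℝ H), ∀ h j, T h (e j) = ν j h • e j := by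
  let core : InnerProductSpace.Core ℝ M :=
    { inner := fun x y ↦ B x y
      conj_inner_symm := fun x y ↦ by simpa using hsymm y x
      re_inner_nonneg := fun x ↦ by
        by_cases hx : x = 0
        · simp [hx]
        · simpa using (hpos x hx).le
      add_left := fun x y z ↦ by simp
      smul_left := fun x y r ↦ by simp
      definite := fun x h ↦ by
        by_contra hx
        exact (hpos x hx).ne' h }
  let _ : NormedAddCommGroup M := core.toNormedAddCommGroup
  let _ : InnerProductSpace ℝ M := .ofCore core.toCore
  have hTs : ∀ h, (T h).IsSymmetric := fun h x y ↦ hT h x y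
  have htop := LinearMap.IsSymmetric.iSup_iInf_eq_top_of_commute (T := fun h ↦ T h) hTs
    fun h h' _ ↦ hcomm h h'
  -- Joint eigenvectors span, so a basis can be selected among them. The eigenvalues are then linear
  -- in `h` because basis vectors are nonzero.
  let s : Set M := {x | ∃ χ : H → ℝ, ∀ h, T h x = χ h • x}
  have hs : ⊤ ≤ Submodule.span ℝ s := by
    rw [← htop, iSup_le_iff]
    intro χ x hx
    refine Submodule.subset_span ⟨χ, fun h ↦ ?_⟩
    exact Module.End.mem_eigenspace_iff.1 ((Submodule.mem_iInf _).1 hx h)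
  let e₀ := Module.Basis.ofSpan hs
  have hfin : Finite _ := Module.Finite.finite_basis e₀
  let _ := Fintype.ofFinite ((linearIndepOn_empty ℝ (id : M → M)).extend (empty_subset s))
  let e := e₀.reindex (Fintype.equivFinOfCardEq (Module.finrank_eq_card_basis e₀).symm)
  have he : ∀ j, ∃ χ : H → ℝ, ∀ h, T h (e j) = χ h • e j := by
    intro j
    have : e j ∈ range e₀ := ⟨_, (e₀.reindex_apply _ _).symm⟩
    exact Module.Basis.ofSpan_subset hs this
  choose χ hχ using he
  refine ⟨e, fun j ↦
    { toFun := χ j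
      map_add' := fun h h' ↦ smul_left_injective ℝ (e.ne_zero j) ?_
      map_smul' := fun c h ↦ smul_left_injective ℝ (e.ne_zero j) ?_ }, fun h j ↦ hχ j h⟩
  · simp only [add_smul, ← hχ, map_add, LinearMap.add_apply]
  · simp only [RingHom.id_apply, smul_assoc, ← hχ, map_smul, LinearMap.smul_apply]

theorem eq_zero_of_eq_neg {M : Type*} [AddCommGroup M] [Module ℝ M] {v : M} (h : v = -v) :
    v = 0 := by
  have h2 : (2 : ℝ) • v = 0 := by
    rw [two_smul]
    exact add_eq_zero_iff_eq_neg.2 h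
  exact (smul_eq_zero.1 h2).resolve_left two_ne_zero

theorem LinearMap.eq_or_eq_neg_of_sq_eq {M : Type*} [AddCommGroup M] [Module ℝ M]
    {μ ν : Module.Dual ℝ M} (h : ∀ x, μ x ^ 2 = ν x ^ 2) : μ = ν ∨ μ = -ν := by
  by_contra! hne
  obtain ⟨x, hx⟩ : ∃ x, μ x ≠ ν x := by
    by_contra! h1
    exact hne.1 (LinearMap.ext h1)
  obtain ⟨y, hy⟩ : ∃ y, μ y ≠ -ν y := by
    by_contra! h1
    exact hne.2 (LinearMap.ext h1)
  have h1 : μ x = -ν x := (sq_eq_sq_iff_eq_or_eq_neg.1 (h x)).resolve_left hx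
  have h2 : μ y = ν y := (sq_eq_sq_iff_eq_or_eq_neg.1 (h y)).resolve_right hy
  rcases sq_eq_sq_iff_eq_or_eq_neg.1 (h (x + y)) with h3 | h3 <;> rw [map_add, map_add] at h3
  · exact hx (by linarith)
  · exact hy (by linarith)

/-! ### The Cartan involution and the twisted adjoint operators -/

section Pair

variable {L : Type*} [LieRing L] [LieAlgebra ℝ L]

theorem negKilling_add_left (x y z : L) : negKilling (x + y) z = negKilling x z + negKilling y z := by
  simp [negKilling]; ring

theorem negKilling_add_right (x y z : L) :
    negKilling x (y + z) = negKilling x y + negKilling x z := by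
  simp [negKilling]; ring

theorem negKilling_smul_left (c : ℝ) (x y : L) : negKilling (c • x) y = c * negKilling x y := by
  simp [negKilling]

theorem negKilling_smul_right (c : ℝ) (x y : L) : negKilling x (c • y) = c * negKilling x y := by
  simp [negKilling]

theorem negKilling_neg_left (x y : L) : negKilling (-x) y = -negKilling x y := by
  simp [negKilling]

theorem negKilling_neg_right (x y : L) : negKilling x (-y) = -negKilling x y := by
  simp [negKilling]

theorem negKilling_zero_right (y : L) : negKilling y 0 = 0 := by simp [negKilling]

theorem negKilling_sum_left {ι : Type*} (s : Finset ι) (f : ι → L) (y : L) :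
    negKilling (∑ i ∈ s, f i) y = ∑ i ∈ s, negKilling (f i) y := by
  simp [negKilling, LinearMap.sum_apply]

theorem negKilling_sum_right {ι : Type*} (s : Finset ι) (f : ι → L) (y : L) :
    negKilling y (∑ i ∈ s, f i) = ∑ i ∈ s, negKilling y (f i) := by
  simp [negKilling]

theorem negKilling_comm (x y : L) : negKilling x y = negKilling y x := by
  simp only [negKilling]; rw [LieModule.traceForm_comm]

theorem negKilling_lie (x y z : L) : negKilling ⁅x, y⁆ z = negKilling x ⁅y, z⁆ := by
  simp only [negKilling]; rw [LieModule.traceForm_apply_lie_apply]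

theorem negKilling_lie_skew (x y z : L) : negKilling ⁅x, y⁆ z = -negKilling y ⁅x, z⁆ := by
  rw [← lie_skew, negKilling_neg_left, negKilling_lie]

theorem negKilling_map {φ : L ≃ₗ[ℝ] L} (h : ∀ x y, φ ⁅x, y⁆ = ⁅φ x, φ y⁆) (x y : L) :
    negKilling (φ x) (φ y) = negKilling x y := by
  let e : L ≃ₗ⁅ℝ⁆ L := { φ with map_lie' := h _ _ }
  exact congrArg Neg.neg (LieAlgebra.killingForm_of_equiv_apply e x y)

namespace IsCompactSymmetricPair

variable {𝔤 : LieSubalgebra ℝ L} {V : Submodule ℝ L} (hL : IsCompactSymmetricPair 𝔤 V)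
include hL

theorem negKilling_pos {x : L} (hx : x ≠ 0) : 0 < negKilling x x :=
  neg_pos.2 (hL.killing_neg x hx)

theorem eq_zero_of_negKilling {x : L} (hx : negKilling x x = 0) : x = 0 := by
  by_contra h
  exact (hL.negKilling_pos h).ne' hx

theorem exists_add (x : L) : ∃ y ∈ 𝔤, ∃ v ∈ V, y + v = x := by
  have : x ∈ 𝔤.toSubmodule ⊔ V := hL.isCompl.sup_eq_top ▸ Submodule.mem_top
  obtain ⟨y, hy, v, hv, h⟩ := Submodule.mem_sup.1 this
  exact ⟨y, hy, v, hv, h⟩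

/-- The Cartan involution, equal to `1` on `𝔤` and to `-1` on `V`. -/
noncomputable def invol : L →ₗ[ℝ] L :=
  LinearMap.ofIsCompl hL.isCompl 𝔤.toSubmodule.subtype (-V.subtype)

theorem invol_of_mem_g {x : L} (hx : x ∈ 𝔤) : hL.invol x = x :=
  LinearMap.ofIsCompl_apply_left hL.isCompl (⟨x, hx⟩ : 𝔤.toSubmodule)

theorem invol_of_mem_V {x : L} (hx : x ∈ V) : hL.invol x = -x :=
  LinearMap.ofIsCompl_apply_right hL.isCompl (⟨x, hx⟩ : V)

theorem invol_invol (x : L) : hL.invol (hL.invol x) = x := by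
  obtain ⟨y, hy, v, hv, rfl⟩ := hL.exists_add x
  simp [hL.invol_of_mem_g hy, hL.invol_of_mem_V hv]

theorem mem_g_iff {x : L} : x ∈ 𝔤 ↔ hL.invol x = x := by
  refine ⟨hL.invol_of_mem_g, fun h ↦ ?_⟩
  obtain ⟨y, hy, v, hv, rfl⟩ := hL.exists_add x
  rw [map_add, hL.invol_of_mem_g hy, hL.invol_of_mem_V hv, add_right_inj] at h
  have : v = 0 := eq_zero_of_eq_neg h.symm
  simpa [this] using hy

theorem invol_lie (x y : L) : hL.invol ⁅x, y⁆ = ⁅hL.invol x, hL.invol y⁆ := by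
  obtain ⟨a, ha, v, hv, rfl⟩ := hL.exists_add x
  obtain ⟨b, hb, w, hw, rfl⟩ := hL.exists_add y
  have h1 := hL.invol_of_mem_g (𝔤.lie_mem ha hb)
  have h2 := hL.invol_of_mem_V (hL.lie_mem_V a ha w hw)
  have h3 : hL.invol ⁅v, b⁆ = -⁅v, b⁆ := by
    rw [← lie_skew, map_neg, hL.invol_of_mem_V (hL.lie_mem_V b hb v hv)]
  have h4 := hL.invol_of_mem_g (hL.lie_mem_g v hv w hw)
  simp only [add_lie, lie_add, map_add, h1, h2, h3, h4, hL.invol_of_mem_g ha,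
    hL.invol_of_mem_g hb, hL.invol_of_mem_V hv, hL.invol_of_mem_V hw, neg_lie, lie_neg]
  abel

theorem negKilling_invol (x y : L) : negKilling (hL.invol x) (hL.invol y) = negKilling x y :=
  negKilling_map (φ := LinearEquiv.ofLinearMap hL.invol hL.invol
    (LinearMap.ext hL.invol_invol) (LinearMap.ext hL.invol_invol)) hL.invol_lie x y

theorem negKilling_invol_left (x y : L) :
    negKilling (hL.invol x) y = negKilling x (hL.invol y) := by
  rw [← hL.negKilling_invol, hL.invol_invol]

theorem map_invol {φ : L ≃ₗ[ℝ] L} (hφ : IsPairAut 𝔤 V φ) (x : L) :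
    φ (hL.invol x) = hL.invol (φ x) := by
  obtain ⟨y, hy, v, hv, rfl⟩ := hL.exists_add x
  simp [hL.invol_of_mem_g hy, hL.invol_of_mem_V hv, hL.invol_of_mem_g ((hφ.mem_g y).2 hy),
    hL.invol_of_mem_V ((hφ.mem_V v).2 hv)]

/-- The symmetric operator `x ↦ ⁅H, θ x⁆`, for the Cartan involution `θ`. -/
noncomputable def twist : L →ₗ[ℝ] Module.End ℝ L where
  toFun H := LieAlgebra.ad ℝ L H ∘ₗ hL.invol
  map_add' H H' := by ext x; simp
  map_smul' c H := by ext x; simp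

theorem twist_apply (H x : L) : hL.twist H x = ⁅H, hL.invol x⁆ := rfl

/-- For `H ∈ V`, `ad H` is skew and anticommutes with the involution, so their product is symmetric.
Its real eigenvalues are linear in `H`, whereas `(ad H)²` only shows the squares of the roots. -/
theorem twist_symm {H : L} (hH : H ∈ V) (x y : L) :
    negKilling (hL.twist H x) y = negKilling x (hL.twist H y) := by
  rw [twist_apply, twist_apply, negKilling_lie_skew, hL.negKilling_invol_left, hL.invol_lie,
    hL.invol_of_mem_V hH, neg_lie, negKilling_neg_right, neg_neg]

theorem twist_twist {H' : L} (H : L) (hH' : H' ∈ V) (x : L) :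
    hL.twist H (hL.twist H' x) = -⁅H, ⁅H', x⁆⁆ := by
  rw [twist_apply, twist_apply, hL.invol_lie, hL.invol_invol, hL.invol_of_mem_V hH', neg_lie,
    lie_neg]

theorem lie_eq_twist (H x : L) : ⁅H, x⁆ = hL.twist H (hL.invol x) := by
  rw [twist_apply, hL.invol_invol]

/-- Consequently the involution carries weight `ν` to weight `-ν`. -/
theorem twist_invol {H : L} (hH : H ∈ V) (x : L) :
    hL.twist H (hL.invol x) = -hL.invol (hL.twist H x) := by
  rw [← hL.lie_eq_twist, twist_apply, hL.invol_lie, hL.invol_invol, hL.invol_of_mem_V hH, neg_lie,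
    neg_neg]

theorem map_twist {φ : L ≃ₗ[ℝ] L} (hφ : IsPairAut 𝔤 V φ) (H x : L) :
    φ (hL.twist H x) = hL.twist (φ H) (φ x) := by
  rw [twist_apply, twist_apply, hφ.map_lie, hL.map_invol hφ]

end IsCompactSymmetricPair

theorem IsMaximalAbelian.mem_iff {V S : Submodule ℝ L} (hS : IsMaximalAbelian V S) {x : L}
    (hx : x ∈ V) : x ∈ S ↔ ∀ H ∈ S, ⁅H, x⁆ = 0 := by
  refine ⟨fun h H hH ↦ hS.abelian _ hH _ h, fun h ↦ hS.maximal x hx fun y hy ↦ ?_⟩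
  rw [← lie_skew, h y hy, neg_zero]

/-- A basis of joint eigenvectors of the symmetric operators `x ↦ ⁅H, θ x⁆`, `H ∈ S`. -/
structure WeightBasis {𝔤 : LieSubalgebra ℝ L} {V : Submodule ℝ L}
    (hL : IsCompactSymmetricPair 𝔤 V) (S : Submodule ℝ L) where
  e : Module.Basis (Fin (Module.finrank ℝ L)) ℝ L
  ν : Fin (Module.finrank ℝ L) → Module.Dual ℝ S
  twist_e : ∀ (H : S) j, hL.twist H (e j) = ν j H • e j

theorem IsCompactSymmetricPair.nonempty_weightBasis [FiniteDimensional ℝ L]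
    {𝔤 : LieSubalgebra ℝ L} {V S : Submodule ℝ L}
    (hL : IsCompactSymmetricPair 𝔤 V) (hS : IsMaximalAbelian V S) :
    Nonempty (WeightBasis hL S) := by
  obtain ⟨e, ν, h⟩ := exists_joint_eigenbasis (-killingForm ℝ L)
    (fun x y ↦ negKilling_comm x y) (fun x hx ↦ hL.negKilling_pos hx)
    (hL.twist ∘ₗ S.subtype) (fun h x y ↦ hL.twist_symm (hS.le h.2) x y) (fun h h' ↦ by
      ext x
      change hL.twist h (hL.twist h' x) = hL.twist h' (hL.twist h x)
      rw [hL.twist_twist _ (hS.le h'.2), hL.twist_twist _ (hS.le h.2), neg_inj,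
        leibniz_lie, hS.abelian _ h.2 _ h'.2, zero_lie, zero_add])
  exact ⟨⟨e, ν, h⟩⟩

end Pair

/-! ### Weights, restricted roots and chambers -/

section Weights

variable {L : Type*} [LieRing L] [LieAlgebra ℝ L] {𝔤 : LieSubalgebra ℝ L} {V S : Submodule ℝ L}
  {hL : IsCompactSymmetricPair 𝔤 V}

namespace WeightBasis

variable (W : WeightBasis hL S) (hS : IsMaximalAbelian V S)

theorem repr_twist (H : S) (x : L) (j) :
    W.e.repr (hL.twist H x) j = W.ν j H * W.e.repr x j := by
  have : W.e.coord j ∘ₗ hL.twist H = W.ν j H • W.e.coord j := by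
    refine W.e.ext fun i ↦ ?_
    simp only [LinearMap.comp_apply, W.twist_e, map_smul, LinearMap.smul_apply,
      Module.Basis.coord_apply, Module.Basis.repr_self, smul_eq_mul]
    by_cases h : i = j
    · rw [h]
    · simp [h]
  exact LinearMap.congr_fun this x

theorem repr_lie (H : S) (x : L) (j) :
    W.e.repr ⁅(H : L), x⁆ j = W.ν j H * W.e.repr (hL.invol x) j := by
  rw [hL.lie_eq_twist, W.repr_twist]

theorem eq_of_twist_eq {μ : Module.Dual ℝ S} {x : L} (hx : ∀ H : S, hL.twist H x = μ H • x) {j}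
    (hj : W.e.repr x j ≠ 0) : W.ν j = μ := by
  ext H
  have := W.repr_twist H x j
  rw [hx] at this
  simpa [hj] using this.symm

include W hS

theorem lie_lie_e (H H' : S) (j) :
    ⁅(H : L), ⁅(H' : L), W.e j⁆⁆ = -(W.ν j H * W.ν j H') • W.e j := by
  rw [neg_smul, ← neg_eq_iff_eq_neg, ← hL.twist_twist _ (hS.le H'.2), W.twist_e, map_smul,
    W.twist_e, smul_smul, mul_comm]

theorem repr_lie_lie (H H' : S) (x : L) (j) :
    W.e.repr ⁅(H : L), ⁅(H' : L), x⁆⁆ j = -(W.ν j H * W.ν j H') * W.e.repr x j := by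
  rw [← neg_neg ⁅(H : L), ⁅(H' : L), x⁆⁆, ← hL.twist_twist _ (hS.le H'.2), map_neg,
    Finsupp.neg_apply, W.repr_twist, W.repr_twist]
  ring

theorem mem_rootSpace_iff {μ : Module.Dual ℝ S} {x : L} :
    x ∈ rootSpace μ ↔ ∀ j, W.e.repr x j ≠ 0 → μ = W.ν j ∨ μ = -W.ν j := by
  change (∀ H : S, _) ↔ _
  constructor
  · intro h j hj
    refine LinearMap.eq_or_eq_neg_of_sq_eq fun H ↦ ?_
    have := W.repr_lie_lie hS H H x j
    rw [h H] at this
    simp only [map_smul, Finsupp.smul_apply, smul_eq_mul, mul_eq_mul_right_iff, hj, or_false] at this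
    linarith
  · intro h H
    refine W.e.ext_elem fun j ↦ ?_
    rw [W.repr_lie_lie hS]
    simp only [map_smul, Finsupp.smul_apply, smul_eq_mul]
    by_cases hj : W.e.repr x j = 0
    · simp [hj]
    · rcases h j hj with h | h <;> simp [h] <;> ring_nf <;> simp

theorem exists_neg (j) : ∃ i, W.ν i = -W.ν j := by
  have h0 : hL.invol (W.e j) ≠ 0 := fun h ↦ W.e.ne_zero j (by rw [← hL.invol_invol (W.e j), h, map_zero])
  obtain ⟨i, hi⟩ : ∃ i, W.e.repr (hL.invol (W.e j)) i ≠ 0 := by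
    by_contra! h
    exact h0 (W.e.repr.map_eq_zero_iff.1 (Finsupp.ext h))
  refine ⟨i, W.eq_of_twist_eq (fun H ↦ ?_) hi⟩
  rw [hL.twist_invol (hS.le H.2), W.twist_e, map_smul, LinearMap.neg_apply, neg_smul]

theorem isRestrictedRoot_iff {μ : Module.Dual ℝ S} :
    IsRestrictedRoot μ ↔ μ ≠ 0 ∧ ∃ j, W.ν j = μ := by
  refine and_congr_right fun _ ↦ ⟨fun h ↦ ?_, ?_⟩
  · obtain ⟨x, hx, hx0⟩ := (Submodule.ne_bot_iff _).1 h
    obtain ⟨i, hi⟩ : ∃ i, W.e.repr x i ≠ 0 := by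
      by_contra! h
      exact hx0 (W.e.repr.map_eq_zero_iff.1 (Finsupp.ext h))
    rcases (W.mem_rootSpace_iff hS).1 hx i hi with h | h
    · exact ⟨i, h.symm⟩
    · exact h ▸ W.exists_neg hS i
  · rintro ⟨j, rfl⟩
    refine (Submodule.ne_bot_iff _).2 ⟨W.e j, (W.mem_rootSpace_iff hS).2 fun i hi ↦ ?_,
      W.e.ne_zero j⟩
    rw [W.e.repr_self, Finsupp.single_apply] at hi
    left
    rw [(ite_ne_right_iff.1 hi).1]

theorem mem_regularSet_iff {H : S} : H ∈ regularSet S ↔ ∀ j, W.ν j ≠ 0 → W.ν j H ≠ 0 := by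
  refine ⟨fun h j hj ↦ h _ ((W.isRestrictedRoot_iff hS).2 ⟨hj, j, rfl⟩), fun h μ hμ ↦ ?_⟩
  obtain ⟨hμ, j, rfl⟩ := (W.isRestrictedRoot_iff hS).1 hμ
  exact h j hμ

theorem repr_eq_zero_of_lie_lie {H : S} {x : L} (h : ⁅(H : L), ⁅(H : L), x⁆⁆ = 0) {j}
    (hj : W.ν j H ≠ 0) : W.e.repr x j = 0 := by
  have := W.repr_lie_lie hS H H x j
  simpa [h, hj] using this

theorem lie_eq_zero_iff {x : L} :
    (∀ H : S, ⁅(H : L), x⁆ = 0) ↔ ∀ j, W.ν j ≠ 0 → W.e.repr x j = 0 := by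
  constructor
  · intro h j hj
    obtain ⟨H, hH⟩ : ∃ H, W.ν j H ≠ 0 := by
      by_contra! h
      exact hj (LinearMap.ext h)
    exact W.repr_eq_zero_of_lie_lie hS (by rw [h H, lie_zero]) hH
  · intro h H
    have h2 : hL.twist H x = 0 := by
      refine W.e.ext_elem fun j ↦ ?_
      rw [W.repr_twist]
      by_cases hj : W.ν j = 0
      · simp [hj]
      · simp [h j hj]
    have h3 : hL.twist H (hL.invol x) = 0 := by
      rw [hL.twist_invol (hS.le H.2), h2, map_zero, neg_zero]
    rwa [← hL.lie_eq_twist] at h3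

/-- No nonzero weight vanishes at a regular `H`, so the kernel of `(ad H)²` involves the zero weight
only and is centralized by all of `S`. -/
theorem lie_eq_zero_of_regular {H : S} (hH : H ∈ regularSet S) {x : L}
    (h : ⁅(H : L), ⁅(H : L), x⁆⁆ = 0) (H' : S) : ⁅(H' : L), x⁆ = 0 :=
  (W.lie_eq_zero_iff hS).2
    (fun j hj ↦ W.repr_eq_zero_of_lie_lie hS h ((W.mem_regularSet_iff hS).1 hH j hj)) H'

theorem mem_of_lie_eq_zero {H : S} (hH : H ∈ regularSet S) {x : L} (hx : x ∈ V)
    (h : ⁅(H : L), x⁆ = 0) : x ∈ S :=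
  (hS.mem_iff hx).2 fun H' hH' ↦
    W.lie_eq_zero_of_regular hS hH (by rw [h, lie_zero]) ⟨H', hH'⟩

/-- Such an `H` has `ad H = 0`, and the Killing form is definite. -/
theorem eq_zero_of_weights {H : S} (h : ∀ j, W.ν j H = 0) : H = 0 := by
  have hH : hL.twist (H : L) = 0 := W.e.ext fun j ↦ by rw [W.twist_e, h]; simp
  have had : LieAlgebra.ad ℝ L (H : L) = 0 := by
    ext x
    change ⁅(H : L), x⁆ = 0
    rw [hL.lie_eq_twist, hH]
    rfl
  refine Subtype.ext (hL.eq_zero_of_negKilling ?_)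
  simp [negKilling, killingForm_apply_apply, had]

variable [FiniteDimensional ℝ L] [TopologicalSpace L] [IsTopologicalAddGroup L]
  [ContinuousSMul ℝ L] [T2Space L]

theorem chamber_eq {C : Set S} (hC : IsOpenChamber C) {A : S} (hA : A ∈ C) :
    C = {H | ∀ j, 0 < W.ν j A → 0 < W.ν j H} := by
  obtain ⟨H₀, hH₀, rfl⟩ := hC
  have hAr : A ∈ regularSet S := connectedComponentIn_subset _ _ hA
  have hreg := (W.mem_regularSet_iff hS).1 hAr
  rw [connectedComponentIn_eq hA]
  apply Subset.antisymm
  -- A weight that changes sign on the connected component would vanish at one of its points.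
  · intro H hH j hj
    by_contra! hle
    have hpre := isPreconnected_connectedComponentIn.image (W.ν j)
      (W.ν j).continuous_of_finiteDimensional.continuousOn
      (s := connectedComponentIn (regularSet S) A)
    have h0 : (0 : ℝ) ∈ W.ν j '' connectedComponentIn (regularSet S) A :=
      hpre.ordConnected.out (mem_image_of_mem _ hH)
        (mem_image_of_mem _ (mem_connectedComponentIn hAr)) ⟨hle, hj.le⟩
    obtain ⟨H', hH', h0⟩ := h0
    refine (W.mem_regularSet_iff hS).1 (connectedComponentIn_subset _ _ hH') j ?_ h0
    rintro h
    simp [h] at hj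
  -- The intersection of half-spaces is convex, and it meets no wall because weights occur in pairs
  -- `±ν`.
  · refine IsPreconnected.subset_connectedComponentIn ?_ (fun j hj ↦ hj) ?_
    · refine Convex.isPreconnected ?_
      have : {H | ∀ j, 0 < W.ν j A → 0 < W.ν j H} =
          ⋂ j, ⋂ (_ : 0 < W.ν j A), {H : S | 0 < W.ν j H} := by
        ext; simp
      rw [this]
      exact convex_iInter₂ fun j _ ↦ convex_halfSpace_gt (W.ν j).isLinear 0
    · intro H hH
      refine (W.mem_regularSet_iff hS).2 fun j hj ↦ ?_
      rcases (hreg j hj).lt_or_gt with h | h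
      · obtain ⟨i, hi⟩ := W.exists_neg hS j
        have := hH i (by rw [hi]; simpa using h)
        rw [hi, LinearMap.neg_apply] at this
        linarith
      · exact (hH j h).ne'

theorem mem_regularSet_of_mem_chamber {C : Set S} (hC : IsOpenChamber C) {A : S} (hA : A ∈ C) :
    A ∈ regularSet S := by
  obtain ⟨H₀, hH₀, rfl⟩ := hC
  exact connectedComponentIn_subset _ _ hA

theorem isPositiveRoot_iff {C : Set S} (hC : IsOpenChamber C) {A : S} (hA : A ∈ C)
    {μ : Module.Dual ℝ S} : IsPositiveRoot C μ ↔ 0 < μ A ∧ ∃ j, W.ν j = μ := by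
  constructor
  · rintro ⟨h, h2⟩
    exact ⟨h2 A hA, ((W.isRestrictedRoot_iff hS).1 h).2⟩
  · rintro ⟨h, j, rfl⟩
    refine ⟨(W.isRestrictedRoot_iff hS).2 ⟨fun h0 ↦ by simp [h0] at h, j, rfl⟩, fun H hH ↦ ?_⟩
    rw [W.chamber_eq hS hC hA] at hH
    exact hH j h

theorem nonneg_of_mem_closure {C : Set S} (hC : IsOpenChamber C) {A : S} (hA : A ∈ C) {H : S}
    (hH : H ∈ closure C) {j} (hj : 0 < W.ν j A) : 0 ≤ W.ν j H := by
  have hcl : IsClosed {H : S | 0 ≤ W.ν j H} :=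
    isClosed_Ici.preimage (W.ν j).continuous_of_finiteDimensional
  refine closure_minimal (fun H' hH' ↦ ?_) hcl hH
  rw [W.chamber_eq hS hC hA] at hH'
  exact (hH' j hj).le

theorem isOpen_chamber {C : Set S} (hC : IsOpenChamber C) {A : S} (hA : A ∈ C) : IsOpen C := by
  have : {H | ∀ j, 0 < W.ν j A → 0 < W.ν j H} =
      ⋂ j, ⋂ (_ : 0 < W.ν j A), {H : S | 0 < W.ν j H} := by
    ext; simp
  rw [W.chamber_eq hS hC hA, this]
  exact isOpen_iInter_of_finite fun j ↦ isOpen_iInter_of_finite fun _ ↦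
    isOpen_Ioi.preimage (W.ν j).continuous_of_finiteDimensional

end WeightBasis

end Weights

/-! ### Rigidity of a polyhedral cone -/

section Cone

open Finset in
/-- A linear map which preserves a pointed polyhedral cone and the functionals
`∑ i with 0 < ν i h, ν i`, for `h` in the cone, fixes the cone pointwise. -/
theorem eq_self_of_mem_cone {M ι : Type*} [AddCommGroup M] [Module ℝ M]
    (P : Finset ι) (ν : ι → Module.Dual ℝ M) (hsep : ∀ x, (∀ i ∈ P, ν i x = 0) → x = 0)
    (w : M →ₗ[ℝ] M) (hw : ∀ h, (∀ i ∈ P, 0 ≤ ν i h) → ∀ i ∈ P, 0 ≤ ν i (w h))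
    (hΛ : ∀ h k, (∀ i ∈ P, 0 ≤ ν i h) → (∀ i ∈ P, 0 ≤ ν i k) →
      ∑ i ∈ P with 0 < ν i h, ν i (w k) = ∑ i ∈ P with 0 < ν i h, ν i k) (h : M)
    (hh : ∀ i ∈ P, 0 ≤ ν i h) : w h = h := by
  induction hn : #{i ∈ P | 0 < ν i h} using Nat.strong_induction_on generalizing h with
  | _ n ih =>
  subst hn
  have hfull : ∀ k, (∀ i ∈ P, 0 ≤ ν i k) → ∑ i ∈ P with 0 < ν i k, ν i k = ∑ i ∈ P, ν i k := by
    intro k hk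
    rw [sum_filter]
    refine sum_congr rfl fun i hi ↦ ?_
    split_ifs with h
    · rfl
    · exact le_antisymm (hk i hi) (not_lt.1 h)
  have hpart : ∀ k l, (∀ i ∈ P, 0 ≤ ν i l) →
      ∑ i ∈ P with 0 < ν i k, ν i l ≤ ∑ i ∈ P, ν i l := fun k l hl ↦
    sum_le_sum_of_subset_of_nonneg (filter_subset _ _) fun i hi _ ↦ hl i hi
  -- Let `Λ` be the sum of all functionals. Then `Λ(w h) = Λ_{w h}(w h) = Λ_{w h}(h) ≤ Λ(h) = Λ_h(h)
  -- = Λ_h(w h)`, so the nonnegative terms missing from `Λ_h(w h)` are zero.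
  have hoff : ∀ i ∈ P, ¬ 0 < ν i h → ν i (w h) = 0 := by
    intro i hi hni
    have h1 : ∑ i ∈ P with 0 < ν i h, ν i (w h) = ∑ i ∈ P, ν i (w h) := by
      refine le_antisymm (hpart _ _ (hw h hh)) ?_
      rw [← hfull _ (hw h hh), hΛ _ _ (hw h hh) hh, hΛ _ _ hh hh, hfull _ hh]
      exact hpart _ _ hh
    rw [← sum_filter_add_sum_filter_not P (fun i ↦ 0 < ν i h) fun i ↦ ν i (w h)] at h1
    exact (sum_eq_zero_iff_of_nonneg fun i hi ↦ hw h hh i (mem_filter.1 hi).1).1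
      (left_eq_add.1 h1) i (mem_filter.2 ⟨hi, hni⟩)
  -- Move from `h` along `d` until the first functional reaches zero. That point is in the cone with
  -- fewer positive functionals, so the induction hypothesis applies to it.
  have hshrink : ∀ d, (∀ i ∈ P, ¬ 0 < ν i h → ν i d = 0) → (∃ i ∈ P, ν i d < 0) →
      ∃ s : ℝ, 0 < s ∧ w (h + s • d) = h + s • d := by
    rintro d hd ⟨i₀, hi₀, hi₀d⟩
    obtain ⟨i, hi, hmin⟩ := exists_min_image {i ∈ P | ν i d < 0} (fun i ↦ ν i h / -ν i d)
      ⟨i₀, mem_filter.2 ⟨hi₀, hi₀d⟩⟩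
    obtain ⟨hiP, hid⟩ := mem_filter.1 hi
    have hih : 0 < ν i h := by
      by_contra hc
      exact hid.ne (hd i hiP hc)
    refine ⟨ν i h / -ν i d, div_pos hih (by linarith), ?_⟩
    have hmem : ∀ j ∈ P, 0 ≤ ν j (h + (ν i h / -ν i d) • d) := by
      intro j hj
      rw [map_add, map_smul, smul_eq_mul]
      rcases lt_or_ge (ν j d) 0 with hjd | hjd
      · have := (le_div_iff₀ (by linarith)).1 (hmin j (mem_filter.2 ⟨hj, hjd⟩))
        linarith
      · have := mul_nonneg (div_pos hih (neg_pos.2 hid)).le hjd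
        linarith [hh j hj]
    refine ih _ (card_lt_card ?_) _ hmem rfl
    refine Finset.ssubset_iff_subset_ne.2 ⟨fun j hj ↦ ?_, fun heq ↦ ?_⟩
    · obtain ⟨hjP, hj⟩ := mem_filter.1 hj
      refine mem_filter.2 ⟨hjP, ?_⟩
      by_contra hc
      rw [map_add, map_smul, hd j hjP hc, smul_zero, add_zero] at hj
      exact hc hj
    · have : i ∈ ({i ∈ P | 0 < ν i h} : Finset ι) := mem_filter.2 ⟨hiP, hih⟩
      rw [← heq] at this
      have h2 := (mem_filter.1 this).2
      rw [map_add, map_smul, smul_eq_mul, div_neg, neg_mul, div_mul_cancel₀ _ hid.ne] at h2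
      linarith
  by_contra hne
  have hd0 : w h - h ≠ 0 := sub_ne_zero.2 hne
  have hdoff : ∀ i ∈ P, ¬ 0 < ν i h → ν i (w h - h) = 0 := fun i hi hni ↦ by
    rw [map_sub, hoff i hi hni, le_antisymm (not_lt.1 hni) (hh i hi), sub_zero]
  have hsum : ∑ i ∈ P, ν i (w h - h) = 0 := by
    rw [← sum_filter_add_sum_filter_not P (fun i ↦ 0 < ν i h),
      sum_eq_zero (s := {i ∈ P | ¬ 0 < ν i h}) fun i hi ↦
        hdoff i (mem_filter.1 hi).1 (mem_filter.1 hi).2]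
    simp only [map_sub, sum_sub_distrib, hΛ h h hh hh]
    ring
  obtain ⟨i, hiP, hi⟩ : ∃ i ∈ P, ν i (w h - h) ≠ 0 := by
    by_contra! hc
    exact hd0 (hsep _ hc)
  have hne0 : ∃ i ∈ P, ν i (w h - h) ≠ 0 := ⟨i, hiP, hi⟩
  obtain ⟨i, hiP, hi⟩ := exists_pos_of_sum_zero_of_exists_nonzero _ hsum hne0
  obtain ⟨j, hjP, hj⟩ := exists_pos_of_sum_zero_of_exists_nonzero (s := P)
    (fun i ↦ -ν i (w h - h)) (by rw [sum_neg_distrib, hsum, neg_zero])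
    (by simpa only [neg_ne_zero] using hne0)
  -- The values on `w h - h` sum to zero without all vanishing, so both signs occur. Hence `w` fixes
  -- a point of the line on either side of `h`, and so `h` itself.
  obtain ⟨s, hs, hs1⟩ := hshrink (w h - h) hdoff ⟨j, hjP, by linarith⟩
  obtain ⟨r, hr, hr1⟩ := hshrink (-(w h - h))
    (fun i hi hni ↦ by rw [map_neg, hdoff i hi hni, neg_zero])
    ⟨i, hiP, by rw [map_neg]; linarith⟩
  rw [map_add, map_smul] at hs1 hr1
  rw [map_neg] at hr1
  have h1 : s • w (w h - h) = (s - 1) • (w h - h) := by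
    rw [sub_smul, one_smul, ← sub_eq_zero]
    rw [← sub_eq_zero] at hs1
    rw [← hs1]
    abel
  have h2 : r • w (w h - h) = (r + 1) • (w h - h) := by
    rw [add_smul, one_smul, ← sub_eq_zero]
    rw [← sub_eq_zero, ← neg_eq_zero] at hr1
    rw [← hr1]
    simp only [smul_neg]
    abel
  have h3 : (r + s) • (w h - h) = 0 := by
    have h4 : r • ((s - 1) • (w h - h)) = s • ((r + 1) • (w h - h)) := by
      rw [← h1, ← h2, smul_comm]
    rw [smul_smul, smul_smul, ← sub_eq_zero, ← sub_smul] at h4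
    rw [← neg_eq_zero, ← neg_smul, ← h4]
    congr 1
    ring
  exact hd0 ((smul_eq_zero.1 h3).resolve_left (by linarith))

end Cone

/-! ### Multilinear forms and the derivation action of endomorphisms -/

theorem MultilinearMap.continuous_of_finiteDimensional {F ι : Type*} [Fintype ι] [DecidableEq ι]
    [NormedAddCommGroup F] [NormedSpace ℝ F] [FiniteDimensional ℝ F]
    (ω : MultilinearMap ℝ (fun _ : ι ↦ F) ℝ) : Continuous ω := by
  let b := Module.finBasis ℝ F
  have h : ∀ m : ι → F, ω m =
      ∑ r : ι → Fin (Module.finrank ℝ F), (∏ i, b.coord (r i) (m i)) • ω fun i ↦ b (r i) := by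
    intro m
    have hm : m = fun i ↦ ∑ j, b.coord j (m i) • b j := by
      ext1 i
      exact (b.sum_repr (m i)).symm
    conv_lhs => rw [hm, ω.map_sum]
    exact Finset.sum_congr rfl fun r _ ↦ ω.map_smul_univ _ _
  rw [show (ω : (ι → F) → ℝ) = _ from funext h]
  refine continuous_finsetSum _ fun r _ ↦ ?_
  simp only [smul_eq_mul]
  refine Continuous.mul ?_ continuous_const
  exact continuous_finsetProd _ fun i _ ↦
    (b.coord (r i)).continuous_of_finiteDimensional.comp (continuous_apply i)

section Multilinear

variable {M ι : Type*} [AddCommGroup M] [Module ℝ M] [Fintype ι] [DecidableEq ι]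

namespace MultilinearMap

theorem compLinearMap_update_id (A : Module.End ℝ M) (ω : MultilinearMap ℝ (fun _ : ι ↦ M) ℝ)
    (i : ι) (v : ι → M) :
    ω.compLinearMap (Function.update (fun _ ↦ LinearMap.id) i A) v =
      ω (Function.update v i (A (v i))) := by
  rw [compLinearMap_apply]
  congr 1
  ext1 k
  by_cases hk : k = i
  · subst hk
    simp
  · simp [hk]

/-- The derivation action of endomorphisms of `M` on multilinear forms on `M`. -/
def der : Module.End ℝ M →ₗ[ℝ] Module.End ℝ (MultilinearMap ℝ (fun _ : ι ↦ M) ℝ) :=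
  LinearMap.mk₂ ℝ
    (fun A ω ↦ ∑ i, ω.compLinearMap (Function.update (fun _ ↦ LinearMap.id) i A))
    (fun A B ω ↦ by
      ext v
      simp only [sum_apply, add_apply, compLinearMap_update_id, LinearMap.add_apply,
        ω.map_update_add, Finset.sum_add_distrib])
    (fun c A ω ↦ by
      ext v
      simp only [sum_apply, smul_apply, compLinearMap_update_id, LinearMap.smul_apply,
        ω.map_update_smul, Finset.smul_sum])
    (fun A ω η ↦ by ext v; simp [sum_apply, Finset.sum_add_distrib])
    (fun c A ω ↦ by ext v; simp [sum_apply, Finset.mul_sum])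

theorem der_apply (A : Module.End ℝ M) (ω : MultilinearMap ℝ (fun _ : ι ↦ M) ℝ) (v : ι → M) :
    der A ω v = ∑ i, ω (Function.update v i (A (v i))) := by
  change (∑ i, ω.compLinearMap (Function.update (fun _ ↦ LinearMap.id) i A)) v = _
  simp only [sum_apply, compLinearMap_update_id]

/-- Substitution in the arguments reverses products: `der` is an anti-representation, whence the
order of the factors in the commutator. -/
theorem der_der (A B : Module.End ℝ M) (ω : MultilinearMap ℝ (fun _ : ι ↦ M) ℝ) :
    der A (der B ω) = der B (der A ω) + der (B * A - A * B) ω := by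
  ext v
  let f (A B : Module.End ℝ M) (i k : ι) : ℝ := ω (Function.update (Function.update v i (A (v i))) k
    (B (Function.update v i (A (v i)) k)))
  have hne : ∀ i k, i ≠ k → f A B i k = f B A k i := by
    intro i k h
    simp only [f, Function.update_of_ne h, Function.update_of_ne h.symm]
    rw [Function.update_comm h]
  have heq : ∀ (A B : Module.End ℝ M) i, f A B i i = ω (Function.update v i ((B * A) (v i))) := by
    intro A B i
    simp [f]
  have hf : ∀ A B, der A (der B ω) v = ∑ i, ∑ k, f A B i k := fun A B ↦ by
    simp only [der_apply, f]
  rw [add_apply, hf, hf, der_apply]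
  rw [Finset.sum_comm (f := fun i k ↦ f B A i k), ← sub_eq_iff_eq_add', ← Finset.sum_sub_distrib]
  refine Finset.sum_congr rfl fun i _ ↦ ?_
  rw [← Finset.sum_sub_distrib, Finset.sum_eq_single i]
  · rw [heq, heq, LinearMap.sub_apply, ω.map_update_sub]
  · intro k _ hk
    rw [hne i k hk.symm, sub_self]
  · simp

theorem der_compLinearMap {A B φ : Module.End ℝ M} (h : φ * A = B * φ)
    (ω : MultilinearMap ℝ (fun _ : ι ↦ M) ℝ) :
    der A (ω.compLinearMap fun _ ↦ φ) = (der B ω).compLinearMap fun _ ↦ φ := by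
  ext v
  simp only [der_apply, compLinearMap_apply]
  refine Finset.sum_congr rfl fun i _ ↦ congrArg ω ?_
  ext1 k
  by_cases hk : k = i
  · subst hk
    simpa using LinearMap.congr_fun h (v k)
  · simp [hk]

/-- A space of multilinear forms which is stable under the derivation action of `X` is stable
under the substitution by `exp X`. -/
theorem compLinearMap_exp_mem [FiniteDimensional ℝ M]
    {E : Submodule ℝ (MultilinearMap ℝ (fun _ : ι ↦ M) ℝ)} {X : Module.End ℝ M}
    (hE : ∀ ω ∈ E, der X ω ∈ E) {ω : MultilinearMap ℝ (fun _ : ι ↦ M) ℝ} (hω : ω ∈ E) :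
    (ω.compLinearMap fun _ ↦ NormedSpace.exp X) ∈ E := by
  have : Module.Free ℝ E := Module.Free.of_divisionRing ℝ E
  let b := Module.finBasis ℝ E
  let D : Module.End ℝ E := (der X).restrict hE
  let A : Module.End ℝ (Fin (Module.finrank ℝ E) → ℝ) :=
    Matrix.toLin' (LinearMap.toMatrix b b D).transpose
  have hA : ∀ v : ι → M, A (fun i ↦ (b i : MultilinearMap ℝ (fun _ : ι ↦ M) ℝ) v) =
      fun i ↦ der X (b i) v := by
    intro v
    ext i
    have h1 : D (b i) = ∑ j, LinearMap.toMatrix b b D j i • b j := by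
      simp only [LinearMap.toMatrix_apply]
      exact (b.sum_repr _).symm
    have h2 := congrArg (fun η : E ↦ (η : MultilinearMap ℝ (fun _ : ι ↦ M) ℝ) v) h1
    simp only [Submodule.coe_sum, Submodule.coe_smul, sum_apply, smul_apply, smul_eq_mul] at h2
    rw [show der X (b i) v = _ from h2]
    simp [A, Matrix.toLin'_apply, Matrix.mulVec, dotProduct]
  -- At fixed vectors, the values of a basis of `E` along `exp (tX)` solve a linear system with
  -- constant matrix `A`. This replaces an exponential on the space of forms, which then needs no
  -- norm.
  have key : ∀ v : ι → M, (fun i ↦ (b i : MultilinearMap ℝ (fun _ : ι ↦ M) ℝ)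
      (fun k ↦ NormedSpace.exp X (v k))) = NormedSpace.exp A
        (fun i ↦ (b i : MultilinearMap ℝ (fun _ : ι ↦ M) ℝ) v) := by
    intro v
    let y : ℝ → Fin (Module.finrank ℝ E) → ℝ := fun t i ↦
      (b i : MultilinearMap ℝ (fun _ : ι ↦ M) ℝ) fun k ↦ NormedSpace.exp (t • X) (v k)
    let z : ℝ → Fin (Module.finrank ℝ E) → ℝ := fun t ↦ NormedSpace.exp (t • A) (y 0)
    have hy : ∀ t, HasDerivAt y (A (y t)) t := by
      intro t
      rw [hasDerivAt_pi]
      intro i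
      rw [hA]
      let c : ContinuousMultilinearMap ℝ (fun _ : ι ↦ Module.End ℝ M) ℝ :=
        ⟨(b i : MultilinearMap ℝ (fun _ : ι ↦ M) ℝ).compLinearMap fun k ↦ LinearMap.applyₗ (v k),
          MultilinearMap.continuous_of_finiteDimensional _⟩
      have h0 : HasDerivAt (fun (t : ℝ) (_ : ι) ↦ NormedSpace.exp (t • X))
          (fun _ ↦ X * NormedSpace.exp (t • X)) t :=
        hasDerivAt_pi.2 fun _ ↦ hasDerivAt_exp_smul_const' (𝕂 := ℝ) X t
      have h1 := (c.hasFDerivAt (fun _ ↦ NormedSpace.exp (t • X))).comp_hasDerivAt t h0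
      refine h1.congr_deriv ?_
      rw [ContinuousMultilinearMap.linearDeriv_apply]
      simp only [der_apply]
      refine Finset.sum_congr rfl fun k _ ↦ congrArg (b i : MultilinearMap ℝ (fun _ : ι ↦ M) ℝ) ?_
      ext1 l
      by_cases hl : l = k
      · subst hl
        simp
      · simp [hl]
    have hz : ∀ t, HasDerivAt z (A (z t)) t := fun t ↦
      (hasDerivAt_exp_smul_const' (𝕂 := ℝ) A t).linearMap_comp (LinearMap.applyₗ (y 0))
    have := eqOn_of_linear_ode isOpen_univ ordConnected_univ
      (M := fun _ ↦ LinearMap.toContinuousLinearMap A) continuousOn_const (fun t _ ↦ hy t)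
      (fun t _ ↦ hz t) (mem_univ 0) (by simp [z]) (mem_univ 1)
    simpa [y, z] using this
  have hb : ∀ i, ((b i : MultilinearMap ℝ (fun _ : ι ↦ M) ℝ).compLinearMap
      fun _ ↦ NormedSpace.exp X) ∈ E := by
    intro i
    have : ((b i : MultilinearMap ℝ (fun _ : ι ↦ M) ℝ).compLinearMap fun _ ↦ NormedSpace.exp X) =
        ∑ j, NormedSpace.exp A (Pi.single j 1) i • (b j : MultilinearMap ℝ (fun _ : ι ↦ M) ℝ) := by
      ext v
      have h1 := congrFun (key v) i
      rw [compLinearMap_apply, h1]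
      conv_lhs => rw [pi_eq_sum_univ' (fun i ↦ (b i : MultilinearMap ℝ (fun _ : ι ↦ M) ℝ) v)]
      simp [mul_comm, sum_apply]
    rw [this]
    exact sum_mem fun j _ ↦ E.smul_mem _ (b j).2
  have hω' : ω = ∑ i, b.repr ⟨ω, hω⟩ i • (b i : MultilinearMap ℝ (fun _ : ι ↦ M) ℝ) := by
    have := congrArg Subtype.val (b.sum_repr ⟨ω, hω⟩).symm
    rwa [Submodule.coe_sum] at this
  have : (ω.compLinearMap fun _ ↦ NormedSpace.exp X) = ∑ i, b.repr ⟨ω, hω⟩ i •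
      ((b i : MultilinearMap ℝ (fun _ : ι ↦ M) ℝ).compLinearMap fun _ ↦ NormedSpace.exp X) := by
    conv_lhs => rw [hω']
    ext v
    simp [sum_apply]
  rw [this]
  exact sum_mem fun i _ ↦ E.smul_mem _ (hb i)

/-- The hypothesis says that `A` descends to the quotient on which the coordinates `s i` live.
Jacobi's formula for the determinant then produces the trace of the induced map. -/
theorem der_det {n : Type*} (e : Module.Basis n ℝ M) [Finite n] (s : ι → n) (hs : Function.Injective s)
    {A : Module.End ℝ M} (hA : ∀ x, (∀ i, e.repr x (s i) = 0) → ∀ i, e.repr (A x) (s i) = 0) :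
    der A (Matrix.detRowAlternating.toMultilinearMap.compLinearMap
      fun _ : ι ↦ LinearMap.pi fun i ↦ e.coord (s i)) =
    (∑ i, e.repr (A (e (s i))) (s i)) • (Matrix.detRowAlternating.toMultilinearMap.compLinearMap
      fun _ : ι ↦ LinearMap.pi fun i ↦ e.coord (s i)) := by
  classical
  let π : M →ₗ[ℝ] ι → ℝ := LinearMap.pi fun i ↦ e.coord (s i)
  let B : Matrix ι ι ℝ := Matrix.of fun k i ↦ e.repr (A (e (s k))) (s i)
  have hπ : ∀ x, π (A x) = Matrix.vecMul (π x) B := by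
    intro x
    have h1 := hA (x - ∑ k, e.repr x (s k) • e (s k)) fun i ↦ by
      simp [Finsupp.single_apply, hs.eq_iff]
    ext i
    have h2 := h1 i
    simp only [map_sub, Finsupp.sub_apply, sub_eq_zero] at h2
    simpa [π, B, Matrix.vecMul, dotProduct] using h2
  ext v
  rw [der_apply, smul_apply]
  simp only [compLinearMap_apply]
  let N : Matrix ι ι ℝ := Matrix.of fun k ↦ π (v k)
  have h3 : ∀ i, Matrix.detRowAlternating.toMultilinearMap
      (fun k ↦ π (Function.update v i (A (v i)) k)) = ∑ k, N.adjugate k i * (N * B) i k := by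
    intro i
    have h4 : (fun k ↦ π (Function.update v i (A (v i)) k)) =
        N.updateRow i (Matrix.vecMul (π (v i)) B) := by
      ext1 k
      by_cases hk : k = i
      · subst hk
        simp [hπ]
      · rw [Matrix.updateRow_ne hk, Function.update_of_ne hk]
        rfl
    rw [h4]
    change Matrix.det _ = _
    rw [← Matrix.cramer_transpose_apply, Matrix.cramer_eq_adjugate_mulVec,
      ← Matrix.adjugate_transpose]
    rfl
  rw [Finset.sum_congr rfl fun i _ ↦ h3 i]
  have h5 : ∑ i, ∑ k, N.adjugate k i * (N * B) i k = (N.adjugate * (N * B)).trace := by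
    rw [Finset.sum_comm]
    rfl
  rw [h5, ← mul_assoc, Matrix.adjugate_mul, smul_mul_assoc, one_mul, Matrix.trace_smul, smul_eq_mul,
    smul_eq_mul, mul_comm]
  rfl

end MultilinearMap

end Multilinear

/-! ### Modules generated by a highest weight vector -/

theorem Module.End.eigenvalue_le_of_mem_span {M : Type*} [AddCommGroup M] [Module ℝ M]
    {T : Module.End ℝ M} {Λ Λ' : ℝ} {u : M} (hu : u ≠ 0) (hTu : T u = Λ' • u)
    (hmem : u ∈ Submodule.span ℝ {η | ∃ c ≤ Λ, T η = c • η}) : Λ' ≤ Λ := by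
  by_contra! hlt
  have hle : Submodule.span ℝ {η | ∃ c ≤ Λ, T η = c • η} ≤ ⨆ c ≠ Λ', T.eigenspace c := by
    rw [Submodule.span_le]
    rintro η ⟨c, hc, h⟩
    exact Submodule.mem_iSup_of_mem c (Submodule.mem_iSup_of_mem (by linarith : c < Λ').ne
      (Module.End.mem_eigenspace_iff.2 h))
  exact hu (Submodule.disjoint_def.1 (T.eigenspaces_iSupIndep Λ') u
    (Module.End.mem_eigenspace_iff.2 hTu) (hle hmem))

/-- `E` is generated from `ω` by the operators with `ν j > 0` alone. Each of these lowers the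
eigenvalue of `T`, which bounds the eigenvalues on `E` by that of `ω`. -/
theorem exists_stable_le_span {M N κ : Type*} [AddCommGroup M] [Module ℝ M] [AddCommGroup N]
    [Module ℝ N] [Fintype κ] (D : N →ₗ[ℝ] Module.End ℝ M) (T : Module.End ℝ M)
    (e : Module.Basis κ ℝ N) (ν : κ → ℝ) {Λ : ℝ} {ω : M} (hω : T ω = Λ • ω)
    (hT : ∀ j η, T (D (e j) η) = D (e j) (T η) - ν j • D (e j) η)
    (hneg : ∀ j, ¬ 0 < ν j → ∃ c : ℝ, D (e j) ω = c • ω)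
    (hD : ∀ u u', ∃ w, ∀ η, D u (D u' η) = D u' (D u η) + D w η) :
    ∃ E : Submodule ℝ M, ω ∈ E ∧ E ≤ Submodule.span ℝ {η | ∃ c ≤ Λ, T η = c • η} ∧
      ∀ u, ∀ η ∈ E, D u η ∈ E := by
  let E : Submodule ℝ M := sInf {E | ω ∈ E ∧ ∀ j, 0 < ν j → ∀ η ∈ E, D (e j) η ∈ E}
  have hEle : ∀ F : Submodule ℝ M, ω ∈ F →
      (∀ j, 0 < ν j → ∀ η ∈ F, D (e j) η ∈ F) → E ≤ F :=
    fun F h1 h2 ↦ sInf_le ⟨h1, h2⟩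
  have hωE : ω ∈ E := Submodule.mem_sInf.2 fun F hF ↦ hF.1
  have hEj : ∀ j, 0 < ν j → ∀ η ∈ E, D (e j) η ∈ E := fun j hj η hη ↦
    Submodule.mem_sInf.2 fun F hF ↦ hF.2 j hj η (Submodule.mem_sInf.1 hη F hF)
  clear_value E
  refine ⟨E, hωE, ?_, ?_⟩
  · refine hEle _ (Submodule.subset_span ⟨_, le_rfl, hω⟩) fun j hj η hη ↦ ?_
    induction hη using Submodule.span_induction with
    | mem η hη =>
      obtain ⟨c, hc, hη⟩ := hη
      refine Submodule.subset_span ⟨c - ν j, by linarith, ?_⟩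
      rw [hT, hη, map_smul, sub_smul]
    | zero => rw [map_zero]; exact zero_mem _
    | add _ _ _ _ h1 h2 => rw [map_add]; exact add_mem h1 h2
    | smul c _ _ h1 => rw [map_smul]; exact Submodule.smul_mem _ c h1
  -- The elements of `E` that every `D u` keeps in `E` include `ω`, and by the commutation relation
  -- they are stable under the generating operators; by minimality they exhaust `E`.
  · let F : Submodule ℝ M := E ⊓ ⨅ u, E.comap (D u)
    have hF : ∀ η, η ∈ F ↔ η ∈ E ∧ ∀ u, D u η ∈ E := fun η ↦ by
      simp [F, Submodule.mem_iInf]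
    have : E ≤ F := by
      refine hEle F ((hF _).2 ⟨hωE, fun u ↦ ?_⟩) fun j hj η hη ↦ ?_
      · rw [← e.sum_repr u, map_sum, LinearMap.sum_apply]
        refine sum_mem fun j _ ↦ ?_
        rw [map_smul, LinearMap.smul_apply]
        refine E.smul_mem _ ?_
        by_cases hj : 0 < ν j
        · exact hEj j hj ω hωE
        · obtain ⟨c, hc⟩ := hneg j hj
          rw [hc]
          exact E.smul_mem _ hωE
      · obtain ⟨hηE, hη⟩ := (hF _).1 hη
        refine (hF _).2 ⟨hη _, fun u ↦ ?_⟩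
        obtain ⟨w, hw⟩ := hD u (e j)
        rw [hw]
        exact add_mem (hEj j hj _ (hη u)) (hη w)
    exact fun u η hη ↦ ((hF η).1 (this hη)).2 u

open MultilinearMap in
theorem MultilinearMap.exists_volume {ι M n : Type*} [Fintype ι] [DecidableEq ι] [AddCommGroup M]
    [Module ℝ M] [FiniteDimensional ℝ M] [Finite n]
    (e : Module.Basis n ℝ M) (s : ι → n) (hs : Function.Injective s) :
    ∃ ω : MultilinearMap ℝ (fun _ : ι ↦ M) ℝ, ω (fun i ↦ e (s i)) = 1 ∧
      ∀ A : Module.End ℝ M,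
        (∀ x, (∀ i, e.repr x (s i) = 0) → ∀ i, e.repr (A x) (s i) = 0) →
        der A ω = (∑ i, e.repr (A (e (s i))) (s i)) • ω := by
  refine ⟨_, ?_, fun A hA ↦ der_det e s hs hA⟩
  have : (fun i : ι ↦ (LinearMap.pi fun k : ι ↦ e.coord (s k)) (e (s i))) =
      (1 : Matrix ι ι ℝ) := by
    ext i k
    classical
    rw [LinearMap.pi_apply, e.coord_apply, e.repr_self, Finsupp.single_apply, hs.eq_iff,
      Matrix.one_apply]
    split_ifs <;> rfl
  change Matrix.det (fun i : ι ↦ (LinearMap.pi fun k : ι ↦ e.coord (s k)) (e (s i))) = 1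
  rw [this, Matrix.det_one]

/-! ### The dual symmetric Lie algebra and the highest weight inequality -/

section Highest

variable {L : Type*} [LieRing L] [LieAlgebra ℝ L] {𝔤 : LieSubalgebra ℝ L} {V S : Submodule ℝ L}

namespace IsCompactSymmetricPair

variable (hL : IsCompactSymmetricPair 𝔤 V)

/-- The linear map which is `ad` on `𝔤` and `twist` on `V`; its range is the image of the adjoint
representation of the dual symmetric Lie algebra. -/
noncomputable def rho : L →ₗ[ℝ] Module.End ℝ L :=
  (2⁻¹ : ℝ) • ((LieAlgebra.ad ℝ L : L →ₗ[ℝ] Module.End ℝ L) ∘ₗ (LinearMap.id + hL.invol) +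
    hL.twist ∘ₗ (LinearMap.id - hL.invol))

theorem rho_of_mem_g {X : L} (hX : X ∈ 𝔤) : hL.rho X = LieAlgebra.ad ℝ L X := by
  simp [rho, hL.invol_of_mem_g hX, ← two_smul ℝ, smul_smul]

theorem rho_of_mem_V {v : L} (hv : v ∈ V) : hL.rho v = hL.twist v := by
  simp [rho, hL.invol_of_mem_V hv, ← two_smul ℝ, smul_smul]

theorem ad_mul_twist_sub {X : L} (hX : X ∈ 𝔤) (v : L) :
    LieAlgebra.ad ℝ L X * hL.twist v - hL.twist v * LieAlgebra.ad ℝ L X = hL.twist ⁅X, v⁆ := by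
  ext x
  simp only [LinearMap.sub_apply, Module.End.mul_apply, LieAlgebra.ad_apply, twist_apply,
    hL.invol_lie, hL.invol_of_mem_g hX]
  rw [leibniz_lie X v]
  abel

theorem twist_mul_twist_sub {v w : L} (hv : v ∈ V) (hw : w ∈ V) :
    hL.twist v * hL.twist w - hL.twist w * hL.twist v = -LieAlgebra.ad ℝ L ⁅v, w⁆ := by
  ext x
  simp only [LinearMap.sub_apply, Module.End.mul_apply, LinearMap.neg_apply, LieAlgebra.ad_apply,
    hL.twist_twist _ hv, hL.twist_twist _ hw]
  rw [leibniz_lie v w]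
  abel

/-- In the dual Lie algebra the bracket on `V × V` changes sign, and `rho` is its adjoint
representation. So `rho (e j)` shifts weights by `ν j`. -/
theorem twist_mul_rho_sub {H : L} (hH : H ∈ V) (u : L) :
    hL.twist H * hL.rho u - hL.rho u * hL.twist H = hL.rho (hL.twist H u) := by
  obtain ⟨X, hX, v, hv, rfl⟩ := hL.exists_add u
  have h1 := hL.ad_mul_twist_sub hX H
  have h2 := hL.twist_mul_twist_sub hH hv
  have h3 : hL.twist H X = -⁅X, H⁆ := by rw [twist_apply, hL.invol_of_mem_g hX, lie_skew]
  have h4 : hL.twist H v = -⁅H, v⁆ := by rw [twist_apply, hL.invol_of_mem_V hv, lie_neg]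
  rw [map_add, map_add, map_add, h3, h4, map_neg, map_neg, hL.rho_of_mem_V (hL.lie_mem_V X hX H hH),
    hL.rho_of_mem_g (hL.lie_mem_g H hH v hv), hL.rho_of_mem_g hX, hL.rho_of_mem_V hv, ← h1, ← h2]
  noncomm_ring

theorem exists_rho_eq (u u' : L) : ∃ w, hL.rho u * hL.rho u' - hL.rho u' * hL.rho u = hL.rho w := by
  obtain ⟨X, hX, v, hv, rfl⟩ := hL.exists_add u
  obtain ⟨X', hX', v', hv', rfl⟩ := hL.exists_add u'
  refine ⟨⁅X, X'⁆ + ⁅X, v'⁆ - ⁅X', v⁆ - ⁅v, v'⁆, ?_⟩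
  have h0 : LieAlgebra.ad ℝ L X * LieAlgebra.ad ℝ L X' - LieAlgebra.ad ℝ L X' * LieAlgebra.ad ℝ L X =
      LieAlgebra.ad ℝ L ⁅X, X'⁆ := by
    ext x
    simp only [LinearMap.sub_apply, Module.End.mul_apply, LieAlgebra.ad_apply]
    rw [leibniz_lie X X']
    abel
  have h1 := hL.ad_mul_twist_sub hX v'
  have h2 := hL.ad_mul_twist_sub hX' v
  have h3 := hL.twist_mul_twist_sub hv hv'
  rw [map_sub, map_sub, map_add, map_add, map_add, hL.rho_of_mem_g (𝔤.lie_mem hX hX'),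
    hL.rho_of_mem_V (hL.lie_mem_V X hX v' hv'), hL.rho_of_mem_V (hL.lie_mem_V X' hX' v hv),
    hL.rho_of_mem_g (hL.lie_mem_g v hv v' hv'), hL.rho_of_mem_g hX, hL.rho_of_mem_g hX',
    hL.rho_of_mem_V hv, hL.rho_of_mem_V hv', ← h0, ← h1, ← h2, sub_eq_add_neg _ ((LieAlgebra.ad ℝ L) ⁅v, v'⁆), ← h3]
  noncomm_ring

end IsCompactSymmetricPair

namespace WeightBasis

open MultilinearMap Finset

variable {hL : IsCompactSymmetricPair 𝔤 V} (W : WeightBasis hL S) (hS : IsMaximalAbelian V S)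
  [FiniteDimensional ℝ L] [TopologicalSpace L] [IsTopologicalAddGroup L]
  [ContinuousSMul ℝ L] [T2Space L]

theorem rho_e_apply_e (H : S) (hH : (H : L) ∈ V) (i j) :
    hL.twist H (hL.rho (W.e j) (W.e i)) = (W.ν i H + W.ν j H) • hL.rho (W.e j) (W.e i) := by
  have := LinearMap.congr_fun (hL.twist_mul_rho_sub hH (W.e j)) (W.e i)
  simp only [LinearMap.sub_apply, Module.End.mul_apply, W.twist_e, map_smul,
    LinearMap.smul_apply] at this
  rw [add_smul, ← this]
  abel

/-- A shift by a weight that is nonpositive at `h` cannot lead from the nonpositive part to the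
positive part. The volume form of the positive part is therefore an eigenvector of such a `rho (e
j)`. -/
theorem repr_rho_e_eq_zero {h : S} (hV : (h : L) ∈ V) {j} (hj : W.ν j h ≤ 0) {x : L}
    (hx : ∀ i, 0 < W.ν i h → W.e.repr x i = 0) {i} (hi : 0 < W.ν i h) :
    W.e.repr (hL.rho (W.e j) x) i = 0 := by
  rw [← W.e.sum_repr x, _root_.map_sum, _root_.map_sum, Finsupp.finsetSum_apply]
  refine sum_eq_zero fun k _ ↦ ?_
  rw [map_smul, map_smul, Finsupp.smul_apply, smul_eq_mul]
  by_cases hk : 0 < W.ν k h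
  · rw [hx k hk, zero_mul]
  · have h1 := W.repr_twist h (hL.rho (W.e j) (W.e k)) i
    rw [W.rho_e_apply_e h hV, map_smul, Finsupp.smul_apply, smul_eq_mul] at h1
    have h2 : (W.ν i h - (W.ν k h + W.ν j h)) * W.e.repr (hL.rho (W.e j) (W.e k)) i = 0 := by
      linarith
    rw [(mul_eq_zero.1 h2).resolve_left (by linarith), mul_zero]

include hS

theorem exists_stable_submodule {ι : Type*} [Fintype ι] [DecidableEq ι] {a : S}
    {ω : MultilinearMap ℝ (fun _ : ι ↦ L) ℝ} {Λ : ℝ}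
    (hdet : der (hL.twist a) ω = Λ • ω)
    (hdet2 : ∀ j, ¬ 0 < W.ν j a → ∃ c : ℝ, der (hL.rho (W.e j)) ω = c • ω) :
    ∃ E : Submodule ℝ (MultilinearMap ℝ (fun _ : ι ↦ L) ℝ), ω ∈ E ∧
      E ≤ Submodule.span ℝ {η | ∃ c ≤ Λ, der (hL.twist a) η = c • η} ∧
      ∀ φ ∈ isotropyGroup 𝔤, ∀ η ∈ E, (η.compLinearMap fun _ ↦ (φ : L →ₗ[ℝ] L)) ∈ E := by
  obtain ⟨E, hωE, hEeig, hErho⟩ := exists_stable_le_span (M := MultilinearMap ℝ (fun _ : ι ↦ L) ℝ)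
    (der (ι := ι) ∘ₗ hL.rho) (der (hL.twist a)) W.e
    (fun j ↦ W.ν j a) hdet (fun j η ↦ by
      have h : hL.rho (W.e j) * hL.twist a - hL.twist a * hL.rho (W.e j) =
          -(W.ν j a • hL.rho (W.e j)) := by
        rw [← neg_sub, hL.twist_mul_rho_sub (hS.le a.2), W.twist_e, map_smul]
      rw [LinearMap.comp_apply, der_der, h, map_neg, map_smul, sub_eq_add_neg]
      rfl) hdet2 (fun u u' ↦ by
      obtain ⟨w, hw⟩ := hL.exists_rho_eq u' u
      refine ⟨w, fun η ↦ ?_⟩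
      rw [LinearMap.comp_apply, LinearMap.comp_apply, LinearMap.comp_apply, der_der, hw])
  refine ⟨E, hωE, hEeig, fun φ hφ ↦ And.left (b :=
    ∀ η ∈ E, (η.compLinearMap fun _ ↦ ((φ⁻¹ : L ≃ₗ[ℝ] L) : L →ₗ[ℝ] L)) ∈ E) ?_⟩
  have hEexp : ∀ X ∈ 𝔤, ∀ η ∈ E,
      (η.compLinearMap fun _ ↦ NormedSpace.exp (LieAlgebra.ad ℝ L X)) ∈ E := by
    intro X hX η hη
    refine compLinearMap_exp_mem (fun η hη ↦ ?_) hη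
    rw [← hL.rho_of_mem_g hX]
    exact hErho X η hη
  · refine isotropyGroup_induction (p := fun φ ↦
      (∀ η ∈ E, (η.compLinearMap fun _ ↦ (φ : L →ₗ[ℝ] L)) ∈ E) ∧
      ∀ η ∈ E, (η.compLinearMap fun _ ↦ ((φ⁻¹ : L ≃ₗ[ℝ] L) : L →ₗ[ℝ] L)) ∈ E) ?_ ?_ ?_ ?_ hφ
    · exact ⟨fun η hη ↦ hη, fun η hη ↦ hη⟩
    · rintro φ ψ ⟨h1, h2⟩ ⟨h3, h4⟩
      refine ⟨fun η hη ↦ h3 _ (h1 η hη), fun η hη ↦ ?_⟩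
      rw [mul_inv_rev]
      exact h2 _ (h4 η hη)
    · rintro φ ⟨h1, h2⟩
      exact ⟨h2, by rwa [inv_inv]⟩
    · intro X hX
      refine ⟨hEexp X hX, fun η hη ↦ ?_⟩
      have := hEexp (-X) (neg_mem hX) η hη
      rw [map_neg] at this
      exact this

/-- The highest weight inequality: if the isotropy group moves `a` in the open chamber to `a' ∈ S`,
then the functional `∑ i with 0 < ν i h, ν i` is not larger on `a'` than on `a`, for `h` in the
closed chamber. -/
theorem sum_weights_le {a h a' : S} (ha : a ∈ regularSet S) (hh : ∀ i, 0 < W.ν i a → 0 ≤ W.ν i h)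
    {φ : L ≃ₗ[ℝ] L} (hφ : φ ∈ isotropyGroup 𝔤) (hφa : φ a = a') :
    ∑ i with 0 < W.ν i h, W.ν i a' ≤ ∑ i with 0 < W.ν i h, W.ν i a := by
  classical
  let ι := {i // 0 < W.ν i h}
  obtain ⟨ω, hω1, hω⟩ := exists_volume W.e (fun i : ι ↦ (i : Fin _)) Subtype.val_injective
  have hle : ∀ i, ¬ 0 < W.ν i a → W.ν i h ≤ 0 := by
    intro i hi
    by_cases h0 : W.ν i = 0
    · simp [h0]
    · obtain ⟨k, hk⟩ := W.exists_neg hS i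
      have h1 := (W.mem_regularSet_iff hS).1 ha i h0
      have h2 := hh k (by
        rw [hk, LinearMap.neg_apply]
        linarith [lt_of_le_of_ne (not_lt.1 hi) h1])
      rw [hk, LinearMap.neg_apply] at h2
      linarith
  have hdet : ∀ b : S, der (hL.twist b) ω = (∑ i with 0 < W.ν i h, W.ν i b) • ω := by
    intro b
    rw [hω]
    · congr 1
      rw [Finset.sum_subtype (p := fun i ↦ 0 < W.ν i h) _ (by simp)]
      refine sum_congr rfl fun i _ ↦ ?_
      rw [W.twist_e]
      simp
    · intro x hx i
      rw [W.repr_twist, hx i, mul_zero]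
  have hdet2 : ∀ j, W.ν j h ≤ 0 → ∃ c : ℝ, der (hL.rho (W.e j)) ω = c • ω := by
    intro j hj
    refine ⟨_, hω _ fun x hx i ↦ ?_⟩
    exact W.repr_rho_e_eq_zero (hS.le h.2) hj (fun i hi ↦ hx ⟨i, hi⟩) i.2
  obtain ⟨E, hωE, hEeig, hEφ⟩ := exists_stable_submodule W hS (hdet a) fun j hj ↦ hdet2 j (hle j hj)
  specialize hEφ φ hφ
  let u : MultilinearMap ℝ (fun _ : ι ↦ L) ℝ := ω.compLinearMap fun _ ↦ (φ : L →ₗ[ℝ] L)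
  have hu0 : u ≠ 0 := by
    intro hu
    have : u (fun i ↦ φ.symm (W.e i)) = 1 := by
      rw [← hω1]
      simp [u]
    simp [hu] at this
  -- Since `φ` intertwines the twists by `a` and `a'`, the pulled back form has the eigenvalue
  -- `Λ_h(a')` for `twist a`; it lies in `E`, where eigenvalues are at most `Λ_h(a)`.
  refine Module.End.eigenvalue_le_of_mem_span (T := der (hL.twist a)) hu0 ?_ (hEeig (hEφ ω hωE))
  rw [der_compLinearMap (B := hL.twist a'), hdet a']
  · rfl
  · ext x
    have := hL.map_twist (isPairAut_of_mem hL.lie_mem_V hφ) a x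
    rw [hφa] at this
    exact this

end WeightBasis

end Highest

/-! ### Uniqueness of the orbit point in the closed chamber -/

section Unique

variable {L : Type*} [LieRing L] [LieAlgebra ℝ L] {𝔤 : LieSubalgebra ℝ L} {V S : Submodule ℝ L}
  {hL : IsCompactSymmetricPair 𝔤 V}

namespace WeightBasis

variable (W : WeightBasis hL S) (hS : IsMaximalAbelian V S)
include W hS

theorem pos_of_pos {a h : S} (ha : a ∈ regularSet S) (hh : ∀ i, 0 < W.ν i a → 0 ≤ W.ν i h) {i}
    (hi : 0 < W.ν i h) : 0 < W.ν i a := by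
  by_contra h0
  have h1 := (W.mem_regularSet_iff hS).1 ha i (fun h ↦ by simp [h] at hi)
  obtain ⟨k, hk⟩ := W.exists_neg hS i
  have h2 := hh k (by rw [hk, LinearMap.neg_apply]; linarith [lt_of_le_of_ne (not_lt.1 h0) h1])
  rw [hk, LinearMap.neg_apply] at h2
  linarith

theorem eq_zero_of_forall_pos {a h : S} (ha : a ∈ regularSet S)
    (hh : ∀ i, 0 < W.ν i a → W.ν i h = 0) : h = 0 := by
  refine W.eq_zero_of_weights hS fun j ↦ ?_
  rcases lt_trichotomy (W.ν j h) 0 with h1 | h1 | h1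
  · obtain ⟨k, hk⟩ := W.exists_neg hS j
    have h3 : 0 < W.ν k h := by rw [hk, LinearMap.neg_apply]; linarith
    exact absurd (hh k (W.pos_of_pos hS ha (fun i hi ↦ (hh i hi).ge) h3)) h3.ne'
  · exact h1
  · exact hh j (W.pos_of_pos hS ha (fun i hi ↦ (hh i hi).ge) h1)

variable [FiniteDimensional ℝ L]

/-- The centralizer of a regular `a` lies in that of every `x ∈ S`; here `φ` maps one onto the
other, so the dimensions agree and the inclusion is an equality. -/
theorem ker_ad_eq {φ : L ≃ₗ[ℝ] L} (hφ : IsPairAut 𝔤 V φ) {a x : S} (ha : a ∈ regularSet S)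
    (hax : φ a = x) {z : L} (hz : ⁅(x : L), z⁆ = 0) : ⁅(a : L), z⁆ = 0 := by
  have hle : LinearMap.ker (LieAlgebra.ad ℝ L (a : L)) ≤ LinearMap.ker (LieAlgebra.ad ℝ L (x : L)) :=
    fun z hz ↦ W.lie_eq_zero_of_regular hS ha
      (by rw [show ⁅(a : L), z⁆ = 0 from hz, lie_zero]) x
  have hmap : (LinearMap.ker (LieAlgebra.ad ℝ L (a : L))).map (φ : L →ₗ[ℝ] L) =
      LinearMap.ker (LieAlgebra.ad ℝ L (x : L)) := by
    ext z
    rw [Submodule.mem_map_equiv]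
    change ⁅(a : L), φ.symm z⁆ = 0 ↔ ⁅(x : L), z⁆ = 0
    rw [← φ.map_eq_zero_iff, hφ.map_lie, hax, φ.apply_symm_apply]
  have heq := Submodule.eq_of_le_of_finrank_eq hle (by rw [← hmap]; exact (φ.finrank_map_eq _).symm)
  exact heq.ge hz

theorem mem_regularSet_of_map {φ : L ≃ₗ[ℝ] L} (hφ : IsPairAut 𝔤 V φ) {a x : S}
    (ha : a ∈ regularSet S) (hax : φ a = x) : x ∈ regularSet S := by
  refine (W.mem_regularSet_iff hS).2 fun j hj h0 ↦ hj ?_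
  have h1 : ⁅(x : L), hL.invol (W.e j)⁆ = 0 := by
    rw [← hL.twist_apply, W.twist_e, h0, zero_smul]
  have h2 := W.ker_ad_eq hS hφ ha hax h1
  ext H
  have h3 := W.lie_eq_zero_of_regular hS ha (by rw [h2, lie_zero]) H
  rw [← hL.twist_apply, W.twist_e] at h3
  exact (smul_eq_zero.1 h3).resolve_right (W.e.ne_zero j)

theorem map_mem {φ : L ≃ₗ[ℝ] L} (hφ : IsPairAut 𝔤 V φ) {a x : S}
    (ha : a ∈ regularSet S) (hax : φ a = x) : ∀ H ∈ S, φ H ∈ S := fun H hH ↦ by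
  refine W.mem_of_lie_eq_zero hS (W.mem_regularSet_of_map hS hφ ha hax)
    ((hφ.mem_V _).2 (hS.le hH)) ?_
  rw [← hax, ← hφ.map_lie, hS.abelian _ a.2 _ hH, map_zero]

variable [TopologicalSpace L] [IsTopologicalAddGroup L] [ContinuousSMul ℝ L] [T2Space L]

open Finset in
/-- A point of an open chamber is the only point of its orbit in the closed chamber. -/
theorem eq_of_map_eq {C : Set S} (hC : IsOpenChamber C) {a x : S} (ha : a ∈ C)
    (hx : x ∈ closure C) {φ : L ≃ₗ[ℝ] L} (hφ : φ ∈ isotropyGroup 𝔤) (hax : φ a = x) : x = a := by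
  have hP := isPairAut_of_mem hL.lie_mem_V hφ
  have hreg : ∀ {k}, k ∈ C → k ∈ regularSet S := W.mem_regularSet_of_mem_chamber hS hC
  have hmem : ∀ {k l}, k ∈ C → (l ∈ C ↔ ∀ j, 0 < W.ν j k → 0 < W.ν j l) := fun {k l} hk ↦ by
    conv_lhs => rw [W.chamber_eq hS hC hk]
    rfl
  have hxC : x ∈ C := (hmem ha).2 fun j hj ↦ lt_of_le_of_ne (W.nonneg_of_mem_closure hS hC ha hx hj)
    ((W.mem_regularSet_iff hS).1 (W.mem_regularSet_of_map hS hP (hreg ha) hax) j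
      fun h ↦ by simp [h] at hj).symm
  let w : S →ₗ[ℝ] S := (φ : L →ₗ[ℝ] L).restrict (W.map_mem hS hP (hreg ha) hax)
  have hw : ∀ k : S, φ k = w k := fun k ↦ rfl
  have hwa : w a = x := Subtype.ext hax
  -- The image of `C` is connected, consists of regular points and contains `x ∈ C`.
  have hwC : ∀ k ∈ C, w k ∈ C := by
    have hsub : w '' C ⊆ regularSet S := by
      rintro _ ⟨k, hk, rfl⟩
      exact W.mem_regularSet_of_map hS hP (hreg hk) (hw k)
    obtain ⟨H₀, hH₀, hCeq⟩ := hC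
    have hpre : IsPreconnected (w '' C) := by
      rw [hCeq]
      exact isPreconnected_connectedComponentIn.image _
        w.continuous_of_finiteDimensional.continuousOn
    have h1 := hpre.subset_connectedComponentIn ⟨a, ha, hwa⟩ hsub
    rw [← connectedComponentIn_eq (hCeq ▸ hxC), ← hCeq] at h1
    exact fun k hk ↦ h1 ⟨k, hk, rfl⟩
  have hadd : ∀ h k : S, (∀ i, 0 < W.ν i a → 0 ≤ W.ν i h) → k ∈ C → h + k ∈ C := by
    intro h k hh hk
    refine (hmem ha).2 fun j hj ↦ ?_
    rw [map_add]
    linarith [hh j hj, (hmem ha).1 hk j hj]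
  have hsum : ∀ h k : S, (∀ i, 0 < W.ν i a → 0 ≤ W.ν i h) → k ∈ C →
      ∑ i with 0 < W.ν i h, W.ν i (w k) = ∑ i with 0 < W.ν i h, W.ν i k := by
    intro h k hh hk
    have h1 : ∀ {l}, l ∈ C → ∀ i, 0 < W.ν i l → 0 ≤ W.ν i h := fun hl i hi ↦
      hh i ((hmem hl).1 ha i hi)
    -- The inequality is used for `φ` at `k` and for `φ⁻¹` at `w k`.
    refine le_antisymm (W.sum_weights_le hS (hreg hk) (h1 hk) hφ (hw k))
      (W.sum_weights_le hS (hreg (hwC k hk)) (h1 (hwC k hk)) ((isotropyGroup 𝔤).inv_mem hφ) ?_)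
    rw [← hw]
    exact φ.symm_apply_apply _
  rw [← hwa]
  refine eq_self_of_mem_cone (univ.filter fun i ↦ 0 < W.ν i a) W.ν (fun y hy ↦ ?_) w
    (fun h hh ↦ ?_) (fun h k hh hk ↦ ?_) a (fun i hi ↦ (mem_filter.1 hi).2.le)
  · exact W.eq_zero_of_forall_pos hS (hreg ha) fun i hi ↦ hy i (by simpa using hi)
  · simp only [mem_filter, Finset.mem_univ, true_and] at hh ⊢
    intro i hi
    by_contra! h0
    have h1 : 0 < W.ν i (w a) := hwa ▸ (hmem ha).1 hxC i hi
    -- The coefficient is chosen so that `ν i` vanishes at the image of `c • h + a`, although that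
    -- image must lie in the open chamber.
    have h2 := hwC _ (hadd ((-W.ν i (w h) / W.ν i (w a))⁻¹ • h) a (fun j hj ↦ by
      rw [map_smul]
      exact mul_nonneg (inv_nonneg.2 (div_nonneg (by linarith) h1.le)) (hh j hj)) ha)
    have h3 := (hmem ha).1 h2 i hi
    rw [map_add, map_add, map_smul, map_smul, smul_eq_mul] at h3
    have : (-W.ν i (w h) / W.ν i (w a))⁻¹ * W.ν i (w h) = - W.ν i (w a) := by
      field_simp [h0.ne, h1.ne']
    linarith
  · simp only [mem_filter, Finset.mem_univ, true_and] at hh hk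
    have hf : (univ.filter fun i ↦ 0 < W.ν i a).filter (fun i ↦ 0 < W.ν i h) =
        univ.filter fun i ↦ 0 < W.ν i h := by
      rw [filter_filter]
      exact filter_congr fun i _ ↦ ⟨And.right, fun h1 ↦ ⟨W.pos_of_pos hS (hreg ha) hh h1, h1⟩⟩
    rw [hf]
    -- A point `k` of the closed chamber is the difference of the points `k + a` and `a` of the open
    -- one.
    have h1 := hsum h _ hh (hadd k a hk ha)
    have h2 := hsum h a hh ha
    simp only [map_add, sum_add_distrib] at h1
    linarith

end WeightBasis

end Unique

/-! ### Generalized inverses depending smoothly on time -/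

section GeneralizedInverse

open Polynomial

theorem Polynomial.contDiff_eval (p : ℝ[X]) {n : WithTop ℕ∞} :
    ContDiff ℝ n fun t ↦ p.eval t := by
  simpa using p.contDiff_aeval (𝕜 := ℝ) n

variable {M : Type*} [AddCommGroup M] [Module ℝ M] [FiniteDimensional ℝ M]

theorem LinearMap.exists_charpoly_coeff_eq_eval (P Q : Module.End ℝ M) :
    ∃ c : ℕ → ℝ[X], ∀ (t : ℝ) (i : ℕ),
      (LinearMap.charpoly ((P + t • Q) * (P + t • Q))).coeff i = (c i).eval t := by
  let b := Module.finBasis ℝ M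
  let N : Matrix _ _ ℝ[X] := (LinearMap.toMatrix b b P).map C +
    (X : ℝ[X]) • (LinearMap.toMatrix b b Q).map C
  refine ⟨fun i ↦ (N * N).charpoly.coeff i, fun t i ↦ ?_⟩
  have h : LinearMap.toMatrix b b (P + t • Q) = N.map (evalRingHom t) := by
    ext i j
    simp [N, mul_comm t]
  rw [← LinearMap.charpoly_toMatrix _ b, LinearMap.toMatrix_mul, h, ← Matrix.map_mul,
    Matrix.charpoly_map, coeff_map]
  rfl

/-- The generalized inverse of a diagonalizable operator, as a polynomial in the operator. -/
theorem LinearMap.mul_mul_eq_of_diagonal {ι : Type*} [Fintype ι] [DecidableEq ι] {D : Module.End ℝ M}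
    (b : Module.Basis ι ℝ M) (d : ι → ℝ) (hD : ∀ j, D (b j) = d j • b j) {m n : ℕ}
    (hm : m = (Finset.univ.filter fun j ↦ d j = 0).card) (hn : Fintype.card ι < n) :
    D.charpoly.coeff m ≠ 0 ∧
    D * (-(D.charpoly.coeff m)⁻¹ • ∑ i ∈ Finset.range n, D.charpoly.coeff (m + 1 + i) • D ^ i) * D =
      D := by
  -- The characteristic polynomial is `X ^ m * q` with `q(0) ≠ 0`, and `q(D) D = 0`. Writing `q =
  -- q(0) + X r` gives `D r(D) D = -q(0) D`. The bound `n` only has to exceed the degree of `r`.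
  let q : ℝ[X] := ∏ j with d j ≠ 0, (X - C (d j))
  have hchar : D.charpoly = X ^ m * q := by
    have : LinearMap.toMatrix b b D = Matrix.diagonal d := by
      ext i j
      rw [LinearMap.toMatrix_apply, hD, map_smul, b.repr_self, Finsupp.smul_apply,
        Finsupp.single_apply, Matrix.diagonal_apply]
      by_cases h : i = j
      · simp [h]
      · simp [h, Ne.symm h]
    rw [← LinearMap.charpoly_toMatrix _ b, this, Matrix.charpoly_diagonal,
      ← Finset.prod_filter_mul_prod_filter_not Finset.univ fun j ↦ d j = 0, hm]
    congr 1
    rw [← Finset.prod_const]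
    refine Finset.prod_congr rfl fun j hj ↦ ?_
    rw [(Finset.mem_filter.1 hj).2, C_0, sub_zero]
  have hcoeff : ∀ i, D.charpoly.coeff (m + i) = q.coeff i := fun i ↦ by
    rw [hchar, add_comm, coeff_X_pow_mul]
  have h0 : q.coeff 0 ≠ 0 := by
    rw [coeff_zero_eq_eval_zero, eval_prod]
    refine Finset.prod_ne_zero_iff.2 fun j hj ↦ ?_
    simpa using (Finset.mem_filter.1 hj).2
  have hdeg : q.divX.natDegree < n := by
    rw [natDegree_divX_eq_natDegree_tsub_one, natDegree_prod_of_monic _ _ fun j _ ↦ monic_X_sub_C _]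
    simp only [natDegree_X_sub_C, Finset.sum_const, smul_eq_mul, mul_one]
    have := Finset.card_filter_le (Finset.univ : Finset ι) (fun j ↦ d j ≠ 0)
    rw [Finset.card_univ] at this
    omega
  have hsum : ∑ i ∈ Finset.range n, D.charpoly.coeff (m + 1 + i) • D ^ i = aeval D q.divX := by
    rw [aeval_eq_sum_range' hdeg]
    refine Finset.sum_congr rfl fun i _ ↦ ?_
    rw [coeff_divX, add_assoc, hcoeff, add_comm 1]
  have hqD : aeval D q * D = 0 := by
    refine b.ext fun j ↦ ?_
    rw [Module.End.mul_apply, hD, map_smul, Module.End.aeval_apply_of_hasEigenvector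
      (Module.End.hasEigenvector_iff.2 ⟨Module.End.mem_eigenspace_iff.2 (hD j), b.ne_zero j⟩)]
    by_cases h : d j = 0
    · simp [h]
    · have : eval (d j) q = 0 := by
        rw [eval_prod]
        exact Finset.prod_eq_zero (Finset.mem_filter.2 ⟨Finset.mem_univ j, h⟩) (by simp)
      simp [this]
  rw [← divX_mul_X_add q, map_add, map_mul, aeval_X, aeval_C, add_mul, Algebra.algebraMap_eq_smul_one,
    smul_mul_assoc, one_mul] at hqD
  have hm0 := hcoeff 0
  rw [add_zero] at hm0
  refine ⟨by rwa [hm0], ?_⟩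
  have hc : D * aeval D q.divX = aeval D q.divX * D := by
    simpa using congrArg (aeval D) (mul_comm X q.divX)
  rw [hsum, mul_smul_comm, smul_mul_assoc, hc, eq_neg_of_add_eq_zero_left hqD, hm0, smul_neg,
    neg_smul, neg_neg, smul_smul, inv_mul_cancel₀ h0, one_smul]

end GeneralizedInverse

namespace WeightBasis

open LieAlgebra

variable {L : Type*} [LieRing L] [LieAlgebra ℝ L] {𝔤 : LieSubalgebra ℝ L} {V S : Submodule ℝ L}
  {hL : IsCompactSymmetricPair 𝔤 V} [FiniteDimensional ℝ L] (W : WeightBasis hL S)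
  (hS : IsMaximalAbelian V S)
include W hS

open Classical in
-- The square of `ad (A + tα)` is diagonalizable over `ℝ`, with as many zero eigenvalues at each
-- time considered as there are zero weights. One formula, rational in `t`, thus serves all these
-- times, and being a polynomial in the square it preserves `𝔤`.
theorem exists_contDiffAt_inverse {A α : L} (hA : A ∈ V) (hα : α ∈ V) :
    ∃ R : ℝ → Module.End ℝ L, ∀ t : ℝ, (∃ a ∈ regularSet S, ∃ φ : L ≃ₗ[ℝ] L, IsPairAut 𝔤 V φ ∧
        φ (A + t • α) = (a : L)) →
      ContDiffAt ℝ 1 R t ∧ (∀ X ∈ 𝔤, R t X ∈ 𝔤) ∧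
      R t * ad ℝ L (A + t • α) = ad ℝ L (A + t • α) * R t ∧
      ad ℝ L (A + t • α) * ad ℝ L (A + t • α) * R t * ad ℝ L (A + t • α) =
        ad ℝ L (A + t • α) := by
  obtain ⟨c, hc⟩ := LinearMap.exists_charpoly_coeff_eq_eval (ad ℝ L A) (ad ℝ L α)
  have had : ∀ t : ℝ, ad ℝ L A + t • ad ℝ L α = ad ℝ L (A + t • α) := fun t ↦ by simp
  set m := (Finset.univ.filter fun j ↦ W.ν j = 0).card with hm
  set n := Module.finrank ℝ L + 1 with hn
  let D : ℝ → Module.End ℝ L := fun t ↦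
    (ad ℝ L A + t • ad ℝ L α) * (ad ℝ L A + t • ad ℝ L α)
  refine ⟨fun t ↦ -((c m).eval t)⁻¹ • ∑ i ∈ Finset.range n, (c (m + 1 + i)).eval t • D t ^ i,
    fun t ht ↦ ?_⟩
  obtain ⟨a, ha, φ, hφ, hφa⟩ := ht
  have hV : A + t • α ∈ V := add_mem hA (V.smul_mem _ hα)
  have hdiag : ∀ j, D t (W.e.map φ.symm j) = -(W.ν j a * W.ν j a) • W.e.map φ.symm j := by
    intro j
    apply φ.injective
    simp only [D, had, Module.Basis.map_apply, Module.End.mul_apply, ad_apply, map_smul, hφ.map_lie,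
      hφa, LinearEquiv.apply_symm_apply, W.lie_lie_e hS]
  have hm' : m = (Finset.univ.filter fun j ↦ -(W.ν j a * W.ν j a) = 0).card := by
    rw [hm]
    congr 1
    refine Finset.filter_congr fun j _ ↦ ⟨fun h ↦ by simp [h], fun h ↦ ?_⟩
    by_contra h0
    exact (W.mem_regularSet_iff hS).1 ha j h0 (by simpa using h)
  obtain ⟨h1, h2⟩ := LinearMap.mul_mul_eq_of_diagonal _ _ hdiag hm' (n := n) (by simp [n])
  simp only [D, hc] at h1 h2
  have hD : ContDiff ℝ 1 D := by
    have : ContDiff ℝ 1 fun t : ℝ ↦ ad ℝ L A + t • ad ℝ L α :=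
      contDiff_const.add (contDiff_id.smul contDiff_const)
    exact this.mul this
  have hcomm : ∀ T : Module.End ℝ L, Commute (D t) T → Commute
      (-((c m).eval t)⁻¹ • ∑ i ∈ Finset.range n, (c (m + 1 + i)).eval t • D t ^ i) T := fun T hT ↦
    (Commute.sum_left _ _ _ fun i _ ↦ (hT.pow_left i).smul_left _).smul_left _
  have hN := hcomm (ad ℝ L (A + t • α)) (by
    simp only [D, had]
    exact (Commute.refl _).mul_left (Commute.refl _))
  refine ⟨?_, ?_, hN, ?_⟩
  · refine ContDiffAt.smul (((c m).contDiff_eval.contDiffAt.inv h1).neg) ?_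
    exact (ContDiff.sum fun i _ ↦ (c _).contDiff_eval.smul (hD.pow i)).contDiffAt
  · intro X hX
    have hpow : ∀ i, (D t ^ i) X ∈ 𝔤 := by
      intro i
      induction i with
      | zero => simpa using hX
      | succ i ih =>
        rw [pow_succ', Module.End.mul_apply]
        have hDt : ∀ y, D t y = ⁅A + t • α, ⁅A + t • α, y⁆⁆ := fun y ↦ by
          simp only [D, had, Module.End.mul_apply, ad_apply]
        rw [hDt]
        refine hL.lie_mem_g _ hV _ ?_
        rw [← lie_skew]
        exact neg_mem (hL.lie_mem_V _ ih _ hV)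
    rw [LinearMap.smul_apply, LinearMap.sum_apply]
    exact 𝔤.smul_mem _ (sum_mem fun i _ ↦ 𝔤.smul_mem _ (hpow i))
  · set R := -((c m).eval t)⁻¹ • ∑ i ∈ Finset.range n, (c (m + 1 + i)).eval t • D t ^ i
    simp only [had] at h2
    have hRN : R * ad ℝ L (A + t • α) = ad ℝ L (A + t • α) * R := hN
    set N := ad ℝ L (A + t • α)
    -- From `N²RN² = N²` one factor `N` is cancelled: `N` is skew for a definite form, so `N² z = 0`
    -- forces `N z = 0`.
    have key : N * (N * (N * R * N - 1)) = 0 := by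
      rw [← sub_eq_zero] at h2
      rw [← h2]
      have h3 : R * (N * N) = N * R * N := by rw [← mul_assoc, hRN]
      rw [mul_assoc (N * N) R (N * N), h3]
      noncomm_ring
    rw [← sub_eq_zero]
    ext z
    have hy : (N * N * R * N - N) z = N ((N * R * N - 1) z) := by
      rw [← Module.End.mul_apply, mul_sub, mul_one, ← mul_assoc, ← mul_assoc]
    rw [hy]
    refine hL.eq_zero_of_negKilling ?_
    have h3 : ⁅A + t • α, N ((N * R * N - 1) z)⁆ = 0 := LinearMap.congr_fun key z
    conv_lhs => rw [show N ((N * R * N - 1) z) = ⁅A + t • α, (N * R * N - 1) z⁆ from rfl]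
    rw [negKilling_lie_skew,
      show ⁅A + t • α, (N * R * N - 1) z⁆ = N ((N * R * N - 1) z) from rfl, h3, negKilling_zero_right, neg_zero]

end WeightBasis

/-! ### The slice at a regular point and openness of the regular times -/

section Openness

open LieAlgebra NormedSpace

variable {L : Type*} [LieRing L] [LieAlgebra ℝ L] [FiniteDimensional ℝ L] {𝔤 : LieSubalgebra ℝ L}
  {V S : Submodule ℝ L}

/-- A map which applies exponentials to vectors is open if its linearization is surjective. -/
theorem map_nhds_exp_apply {E₁ E₂ E₃ : Type*} [NormedAddCommGroup E₁] [NormedSpace ℝ E₁]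
    [FiniteDimensional ℝ E₁] [NormedAddCommGroup E₂] [NormedSpace ℝ E₂] [FiniteDimensional ℝ E₂]
    [NormedAddCommGroup E₃] [NormedSpace ℝ E₃] [FiniteDimensional ℝ E₃]
    (f : E₁ →ₗ[ℝ] Module.End ℝ L) (g : E₂ →ₗ[ℝ] L) (P : L →ₗ[ℝ] E₃) (y : E₂)
    (hsurj : ∀ v, ∃ ξ η, P (g η) + P (f ξ (g y)) = v) :
    Filter.map (fun p : E₁ × E₂ ↦ P (exp (f p.1) (g p.2))) (𝓝 (0, y)) = 𝓝 (P (g y)) := by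
  let b : Module.End ℝ L →ₗ[ℝ] E₂ →ₗ[ℝ] E₃ :=
    LinearMap.mk₂ ℝ (fun T η ↦ P (T (g η))) (fun _ _ _ ↦ by simp) (fun _ _ _ ↦ by simp)
      (fun _ _ _ ↦ by simp) (fun _ _ _ ↦ by simp)
  let b' : Module.End ℝ L →L[ℝ] E₂ →L[ℝ] E₃ := LinearMap.toContinuousLinearMap
    ((LinearMap.toContinuousLinearMap (𝕜 := ℝ) (E := E₂) (F' := E₃)).toLinearMap ∘ₗ b)
  let f' : E₁ →L[ℝ] Module.End ℝ L := LinearMap.toContinuousLinearMap f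
  have h1 : HasStrictFDerivAt (fun p : E₁ × E₂ ↦ exp (f' p.1))
      ((1 : Module.End ℝ L →L[ℝ] Module.End ℝ L) ∘L (f' ∘L ContinuousLinearMap.fst ℝ E₁ E₂))
      (0, y) := by
    refine HasStrictFDerivAt.comp (0, y) ?_
      (f' ∘L ContinuousLinearMap.fst ℝ E₁ E₂).hasStrictFDerivAt
    simpa using hasStrictFDerivAt_exp_zero (𝕂 := ℝ) (𝔸 := Module.End ℝ L)
  have h2 := (b'.hasStrictFDerivAt.comp (0, y) h1).clm_apply
    (ContinuousLinearMap.snd ℝ E₁ E₂).hasStrictFDerivAt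
  have h3 := h2.map_nhds_eq_of_surj (LinearMap.range_eq_top.2 fun v ↦ by
    obtain ⟨ξ, η, h⟩ := hsurj v
    refine ⟨(ξ, η), ?_⟩
    rw [← h]
    simp [b', b, f'])
  refine Eq.trans h3 (congrArg 𝓝 ?_)
  change P (exp (f 0) (g y)) = P (g y)
  rw [map_zero, exp_zero]
  rfl

variable {hL : IsCompactSymmetricPair 𝔤 V} (W : WeightBasis hL S) (hS : IsMaximalAbelian V S)
include W hS

/-- Take `X = -R [a, v]`, with `R` the generalized inverse on the constant line through `a`. The
remainder commutes with the regular `a`, so it lies in `S`. -/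
theorem WeightBasis.exists_add_lie {a : S} (ha : a ∈ regularSet S) {v : L} (hv : v ∈ V) :
    ∃ X ∈ 𝔤, ∃ H ∈ S, H + ⁅X, (a : L)⁆ = v := by
  obtain ⟨R, hR⟩ := W.exists_contDiffAt_inverse hS (hS.le a.2) (zero_mem V)
  obtain ⟨-, h1, -, h2⟩ := hR 0 ⟨a, ha, LinearEquiv.refl ℝ L,
    ⟨fun _ _ ↦ rfl, fun _ ↦ Iff.rfl, fun _ ↦ Iff.rfl⟩, by simp⟩
  rw [zero_smul, add_zero] at h2
  have hX := h1 _ (hL.lie_mem_g _ (hS.le a.2) v hv)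
  refine ⟨-R 0 ⁅(a : L), v⁆, neg_mem hX, v + ⁅R 0 ⁅(a : L), v⁆, (a : L)⁆, ?_, by
    rw [neg_lie, add_neg_cancel_right]⟩
  refine W.mem_of_lie_eq_zero hS ha (add_mem hv (hL.lie_mem_V _ hX _ (hS.le a.2))) ?_
  have h3 : ⁅(a : L), ⁅(a : L), R 0 ⁅(a : L), v⁆⁆⁆ = ⁅(a : L), v⁆ := LinearMap.congr_fun h2 v
  rw [lie_add, ← lie_skew (R 0 _), lie_neg, h3, add_neg_cancel]

variable [TopologicalSpace L] [IsTopologicalAddGroup L] [ContinuousSMul ℝ L] [T2Space L]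

theorem isOpen_regularTimes {C : Set S} (hC : IsOpenChamber C) {A α : L} (hA : A ∈ V)
    (hα : α ∈ V) : IsOpen (regularTimes 𝔤 C A α) := by
  refine isOpen_iff_mem_nhds.2 fun t₀ ⟨a, ha, φ, hφ, hφa⟩ ↦ ?_
  have hP := isPairAut_of_mem hL.lie_mem_V hφ
  have hreg := W.mem_regularSet_of_mem_chamber hS hC ha
  let cg := (Module.finBasis ℝ 𝔤.toSubmodule).equivFun.symm
  let cs := (Module.finBasis ℝ S).equivFun.symm
  let cv := (Module.finBasis ℝ V).equivFun
  let P : L →ₗ[ℝ] (Fin (Module.finrank ℝ V) → ℝ) :=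
    cv.toLinearMap ∘ₗ V.projectionOnto 𝔤.toSubmodule hL.isCompl.symm
  have hcv : ∀ v w : L, v ∈ V → w ∈ V → P v = P w → v = w := by
    intro v w hv hw h
    have h1 := cv.injective h
    rw [Submodule.projectionOnto_apply_of_mem_left _ hv,
      Submodule.projectionOnto_apply_of_mem_left _ hw] at h1
    exact congrArg Subtype.val h1
  have hmap := map_nhds_exp_apply
    ((ad ℝ L : L →ₗ[ℝ] Module.End ℝ L) ∘ₗ 𝔤.toSubmodule.subtype ∘ₗ cg.toLinearMap)
    (S.subtype ∘ₗ cs.toLinearMap) P (cs.symm a) (fun v ↦ by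
      obtain ⟨X, hX, H, hH, h⟩ := W.exists_add_lie hS hreg (cv.symm v).2
      refine ⟨cg.symm ⟨X, hX⟩, cs.symm ⟨H, hH⟩, ?_⟩
      rw [← map_add]
      simp only [LinearMap.comp_apply, LinearEquiv.coe_coe, LinearEquiv.apply_symm_apply,
        Submodule.subtype_apply, LieHom.coe_toLinearMap, ad_apply, h, P]
      rw [Submodule.projectionOnto_apply_left, LinearEquiv.apply_symm_apply])
  have hcont : Continuous fun t : ℝ ↦ P (φ (A + t • α)) := by
    simp only [map_add, map_smul]
    fun_prop
  have hU : {p : (Fin (Module.finrank ℝ 𝔤.toSubmodule) → ℝ) × (Fin (Module.finrank ℝ S) → ℝ) |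
      cs p.2 ∈ C} ∈ 𝓝 (0, cs.symm a) :=
    ((W.isOpen_chamber hS hC ha).preimage ((cs.toLinearMap.continuous_of_finiteDimensional).comp
      continuous_snd)).mem_nhds (by simpa using ha)
  have him := Filter.image_mem_map (m := fun p : (Fin (Module.finrank ℝ 𝔤.toSubmodule) → ℝ) ×
    (Fin (Module.finrank ℝ S) → ℝ) ↦ P (exp (ad ℝ L (cg p.1 : L)) (cs p.2))) hU
  have h0 : P (φ (A + t₀ • α)) = P (cs (cs.symm a)) := by rw [hφa, LinearEquiv.apply_symm_apply]
  -- For `t` near `t₀` the moved point is `exp (ad X) H` with `H` still in `C`; equality after `P`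
  -- suffices because `P` is injective on `V`.
  filter_upwards [hcont.continuousAt (h0 ▸ hmap ▸ him)] with t ht
  obtain ⟨⟨ξ, η⟩, hη, h⟩ := ht
  have hξ := expEquiv_mem_isotropyGroup (cg ξ).2
  refine ⟨cs η, hη, (expEquiv (ad ℝ L (cg ξ : L)))⁻¹ * φ, mul_mem (inv_mem hξ) hφ, ?_⟩
  have h1 : expEquiv (ad ℝ L (cg ξ : L)) (cs η) = φ (A + t • α) :=
    hcv _ _ (((isPairAut_of_mem hL.lie_mem_V hξ).mem_V _).2 (hS.le (cs η).2))
      ((hP.mem_V _).2 (add_mem hA (V.smul_mem _ hα))) h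
  change (expEquiv (ad ℝ L (cg ξ : L))).symm (φ (A + t • α)) = cs η
  rw [← h1, LinearEquiv.symm_apply_apply]

end Openness

/-! ### Orthogonality and root components -/

section Decomposition

variable {L : Type*} [LieRing L] [LieAlgebra ℝ L] [FiniteDimensional ℝ L] {𝔤 : LieSubalgebra ℝ L}
  {V S : Submodule ℝ L}

/-- The orthogonal projection to a subspace exists. -/
theorem IsCompactSymmetricPair.exists_orthogonalProjection (hL : IsCompactSymmetricPair 𝔤 V)
    (S : Submodule ℝ L) :
    ∃ π : L →ₗ[ℝ] S, (∀ H : S, π H = H) ∧ (∀ x, (∀ H : S, negKilling x (H : L) = 0) → π x = 0) ∧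
      ∀ x, ∀ H : S, negKilling (π x : L) (H : L) = negKilling x (H : L) := by
  let b : L →ₗ[ℝ] Module.Dual ℝ S :=
    LinearMap.mk₂ ℝ (fun x (H : S) ↦ negKilling x (H : L))
      (fun x y H ↦ negKilling_add_left x y H) (fun c x H ↦ negKilling_smul_left c x H)
      (fun x H H' ↦ negKilling_add_right x H H') (fun c x H ↦ negKilling_smul_right c x H)
  have hinj : Function.Injective (b ∘ₗ S.subtype) := by
    refine (injective_iff_map_eq_zero _).2 fun H hH ↦ Subtype.ext ?_
    exact hL.eq_zero_of_negKilling (LinearMap.congr_fun hH H)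
  let e := LinearMap.linearEquivOfInjective (b ∘ₗ S.subtype) hinj Subspace.dual_finrank_eq.symm
  have he : ∀ H : S, e H = b H := fun H ↦ rfl
  refine ⟨e.symm.toLinearMap ∘ₗ b, fun H ↦ ?_, fun x hx ↦ ?_, fun x H ↦ ?_⟩
  · exact e.symm_apply_apply H
  · have : b x = 0 := LinearMap.ext hx
    simp [this]
  · exact LinearMap.congr_fun ((he _).symm.trans (e.apply_symm_apply (b x))) H

theorem IsCompactSymmetricPair.invol_mem_rootSpace (hL : IsCompactSymmetricPair 𝔤 V) (hS : S ≤ V)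
    {μ : Module.Dual ℝ S} {x : L} (hx : x ∈ rootSpace μ) : hL.invol x ∈ rootSpace μ := by
  intro H
  have h := congrArg hL.invol (hx H)
  rw [hL.invol_lie, hL.invol_lie, hL.invol_of_mem_V (hS H.2), map_smul, neg_lie, neg_lie, lie_neg,
    neg_neg] at h
  exact h

theorem negKilling_eq_zero_of_mem_rootSpace {μ μ' : Module.Dual ℝ S} (h : μ ≠ μ') (h' : μ ≠ -μ')
    {x y : L} (hx : x ∈ rootSpace μ) (hy : y ∈ rootSpace μ') : negKilling x y = 0 := by
  by_contra h0
  refine (LinearMap.eq_or_eq_neg_of_sq_eq fun H ↦ ?_).elim h h'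
  have h1 : negKilling ⁅(H : L), ⁅(H : L), x⁆⁆ y = negKilling x ⁅(H : L), ⁅(H : L), y⁆⁆ := by
    rw [negKilling_lie_skew, negKilling_lie_skew, neg_neg]
  rw [hx H, hy H, negKilling_smul_left, negKilling_smul_right] at h1
  have := mul_right_cancel₀ h0 h1
  linarith

theorem negKilling_sum_smul_sum_smul {R : Finset (Module.Dual ℝ S)}
    (hR : ∀ μ ∈ R, ∀ μ' ∈ R, μ ≠ μ' → μ ≠ -μ') {y : Module.Dual ℝ S → L}
    (hy : ∀ μ ∈ R, y μ ∈ rootSpace μ) (c d : Module.Dual ℝ S → ℝ) :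
    negKilling (∑ μ ∈ R, c μ • y μ) (∑ μ ∈ R, d μ • y μ) =
      ∑ μ ∈ R, c μ * d μ * negKilling (y μ) (y μ) := by
  rw [negKilling_sum_left]
  refine Finset.sum_congr rfl fun μ hμ ↦ ?_
  rw [negKilling_sum_right, Finset.sum_eq_single_of_mem μ hμ fun μ' hμ' hne ↦ ?_,
    negKilling_smul_left, negKilling_smul_right, mul_assoc]
  rw [negKilling_smul_left, negKilling_smul_right, negKilling_eq_zero_of_mem_rootSpace hne.symm
    (hR μ hμ μ' hμ' hne.symm) (hy μ hμ) (hy μ' hμ'), mul_zero, mul_zero]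

namespace WeightBasis

variable {hL : IsCompactSymmetricPair 𝔤 V} (W : WeightBasis hL S) (hS : IsMaximalAbelian V S)
include W hS

theorem lie_eq_zero_of_conj {φ : L ≃ₗ[ℝ] L} (hφ : IsPairAut 𝔤 V φ) {a : S} (ha : a ∈ regularSet S)
    {x v z : L} (hx : φ x = a) (hv : v ∈ V) (hxv : ⁅x, v⁆ = 0) (hxz : ⁅x, z⁆ = 0) : ⁅v, z⁆ = 0 := by
  have h1 := congrArg φ hxv
  have h2 := congrArg φ hxz
  rw [hφ.map_lie, hx, map_zero] at h1 h2
  have h3 := W.mem_of_lie_eq_zero hS ha ((hφ.mem_V v).2 hv) h1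
  rw [← φ.map_eq_zero_iff, hφ.map_lie]
  exact W.lie_eq_zero_of_regular hS ha (by rw [h2, lie_zero]) ⟨φ v, h3⟩

/-- The set of values of the weights which are positive at a point. -/
theorem exists_finset_isPositiveRoot [TopologicalSpace L] [IsTopologicalAddGroup L]
    [ContinuousSMul ℝ L] [T2Space L] {C : Set S} (hC : IsOpenChamber C) {A : S} (hA : A ∈ C) :
    ∃ R : Finset (Module.Dual ℝ S), (∀ μ, μ ∈ R ↔ IsPositiveRoot C μ) ∧
      (∀ μ ∈ R, ∀ H ∈ C, 0 < μ H) ∧ (∀ μ ∈ R, ∀ μ' ∈ R, μ ≠ μ' → μ ≠ -μ') ∧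
      ∀ j, W.ν j ≠ 0 → ∃ μ ∈ R, W.ν j = μ ∨ W.ν j = -μ := by
  classical
  refine ⟨(Finset.univ.filter fun j ↦ 0 < W.ν j A).image W.ν, fun μ ↦ ?_, fun μ hμ H hH ↦ ?_,
    fun μ hμ μ' hμ' _ h ↦ ?_, fun j hj ↦ ?_⟩
  · rw [W.isPositiveRoot_iff hS hC hA, Finset.mem_image]
    simp only [Finset.mem_filter, Finset.mem_univ, true_and]
    constructor
    · rintro ⟨j, h, rfl⟩
      exact ⟨h, j, rfl⟩
    · rintro ⟨h, j, rfl⟩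
      exact ⟨j, h, rfl⟩
  · obtain ⟨j, hj, rfl⟩ := Finset.mem_image.1 hμ
    rw [W.chamber_eq hS hC hA] at hH
    exact hH j (by simpa using hj)
  · obtain ⟨j, hj, rfl⟩ := Finset.mem_image.1 hμ
    obtain ⟨i, hi, rfl⟩ := Finset.mem_image.1 hμ'
    simp only [Finset.mem_filter, Finset.mem_univ, true_and] at hi hj
    rw [h, LinearMap.neg_apply] at hj
    linarith
  · have h0 := (W.mem_regularSet_iff hS).1 (W.mem_regularSet_of_mem_chamber hS hC hA) j hj
    rcases h0.lt_or_gt with h | h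
    · obtain ⟨i, hi⟩ := W.exists_neg hS j
      refine ⟨_, Finset.mem_image_of_mem _ (Finset.mem_filter.2 ⟨Finset.mem_univ i, ?_⟩),
        Or.inr (by rw [hi, neg_neg])⟩
      rw [hi, LinearMap.neg_apply]
      linarith
    · exact ⟨_, Finset.mem_image_of_mem _ (Finset.mem_filter.2 ⟨Finset.mem_univ j, h⟩), Or.inl rfl⟩

variable {R : Finset (Module.Dual ℝ S)} (hR0 : ∀ μ ∈ R, μ ≠ 0)
  (hR : ∀ μ ∈ R, ∀ μ' ∈ R, μ ≠ μ' → μ ≠ -μ')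
  (hRν : ∀ j, W.ν j ≠ 0 → ∃ μ ∈ R, W.ν j = μ ∨ W.ν j = -μ)
include hR0 hR hRν

/-- Each nonzero weight determines one `μ ∈ R` up to sign, so the identity can be checked coordinate
by coordinate. It yields the expansions of both `Z` and `[H, K α]`. -/
theorem sum_smul_eq {y : Module.Dual ℝ S → L} (hy : ∀ μ ∈ R, y μ ∈ rootSpace μ)
    (c : Module.Dual ℝ S → ℝ) {x z : L} (hx : x = ∑ μ ∈ R, y μ)
    (hz0 : ∀ j, W.ν j = 0 → W.e.repr z j = 0)
    (hz : ∀ μ ∈ R, ∀ j, (W.ν j = μ ∨ W.ν j = -μ) → W.e.repr z j = c μ * W.e.repr x j) :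
    z = ∑ μ ∈ R, c μ • y μ := by
  have key : ∀ (d : Module.Dual ℝ S → ℝ) j, ∀ μ ∈ R, (W.ν j = μ ∨ W.ν j = -μ) →
      W.e.repr (∑ μ ∈ R, d μ • y μ) j = d μ * W.e.repr (y μ) j := by
    intro d j μ hμ hj
    rw [map_sum, Finsupp.finsetSum_apply, Finset.sum_eq_single_of_mem μ hμ fun μ' hμ' hne ↦ ?_,
      map_smul, Finsupp.smul_apply, smul_eq_mul]
    rw [map_smul, Finsupp.smul_apply, smul_eq_mul]
    by_contra h0
    rcases (W.mem_rootSpace_iff hS).1 (hy μ' hμ') j (right_ne_zero_of_mul h0) with h | h <;>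
      rcases hj with h' | h' <;> rw [h'] at h
    · exact hne h
    · exact hR _ hμ' _ hμ hne h
    · exact hR _ hμ' _ hμ hne h
    · exact hne (by rw [h, neg_neg])
  refine W.e.repr.injective (Finsupp.ext fun j ↦ ?_)
  by_cases hj : W.ν j = 0
  · rw [hz0 j hj, map_sum, Finsupp.finsetSum_apply]
    refine (Finset.sum_eq_zero fun μ hμ ↦ ?_).symm
    rw [map_smul, Finsupp.smul_apply, smul_eq_mul]
    by_contra h0
    rcases (W.mem_rootSpace_iff hS).1 (hy μ hμ) j (right_ne_zero_of_mul h0) with h | h <;>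
      rw [hj] at h
    · exact hR0 μ hμ h
    · exact hR0 μ hμ (by rw [h, neg_zero])
  · obtain ⟨μ, hμ, h⟩ := hRν j hj
    have h1 := key (fun _ ↦ 1) j μ hμ h
    simp only [one_smul, one_mul] at h1
    rw [hz μ hμ j h, key c j μ hμ h, hx, h1]

theorem exists_rootSpace_decomposition : ∃ P : Module.Dual ℝ S → L →ₗ[ℝ] L,
    (∀ μ x, P μ x ∈ rootSpace μ ∧ P μ x ∈ 𝔤) ∧
    ∀ x ∈ 𝔤, (∀ j, W.ν j = 0 → W.e.repr x j = 0) → x = ∑ μ ∈ R, P μ x := by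
  classical
  let Q : Module.Dual ℝ S → L →ₗ[ℝ] L := fun μ ↦ ∑ j with W.ν j = μ ∨ W.ν j = -μ,
    (W.e.coord j).smulRight (W.e j)
  have hQ : ∀ μ x j, W.e.repr (Q μ x) j =
      if W.ν j = μ ∨ W.ν j = -μ then W.e.repr x j else 0 := by
    intro μ x j
    simp only [Q, LinearMap.sum_apply, map_sum, Finsupp.finsetSum_apply,
      LinearMap.smulRight_apply, map_smul, W.e.repr_self, Finsupp.smul_apply, smul_eq_mul,
      Module.Basis.coord_apply, Finsupp.single_apply, mul_ite, mul_one, mul_zero]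
    rw [Finset.sum_ite_eq' ]
    simp
  have hQroot : ∀ μ x, Q μ x ∈ rootSpace μ := fun μ x ↦ (W.mem_rootSpace_iff hS).2 fun j hj ↦ by
    rw [hQ] at hj
    rcases (ite_ne_right_iff.1 hj).1 with h | h
    · exact Or.inl h.symm
    · exact Or.inr (by rw [h, neg_neg])
  -- `Q μ` projects to the weights `±μ`. Averaging with the involution lands in `𝔤` and leaves the
  -- sum unchanged when `x` is fixed by the involution.
  refine ⟨fun μ ↦ (2⁻¹ : ℝ) • (Q μ + hL.invol ∘ₗ Q μ), fun μ x ↦ ⟨?_, ?_⟩, fun x hx hx0 ↦ ?_⟩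
  · exact Submodule.smul_mem _ _ (add_mem (hQroot μ x) (hL.invol_mem_rootSpace hS.le (hQroot μ x)))
  · rw [hL.mem_g_iff]
    simp only [LinearMap.smul_apply, LinearMap.add_apply, LinearMap.comp_apply, map_smul, map_add,
      hL.invol_invol]
    rw [add_comm]
  · have h1 : x = ∑ μ ∈ R, Q μ x := by
      refine W.e.repr.injective (Finsupp.ext fun j ↦ ?_)
      rw [map_sum, Finsupp.finsetSum_apply]
      by_cases hj : W.ν j = 0
      · rw [hx0 j hj]
        refine (Finset.sum_eq_zero fun μ _ ↦ ?_).symm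
        rw [hQ, hx0 j hj, ite_self]
      · obtain ⟨μ, hμ, h⟩ := hRν j hj
        rw [Finset.sum_eq_single_of_mem μ hμ fun μ' hμ' hne ↦ ?_, hQ, if_pos h]
        rw [hQ, if_neg]
        rintro (h' | h') <;> rcases h with h | h <;> rw [h] at h'
        · exact hne h'.symm
        · exact hR _ hμ' _ hμ hne h'.symm
        · exact hR _ hμ _ hμ' hne.symm h'
        · exact hne (neg_injective h').symm
    have h2 : ∑ μ ∈ R, hL.invol (Q μ x) = x := by
      rw [← map_sum, ← h1, hL.invol_of_mem_g hx]
    simp only [LinearMap.smul_apply, LinearMap.add_apply, LinearMap.comp_apply]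
    rw [← Finset.smul_sum, Finset.sum_add_distrib, ← h1, h2, ← two_smul ℝ x, smul_smul]
    norm_num

end WeightBasis

end Decomposition

/-! ### The moving frame -/

section Lift

open LieAlgebra NormedSpace

variable {L : Type*} [LieRing L] [LieAlgebra ℝ L] [FiniteDimensional ℝ L] {𝔤 : LieSubalgebra ℝ L}
  {V S : Submodule ℝ L} [TopologicalSpace L] [IsTopologicalAddGroup L] [ContinuousSMul ℝ L]
  [T2Space L] {hL : IsCompactSymmetricPair 𝔤 V} (W : WeightBasis hL S)
  (hS : IsMaximalAbelian V S)
include W hS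

namespace WeightBasis

/-- The factorization of `ad (α + [η, x])` through `ad x` is what makes the bracket with `K x`
satisfy a homogeneous linear equation. -/
theorem exists_lift {C : Set S} (hC : IsOpenChamber C) {A α : L} (hA : A ∈ V) (hα : α ∈ V)
    {J : Set ℝ} (hJo : IsOpen J) (hJc : IsPreconnected J) (h0 : 0 ∈ J)
    (hJ : J ⊆ regularTimes 𝔤 C A α) :
    ∃ (K : ℝ → Module.End ℝ L) (η : ℝ → L) (T : ℝ → Module.End ℝ L), K 0 = 1 ∧
      (∀ t, K t ∈ isotropyMonoid 𝔤) ∧ ContinuousOn T J ∧ ∀ t ∈ J, HasDerivAt K (K t * ad ℝ L (η t)) t ∧ η t ∈ 𝔤 ∧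
      ⁅A + t • α, ⁅A + t • α, η t⁆⁆ = ⁅A, α⁆ ∧ (∃ u, η t = ⁅A + t • α, u⁆) ∧
      ad ℝ L (α + ⁅η t, A + t • α⁆) = T t * ad ℝ L (A + t • α) := by
  obtain ⟨R, hR⟩ := W.exists_contDiffAt_inverse hS hA hα
  have hconj : ∀ t ∈ J, ∃ a ∈ regularSet S, ∃ φ : L ≃ₗ[ℝ] L, IsPairAut 𝔤 V φ ∧
      φ (A + t • α) = (a : L) := fun t ht ↦ by
    obtain ⟨a, ha, φ, hφ, h⟩ := hJ ht
    exact ⟨a, W.mem_regularSet_of_mem_chamber hS hC ha, φ, isPairAut_of_mem hL.lie_mem_V hφ, h⟩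
  have hx : ∀ t : ℝ, A + t • α ∈ V := fun t ↦ add_mem hA (V.smul_mem _ hα)
  have hy0 : ∀ t : ℝ, ⁅A + t • α, α⁆ = ⁅A, α⁆ := fun t ↦ by simp
  let ℓ : Module.End ℝ L →ₗ[ℝ] Module.End ℝ L :=
    (ad ℝ L : L →ₗ[ℝ] Module.End ℝ L) ∘ₗ LinearMap.applyₗ ⁅A, α⁆
  have hℓ : ∀ t, ℓ (R t) = ad ℝ L (R t ⁅A, α⁆) := fun t ↦ rfl
  have hη : ∀ t ∈ J, R t ⁅A, α⁆ ∈ 𝔤 := fun t ht ↦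
    (hR t (hconj t ht)).2.1 _ (hL.lie_mem_g _ hA _ hα)
  have hsmooth : ∀ t ∈ J, ContDiffAt ℝ 1 (fun t ↦ ℓ (R t)) t := fun t ht ↦
    (LinearMap.toContinuousLinearMap ℓ).contDiff.contDiffAt.comp t (hR t (hconj t ht)).1
  have hJloc : ∀ t ∈ J, ∀ᶠ s in 𝓝 t, s ∈ J := fun t ht ↦ hJo.mem_nhds ht
  obtain ⟨K₀, hK0, hK⟩ := exists_lift_of_local (𝒢 := isotropyMonoid 𝔤) (ζ := fun t ↦ ℓ (R t))
    exists_inv_mem_isotropyMonoid hJo hJc h0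
    (fun t ht ↦ (hsmooth t ht).continuousAt.continuousWithinAt) (fun t ht ↦ by
      obtain ⟨u, -, hu⟩ := exists_local_lift _ (exp_conj_mem_map_ad (𝔤 := 𝔤)) (hsmooth t ht)
        ((hJloc t ht).mono fun s hs ↦ ⟨_, hη s hs, rfl⟩)
      exact ⟨u, hu.mono fun s hs ↦ ⟨closure_exp_le_isotropyMonoid hs.1, hs.2⟩⟩)
  obtain ⟨K, hK0, hKG, hK⟩ : ∃ K : ℝ → Module.End ℝ L, K 0 = 1 ∧ (∀ t, K t ∈ isotropyMonoid 𝔤) ∧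
      ∀ t ∈ J, HasDerivAt K (K t * ℓ (R t)) t := by
    classical
    -- Outside `J` the default value `1` makes membership in the group hold for all times.
    refine ⟨fun t ↦ if t ∈ J then K₀ t else 1, (if_pos h0).trans hK0, fun t ↦ ?_, fun t ht ↦ ?_⟩
    · by_cases ht : t ∈ J
      · simpa only [if_pos ht] using (hK t ht).1
      · simpa only [if_neg ht] using one_mem _
    · simp only [if_pos ht]
      refine (hK t ht).2.congr_of_eventuallyEq ?_
      filter_upwards [hJloc t ht] with s hs
      exact if_pos hs
  have hRc : ContinuousOn R J := fun t ht ↦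
    (hR t (hconj t ht)).1.continuousAt.continuousWithinAt
  have hβ : ContinuousOn (fun t ↦ ad ℝ L (α + ⁅R t ⁅A, α⁆, A + t • α⁆)) J := by
    have hN : Continuous fun t : ℝ ↦ ad ℝ L (A + t • α) := by
      simp only [map_add, map_smul]
      fun_prop
    have hc : ContinuousOn (fun t ↦ ad ℝ L α + (ℓ (R t) * ad ℝ L (A + t • α) -
        ad ℝ L (A + t • α) * ℓ (R t))) J := by
      have h1 : ContinuousOn (fun t ↦ ℓ (R t)) J := fun t ht ↦
        (hsmooth t ht).continuousAt.continuousWithinAt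
      exact continuousOn_const.add ((h1.mul hN.continuousOn).sub (hN.continuousOn.mul h1))
    refine hc.congr fun t _ ↦ ?_
    ext z
    simp only [hℓ, LinearMap.add_apply, LinearMap.sub_apply, Module.End.mul_apply, ad_apply,
      add_lie, lie_lie]
  refine ⟨K, fun t ↦ R t ⁅A, α⁆, fun t ↦ ad ℝ L (α + ⁅R t ⁅A, α⁆, A + t • α⁆) * R t *
    ad ℝ L (A + t • α), hK0, hKG, ?_, fun t ht ↦ ?_⟩
  · have hN : Continuous fun t : ℝ ↦ ad ℝ L (A + t • α) := by
      simp only [map_add, map_smul]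
      fun_prop
    exact (hβ.mul hRc).mul hN.continuousOn
  obtain ⟨-, hRg, hcomm, hinv⟩ := hR t (hconj t ht)
  have hcomm' : ∀ z, R t ⁅A + t • α, z⁆ = ⁅A + t • α, R t z⁆ := LinearMap.congr_fun hcomm
  have hinv' : ∀ z, ⁅A + t • α, ⁅A + t • α, R t ⁅A + t • α, z⁆⁆⁆ = ⁅A + t • α, z⁆ :=
    LinearMap.congr_fun hinv
  have h1 : ⁅A + t • α, ⁅A + t • α, R t ⁅A, α⁆⁆⁆ = ⁅A, α⁆ := by rw [← hy0 t, hinv']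
  refine ⟨hK t ht, hη t ht, h1, ⟨R t α, by rw [← hcomm', hy0]⟩, ?_⟩
  obtain ⟨a, ha, φ, hφ, hφa⟩ := hconj t ht
  -- By the inverse property `z - R[x, [x, z]]` commutes with `x`, and so does `α + [η, x] ∈ V`. By
  -- conjugation to a regular point of `S` the two commute with each other.
  ext z
  simp only [Module.End.mul_apply, ad_apply]
  rw [← sub_eq_zero, ← lie_sub]
  refine W.lie_eq_zero_of_conj hS hφ ha hφa
    (add_mem hα (hL.lie_mem_V _ (hη t ht) _ (hx t))) ?_ ?_
  · rw [lie_add, ← lie_skew (R t _), lie_neg, h1, hy0, add_neg_cancel]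
  · rw [lie_sub, hcomm', hcomm', ← hcomm', hcomm', ← hcomm', hinv', sub_self]

/-- The curve which is moved by the lift stays in the section. -/
theorem lift_mem {A α : L} (hA : A ∈ S) (hα : α ∈ V) {J : Set ℝ} (hJo : IsOpen J)
    (hJc : IsPreconnected J) (h0 : 0 ∈ J) {K : ℝ → Module.End ℝ L} {η : ℝ → L}
    {T : ℝ → Module.End ℝ L} (hK0 : K 0 = 1) (hT : ContinuousOn T J)
    (hK : ∀ t, K t ∈ isotropyMonoid 𝔤)
    (hK' : ∀ t ∈ J, HasDerivAt K (K t * ad ℝ L (η t)) t)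
    (hTN : ∀ t ∈ J, ad ℝ L (α + ⁅η t, A + t • α⁆) = T t * ad ℝ L (A + t • α)) :
    ∀ t ∈ J, K t (A + t • α) ∈ S := by
  obtain ⟨π, hπ, -⟩ := hL.exists_orthogonalProjection S
  let p : Module.End ℝ L := S.subtype ∘ₗ π
  have hunit : ∀ t ∈ J, ∃ u : (Module.End ℝ L)ˣ, (u : Module.End ℝ L) = K t := fun t ht ↦ by
    obtain ⟨g', -, h1, h2⟩ := exists_inv_mem_isotropyMonoid _ (hK t)
    exact ⟨⟨K t, g', h2, h1⟩, rfl⟩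
  have had : ∀ t ∈ J, ∀ v, ad ℝ L (K t v) = K t * ad ℝ L v * Ring.inverse (K t) := by
    intro t ht v
    obtain ⟨u, hu⟩ := hunit t ht
    obtain ⟨φ, hφ, hφK⟩ := hK t
    rw [← hu, Ring.inverse_unit, Units.eq_mul_inv_iff_mul_eq, hu, ← hφK]
    ext z
    exact ((isPairAut_of_mem hL.lie_mem_V hφ).map_lie v z).symm
  let ℓ₀ : Module.End ℝ L →ₗ[ℝ] Module.End ℝ L :=
    LinearMap.mulRight ℝ p ∘ₗ (ad ℝ L : L →ₗ[ℝ] Module.End ℝ L) ∘ₗ LinearMap.applyₗ A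
  let ℓ₁ : Module.End ℝ L →ₗ[ℝ] Module.End ℝ L :=
    LinearMap.mulRight ℝ p ∘ₗ (ad ℝ L : L →ₗ[ℝ] Module.End ℝ L) ∘ₗ LinearMap.applyₗ α
  -- The curve is `U = ad (K x) ∘ p`, with `p` the projection to `S`. It satisfies `U' = K T K⁻¹ U`
  -- and vanishes at `0`, as `A` commutes with `S`.
  have hU : ∀ t ∈ J, HasDerivAt (fun t ↦ ℓ₀ (K t) + t • ℓ₁ (K t))
      (K t * T t * Ring.inverse (K t) * (ℓ₀ (K t) + t • ℓ₁ (K t))) t := by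
    intro t ht
    have h1 := ((hK' t ht).linearMap_comp ℓ₀).add
      ((hasDerivAt_id t).smul ((hK' t ht).linearMap_comp ℓ₁))
    refine h1.congr_deriv ?_
    have h2 : ∀ X : Module.End ℝ L, ℓ₀ X + t • ℓ₁ X = ad ℝ L (X (A + t • α)) * p := fun X ↦ by
      simp [ℓ₀, ℓ₁, add_mul]
    have h3 : ad ℝ L (K t (α + ⁅η t, A + t • α⁆)) =
        K t * T t * Ring.inverse (K t) * ad ℝ L (K t (A + t • α)) := by
      obtain ⟨u, hu⟩ := hunit t ht
      rw [had t ht, had t ht, hTN t ht, ← hu, Ring.inverse_unit]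
      simp only [mul_assoc, Units.inv_mul_cancel_left]
    rw [h2, ← mul_assoc, ← h3, id, one_smul, ← add_assoc, h2, map_add (K t), map_add (ad ℝ L),
      add_mul, add_comm]
    rfl
  have hcont : ContinuousOn (fun t ↦ ContinuousLinearMap.mul ℝ (Module.End ℝ L)
      (K t * T t * Ring.inverse (K t))) J := by
    refine (ContinuousLinearMap.continuous _).comp_continuousOn ?_
    have h1 : ContinuousOn K J := fun t ht ↦ (hK' t ht).continuousAt.continuousWithinAt
    refine (h1.mul hT).mul fun t ht ↦ ?_
    obtain ⟨u, hu⟩ := hunit t ht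
    exact (ContinuousAt.comp (hu ▸ NormedRing.inverse_continuousAt u)
      (hK' t ht).continuousAt).continuousWithinAt
  have hzero := eqOn_of_linear_ode (f := fun t ↦ ℓ₀ (K t) + t • ℓ₁ (K t)) (g := fun _ ↦ 0) hJo
    hJc.ordConnected hcont hU (fun t _ ↦ by simpa using hasDerivAt_const t (0 : Module.End ℝ L))
    h0 (by
      rw [zero_smul, add_zero, hK0]
      ext z
      exact hS.abelian _ hA _ (π z).2)
  intro t ht
  obtain ⟨φ, hφ, hφK⟩ := hK t
  refine (hS.mem_iff ?_).2 fun H hH ↦ ?_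
  · rw [← hφK]
    exact ((isPairAut_of_mem hL.lie_mem_V hφ).mem_V _).2 (add_mem (hS.le hA) (V.smul_mem _ hα))
  · have h1 := LinearMap.congr_fun (hzero ht) H
    have h2 : ⁅K t A, (π H : L)⁆ + t • ⁅K t α, (π H : L)⁆ = 0 := h1
    rw [hπ ⟨H, hH⟩] at h2
    rw [← lie_skew, map_add, map_smul, add_lie, smul_lie, h2, neg_zero]

end WeightBasis

end Lift

/-! ### The equations of motion -/

theorem mainTheorem4 {L : Type*} [LieRing L] [LieAlgebra ℝ L] [FiniteDimensional ℝ L]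
    [TopologicalSpace L] [IsTopologicalAddGroup L] [ContinuousSMul ℝ L] [T2Space L]
    (𝔤 : LieSubalgebra ℝ L) (V S : Submodule ℝ L)
    (hL : IsCompactSymmetricPair 𝔤 V) (hS : IsMaximalAbelian V S)
    (C : Set S) (hC : IsOpenChamber C) (A : S) (hA : A ∈ C) (α : L) (hα : α ∈ V)
    (J : Set ℝ) (hJ : J = connectedComponentIn (regularTimes 𝔤 C (A : L) α) 0) :
    IsOpen J ∧ 0 ∈ J ∧
    ∃ R : Finset (Module.Dual ℝ S), (∀ μ, μ ∈ R ↔ IsPositiveRoot C μ) ∧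
    -- the ballistic curve `a`, its velocity `p` and acceleration `q`
    ∃ a p q : ℝ → S,
      (∀ t ∈ J, a t ∈ C ∧ ∀ x : S, x ∈ closure C ∧ SameOrbit 𝔤 ((A : L) + t • α) (x : L) ↔
        x = a t) ∧
      (∀ t ∈ J, HasDerivAt a (p t) t ∧ HasDerivAt p (q t) t) ∧
    -- a lift `k` to the group which moves the line into the chamber, and the moved momentum `Y`
    ∃ k : ℝ → (L ≃ₗ[ℝ] L), ∃ Y : ℝ → L, ∃ Yc : Module.Dual ℝ S → ℝ → L, ∃ Z : ℝ → L,
      k 0 = 1 ∧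
      (∀ t ∈ J, k t ∈ isotropyGroup 𝔤 ∧ (∀ v : L, DifferentiableAt ℝ (fun s => k s v) t) ∧
        k t ((A : L) + t • α) = (a t : L)) ∧
      (∀ t ∈ J, Y t = k t ⁅(A : L), α⁆ ∧ Y t = ⁅(a t : L), k t α⁆) ∧
      (∀ t ∈ J, (∀ μ ∈ R, Yc μ t ∈ rootSpace μ ∧ Yc μ t ∈ 𝔤) ∧ Y t = ∑ μ ∈ R, Yc μ t) ∧
      (∀ t ∈ J, Z t = ∑ μ ∈ R, ((μ (a t)) ^ 2)⁻¹ • Yc μ t) ∧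
      -- the equations of motion
      (∀ t ∈ J, ∀ H : S, negKilling (q t : L) (H : L) =
        ∑ μ ∈ R, negKilling (Yc μ t) (Yc μ t) / (μ (a t)) ^ 3 * μ H) ∧
      (∀ t ∈ J, HasDerivAt Y ⁅Y t, Z t⁆ t) ∧
      -- the energy of the line is the spin Calogero-Moser Hamiltonian
      (∀ t ∈ J, (1 / 2 : ℝ) * negKilling α α = (1 / 2 : ℝ) * negKilling (p t : L) (p t : L) +
        (1 / 2 : ℝ) * ∑ μ ∈ R, negKilling (Yc μ t) (Yc μ t) / (μ (a t)) ^ 2) := by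
  classical
  obtain ⟨W⟩ := hL.nonempty_weightBasis hS
  have hAV : (A : L) ∈ V := hS.le A.2
  have h0t : (0 : ℝ) ∈ regularTimes 𝔤 C (A : L) α := ⟨A, hA, 1, one_mem _, by simp⟩
  have hJo : IsOpen J := hJ ▸ (isOpen_regularTimes W hS hC hAV hα).connectedComponentIn
  have h0 : 0 ∈ J := hJ ▸ mem_connectedComponentIn h0t
  have hJc : IsPreconnected J := hJ ▸ isPreconnected_connectedComponentIn
  have hJr : J ⊆ regularTimes 𝔤 C (A : L) α := hJ ▸ connectedComponentIn_subset _ _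
  clear hJ
  obtain ⟨R, hR, hRC, hRneg, hRν⟩ := W.exists_finset_isPositiveRoot hS hC hA
  have hR0 : ∀ μ ∈ R, μ ≠ 0 := fun μ hμ h ↦ by simpa [h] using hRC μ hμ A hA
  obtain ⟨π, hπ, hπ0, hπB⟩ := hL.exists_orthogonalProjection S
  obtain ⟨P, hP, hPsum⟩ := W.exists_rootSpace_decomposition hS hR0 hRneg hRν
  obtain ⟨K, η, T, hK0, hKG, hT, hlift⟩ := W.exists_lift hS hC hAV hα hJo hJc h0 hJr
  have hKS := W.lift_mem hS A.2 hα hJo hJc h0 hK0 hT hKG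
    (fun t ht ↦ (hlift t ht).1) (fun t ht ↦ (hlift t ht).2.2.2.2)
  choose hK' hηg hηη hηim _ using hlift
  choose φ hφG hφK using hKG
  have hφK' : ∀ t v, φ t v = K t v := fun t v ↦ LinearMap.congr_fun (hφK t) v
  have hpair : ∀ t, IsPairAut 𝔤 V (φ t) := fun t ↦ isPairAut_of_mem hL.lie_mem_V (hφG t)
  have hKlie : ∀ t, ∀ u v, K t ⁅u, v⁆ = ⁅K t u, K t v⁆ := fun t u v ↦ by
    rw [← hφK' t, ← hφK' t, ← hφK' t, (hpair t).map_lie]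
  have hKV : ∀ t, ∀ v ∈ V, K t v ∈ V := fun t v hv ↦ by
    rw [← hφK' t]
    exact ((hpair t).mem_V v).2 hv
  have hKg : ∀ t, ∀ v ∈ 𝔤, K t v ∈ 𝔤 := fun t v hv ↦ by
    rw [← hφK' t]
    exact ((hpair t).mem_g v).2 hv
  let a : ℝ → S := fun t ↦ π (K t (A + t • α))
  have ha : ∀ t ∈ J, (a t : L) = K t (A + t • α) := fun t ht ↦
    congrArg Subtype.val (hπ ⟨_, hKS t ht⟩)
  let ℓ : Module.End ℝ L × Module.End ℝ L →ₗ[ℝ] S := π ∘ₗ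
    (LinearMap.applyₗ (A : L)).coprod (LinearMap.applyₗ α)
  have haℓ : a = fun t ↦ ℓ (K t, t • K t) := by
    ext t
    simp [a, ℓ]
  have hcurve : ∀ t ∈ J, HasDerivAt (fun t ↦ (K t, t • K t))
      (K t * LieAlgebra.ad ℝ L (η t), t • (K t * LieAlgebra.ad ℝ L (η t)) + K t) t := fun t ht ↦ by
    refine (hK' t ht).prodMk (((hasDerivAt_id t).smul (hK' t ht)).congr_deriv ?_)
    rw [id, one_smul]
  have hπlie : ∀ t ∈ J, ∀ X, π ⁅X, (a t : L)⁆ = 0 := fun t ht X ↦ hπ0 _ fun H ↦ by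
    rw [negKilling_lie, hS.abelian _ (a t).2 _ H.2, negKilling_zero_right]
  have ha' : ∀ t ∈ J, HasDerivAt a (π (K t α)) t := fun t ht ↦ by
    rw [haℓ]
    have h2 := (hcurve t ht).linearMap_comp ℓ
    have h1 : ℓ (K t * LieAlgebra.ad ℝ L (η t), t • (K t * LieAlgebra.ad ℝ L (η t)) + K t) =
        π (K t ⁅η t, A + t • α⁆) + π (K t α) := by
      simp [ℓ, add_assoc]
    rwa [h1, hKlie t, ← ha t ht, hπlie t ht, zero_add] at h2
  -- Every `a t` is conjugate to a point of `C`, hence regular; by continuity the curve cannot leave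
  -- the component of `a 0 = A`.
  have haC : ∀ t ∈ J, a t ∈ C := by
    have hcont : ContinuousOn a J := fun t ht ↦ by
      rw [haℓ]
      exact (ℓ.continuous_of_finiteDimensional.continuousAt.comp
        (hcurve t ht).continuousAt).continuousWithinAt
    have hsub : a '' J ⊆ regularSet S := by
      rintro _ ⟨t, ht, rfl⟩
      obtain ⟨b, hb, ψ, hψ, hψb⟩ := hJr ht
      refine W.mem_regularSet_of_map hS (φ := φ t * ψ⁻¹) (isPairAut_of_mem hL.lie_mem_V
        (mul_mem (hφG t) (inv_mem hψ))) (W.mem_regularSet_of_mem_chamber hS hC hb) ?_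
      rw [ha t ht, ← hφK' t, ← hψb]
      exact congrArg (φ t) (ψ.symm_apply_apply _)
    have ha0 : a 0 = A := Subtype.ext (by rw [ha 0 h0, hK0]; simp)
    obtain ⟨H₀, hH₀, hCeq⟩ := hC
    have h1 := (hJc.image a hcont).subset_connectedComponentIn ⟨0, h0, ha0⟩ hsub
    rw [← connectedComponentIn_eq (hCeq ▸ hA), ← hCeq] at h1
    exact fun t ht ↦ h1 ⟨t, ht, rfl⟩
  have haR : ∀ t ∈ J, ∀ μ ∈ R, 0 < μ (a t) := fun t ht μ hμ ↦ hRC μ hμ _ (haC t ht)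
  let Y : ℝ → L := fun t ↦ K t ⁅(A : L), α⁆
  let Z : ℝ → L := fun t ↦ -K t (η t)
  have hYa : ∀ t ∈ J, Y t = ⁅(a t : L), K t α⁆ := fun t ht ↦ by
    rw [ha t ht, ← hKlie t, add_lie, smul_lie, lie_self, smul_zero, add_zero]
  have hYg : ∀ t ∈ J, Y t ∈ 𝔤 := fun t ht ↦ hKg t _ (hL.lie_mem_g _ hAV _ hα)
  have hYsum : ∀ t ∈ J, Y t = ∑ μ ∈ R, P μ (Y t) := fun t ht ↦ by
    refine hPsum _ (hYg t ht) fun j hj ↦ ?_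
    rw [hYa t ht, W.repr_lie, hj, LinearMap.zero_apply, zero_mul]
  have hZZ : ∀ t ∈ J, ⁅(a t : L), ⁅(a t : L), Z t⁆⁆ = -Y t := fun t ht ↦ by
    rw [ha t ht, lie_neg, lie_neg, ← hKlie t, ← hKlie t, hηη t ht]
  have hroot : ∀ t, ∀ μ ∈ R, P μ (Y t) ∈ rootSpace μ := fun t μ _ ↦ (hP μ _).1
  have hval : ∀ {μ : Module.Dual ℝ S} {j}, (W.ν j = μ ∨ W.ν j = -μ) → ∃ s : ℝ, s * s = 1 ∧
      ∀ H, W.ν j H = s * μ H := by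
    rintro μ j (h | h)
    · exact ⟨1, by norm_num, fun H ↦ by rw [h, one_mul]⟩
    · exact ⟨-1, by norm_num, fun H ↦ by rw [h, neg_one_mul, LinearMap.neg_apply]⟩
  -- `Z` lies in the image of `ad a`, so it has no zero weight component, and `(ad a)² Z = -Y`
  -- determines the others.
  have hZsum : ∀ t ∈ J, Z t = ∑ μ ∈ R, ((μ (a t)) ^ 2)⁻¹ • P μ (Y t) := fun t ht ↦ by
    refine W.sum_smul_eq hS hR0 hRneg hRν (hroot t) (fun μ ↦ ((μ (a t)) ^ 2)⁻¹) (hYsum t ht)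
      (fun j hj ↦ ?_) (fun μ hμ j hj ↦ ?_)
    · obtain ⟨u, hu⟩ := hηim t ht
      simp only [Z]
      rw [hu, hKlie t, ← ha t ht, map_neg, Finsupp.neg_apply, W.repr_lie, hj,
        LinearMap.zero_apply, zero_mul, neg_zero]
    · obtain ⟨s, hs, h⟩ := hval hj
      have h1 := W.repr_lie_lie hS (a t) (a t) (Z t) j
      rw [hZZ t ht, map_neg, Finsupp.neg_apply, h] at h1
      have h2 := (haR t ht μ hμ).ne'
      have h3 : W.e.repr (Y t) j = μ (a t) ^ 2 * W.e.repr (Z t) j := by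
        linear_combination -h1 + μ (a t) ^ 2 * W.e.repr (Z t) j * hs
      rw [h3, inv_mul_cancel_left₀ (pow_ne_zero 2 h2)]
  -- `Y = [a, K α]` and `[H, K α]` have coordinates with the same factor from `K α`, in the ratio
  -- `μ(a)` to `μ(H)`.
  have hHsum : ∀ t ∈ J, ∀ H : S, ⁅(H : L), K t α⁆ = ∑ μ ∈ R, (μ H / μ (a t)) • P μ (Y t) := by
    intro t ht H
    refine W.sum_smul_eq hS hR0 hRneg hRν (hroot t) (fun μ ↦ μ H / μ (a t)) (hYsum t ht)
      (fun j hj ↦ ?_) (fun μ hμ j hj ↦ ?_)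
    · rw [W.repr_lie, hj, LinearMap.zero_apply, zero_mul]
    · obtain ⟨s, hs, h⟩ := hval hj
      have h2 := (haR t ht μ hμ).ne'
      rw [hYa t ht, W.repr_lie, W.repr_lie, h, h]
      field_simp
  have hα' : ∀ t ∈ J, K t α = (π (K t α) : L) + ⁅Z t, (a t : L)⁆ := by
    intro t ht
    have hmem : K t (α + ⁅η t, A + t • α⁆) ∈ S := by
      refine W.mem_of_lie_eq_zero hS (W.mem_regularSet_of_mem_chamber hS hC (haC t ht))
        (hKV t _ (add_mem hα (hL.lie_mem_V _ (hηg t ht) _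
          (add_mem hAV (V.smul_mem _ hα))))) ?_
      rw [ha t ht, ← hKlie t, lie_add, ← lie_skew (η t), lie_neg, hηη t ht, add_lie, smul_lie,
        lie_self, smul_zero, add_zero, add_neg_cancel, map_zero]
    have h1 : π (K t (α + ⁅η t, A + t • α⁆)) = π (K t α) := by
      rw [map_add, map_add, hKlie t, ← ha t ht, hπlie t ht, add_zero]
    have h2 : (π (K t (α + ⁅η t, A + t • α⁆)) : L) = K t (α + ⁅η t, A + t • α⁆) :=
      congrArg Subtype.val (hπ ⟨_, hmem⟩)
    rw [← h1, h2, ha t ht, neg_lie, ← hKlie t, map_add, add_neg_cancel_right]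
  have hvec : ∀ (v : L), ∀ t ∈ J, HasDerivAt (fun t ↦ K t v) (K t ⁅η t, v⁆) t := fun v t ht ↦
    (hK' t ht).linearMap_comp (LinearMap.applyₗ v)
  refine ⟨hJo, h0, R, hR, a, fun t ↦ π (K t α), fun t ↦ π (K t ⁅η t, α⁆), fun t ht ↦ ⟨haC t ht,
    fun x ↦ ⟨?_, ?_⟩⟩, fun t ht ↦ ⟨ha' t ht, (hK' t ht).linearMap_comp
      (π ∘ₗ LinearMap.applyₗ α)⟩, φ, Y, fun μ t ↦ P μ (Y t), Z, ?_,
    fun t ht ↦ ⟨?_, fun v ↦ ?_, ?_⟩, fun t ht ↦ ⟨?_, ?_⟩, fun t ht ↦ ⟨fun μ _ ↦ hP μ _, hYsum t ht⟩,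
    hZsum, fun t ht H ↦ ?_, fun t ht ↦ ?_, fun t ht ↦ ?_⟩
  · rintro ⟨hx, ψ, hψ, hψx⟩
    refine W.eq_of_map_eq hS hC (haC t ht) hx (mul_mem hψ (inv_mem (hφG t))) ?_
    rw [ha t ht, ← hφK' t, ← hψx]
    exact congrArg ψ ((φ t).symm_apply_apply _)
  · rintro rfl
    exact ⟨subset_closure (haC t ht), φ t, hφG t, by rw [hφK' t, ha t ht]⟩
  · ext v
    rw [hφK' 0, hK0]
    rfl
  · exact hφG t
  · simp only [hφK']
    exact ⟨_, hvec v t ht⟩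
  · rw [hφK' t, ha t ht]
  · rw [hφK' t]
  · rw [hφK' t, hYa t ht]
  -- By invariance `⟨a'', H⟩ = -⟨[Z, K α], H⟩ = ⟨Z, [H, K α]⟩`; the weights `μ(a)⁻²` and `μ(H)/μ(a)`
  -- combine to the inverse cube.
  · rw [hπB, hKlie t, ← neg_neg ⁅K t (η t), K t α⁆, ← neg_lie, negKilling_neg_left,
      negKilling_lie, ← lie_skew, negKilling_neg_right, neg_neg, hHsum t ht H]
    change negKilling (Z t) _ = _
    rw [hZsum t ht, negKilling_sum_smul_sum_smul hRneg (hroot t)]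
    refine Finset.sum_congr rfl fun μ hμ ↦ ?_
    have h2 := (haR t ht μ hμ).ne'
    field_simp
  · have h1 := hvec ⁅(A : L), α⁆ t ht
    have h2 : K t ⁅η t, ⁅(A : L), α⁆⁆ = ⁅Y t, Z t⁆ := by rw [hKlie t, ← lie_skew, ← lie_neg]
    rwa [h2] at h1
  · have h1 : negKilling α α = negKilling (K t α) (K t α) := by
      rw [← hφK' t, negKilling_map (hpair t).map_lie]
    have h2 : ∀ H : S, negKilling (H : L) ⁅Z t, (a t : L)⁆ = 0 := fun H ↦ by
      rw [negKilling_comm, negKilling_lie, hS.abelian _ (a t).2 _ H.2, negKilling_zero_right]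
    have h3 : negKilling ⁅Z t, (a t : L)⁆ ⁅Z t, (a t : L)⁆ =
        ∑ μ ∈ R, negKilling (P μ (Y t)) (P μ (Y t)) / (μ (a t)) ^ 2 := by
      -- `‖[Z, a]‖² = -⟨Z, [a, [a, Z]]⟩ = ⟨Z, Y⟩`.
      rw [negKilling_lie, ← lie_skew (Z t), lie_neg, hZZ t ht, neg_neg]
      have h4 : Y t = ∑ μ ∈ R, (1 : ℝ) • P μ (Y t) := by
        simp only [one_smul]
        exact hYsum t ht
      have h5 := negKilling_sum_smul_sum_smul hRneg (hroot t) (fun μ ↦ ((μ (a t)) ^ 2)⁻¹) fun _ ↦ 1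
      rw [← h4, ← hZsum t ht] at h5
      rw [h5]
      exact Finset.sum_congr rfl fun μ _ ↦ by rw [mul_one, inv_mul_eq_div]
    rw [h1, ← h3]
    conv_lhs => rw [hα' t ht]
    rw [negKilling_add_left, negKilling_add_right, negKilling_add_right, h2,
      negKilling_comm ⁅Z t, (a t : L)⁆ (π (K t α) : L), h2]
    ring
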